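/- Let $\mathbf k$ be a field and let $H$ be a finite-dimensional quasi-Hopf algebra over $\mathbf k$: a unital algebra with unital algebra maps $\Delta:H\to H\otimes H$, $\epsilon:H\to\mathbf k$, an invertible $\phi=X\otimes Y\otimes Z\in H^{\otimes 3}$ with inverse $\phi^{-1}=\bar X\otimes\bar Y\otimes\bar Z$ (summation symbols are suppressed), a bijective antipode $S$ and elements $\alpha,\beta\in H$, satisfying $(\mathrm{id}\otimes\Delta)(\Delta(a))\,\phi=\phi\,(\Delta\otimes\mathrm{id})(\Delta(a))$, $(\mathrm{id}\otimes\mathrm{id}\otimes\Delta)(\phi)\,(\Delta\otimes\mathrm{id}\otimes\mathrm{id})(\phi)=(1\otimes\phi)\,(\mathrm{id}\otimes\Delta\otimes\mathrm{id})(\phi)\,(\phi\otimes1)$, $(\epsilon\otimes\mathrm{id})\Delta=\mathrm{id}=(\mathrm{id}\otimes\epsilon)\Delta$, $(\mathrm{id}\otimes\epsilon\otimes\mathrm{id})(\phi)=1\otimes 1$, where $S$ is a linear anti-automorphism with $S(a_{(1)})\alpha a_{(2)}=\epsilon(a)\alpha$, $a_{(1)}\beta S(a_{(2)})=\epsilon(a)\beta$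 and $X\beta S(Y)\alpha Z=1=S(\bar X)\alpha\bar Y\beta S(\bar Z)$. Let $\hat H=\mathrm{Hom}_{\mathbf k}(H,\mathbf k)$, $\langle a\rightharpoonup\psi\mid b\rangle=\psi(ba)$, $\langle\psi\leftharpoonup a\mid b\rangle=\psi(ab)$, and $a\leftharpoonup\nu=\nu(a_{(1)})a_{(2)}$ for $\nu\in\hat H$. Let $\mu:H\to\mathbf k$ be the modulus of $H$, i.e. the algebra map $\mu=\epsilon\circ\theta^{-1}$, where $\theta$ is the modular automorphism ($\omega(ab)=\omega(b\,\theta(a))$) of any nondegenerate functional $\omega$ on $H$. The map $\tau:H\to H$, $\tau(a)=a\leftharpoonup\mu$, is an algebra automorphism. Write $t^{21}$ for the flip of $t\in H\otimes H$. Let $\gamma=S(U')\alpha V'\otimes S(T')\alpha W'$ with $T'\otimes U'\otimes V'\otimes W'=(1\otimes\phi^{-1})(\mathrm{id}\otimes\mathrm{id}\otimes\Delta)(\phi)$; let $f=(S\otimes S)(\Delta^{op}(\bar X))\,\gamma\,\Delta(\bar Y\beta S(\bar Z))$ (an invertible element of $H\otimes H$), $h=(S^{-1}\otimes S^{-1})(f^{21})$,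 $q_R=q_R^1\otimes q_R^2=X\otimes S^{-1}(\alpha Z)Y$, $p_R=\bar X\otimes\bar Y\beta S(\bar Z)$, $U=f^{-1}(S\otimes S)(q_R^{21})$, $V=(S^{-1}\otimes S^{-1})(p_R^{21})\,h$ and $\bar\Delta(a)=V\Delta(a)U$. Let $H^*$ be the quasi-Hopf $H$-bimodule $\hat H$ with $a\cdot\psi\cdot b=S(b)\rightharpoonup\psi\leftharpoonup S^{-1}(a)$ and coaction $\rho:H^*\to H^*\otimes H\cong\mathrm{Hom}_{\mathbf k}(H,H)$, $\rho(\psi)(a)=(\mathrm{id}\otimes\psi)(\bar\Delta(a))$. A left cointegral on $H$ is a coinvariant of $H^*$, i.e. an element of the image of $E:H^*\to H^*$, $E(\psi)=q_R^1\cdot\psi_{(0)}\cdot\beta S(q_R^2\psi_{(1)})$. Let $H_\mu$ be the quasi-Hopf $H$-bimodule $H$ with $a\cdot x\cdot b=\tau(a)xb$ and coaction $x\mapsto T_\mu\Delta(x)$, where $T_\mu=\mu(\bar X)\bar Y\otimes\bar Z$. A Fourier transformation is a nonzero morphism of quasi-Hopf $H$-bimodules $H_\mu\to H^*$, i.e.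 a nonzero $H$-bimodule map that intertwines the coactions. For $\lambda\in\hat H$ put $\mathcal F_\lambda(a)=S(a)\rightharpoonup\lambda$ and $\mathcal F'_\lambda(a)=\lambda\leftharpoonup S^{-1}(\tau^{-1}(a))$. Then for every $0\neq\lambda\in\hat H$ the following are equivalent: (i) $\lambda$ is a left cointegral; (ii) $\mathcal F_\lambda$ is a Fourier transformation; (iii) $\rho(\mathcal F_\lambda(a))=(\mathcal F_\lambda\otimes\mathrm{id})(T_\mu\Delta(a))$ for all $a\in H$; (iv) $\rho(\mathcal F'_\lambda(a))=(\mathcal F'_\lambda\otimes\mathrm{id})(T_\mu\Delta(a))$ for all $a\in H$. -/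

import Mathlib

open scoped TensorProduct

noncomputable section

/-- A quasi-Hopf algebra structure with invertible antipode on a `k`-algebra `H`.
Triple and quadruple tensor powers of `H` are bracketed to the right. -/
structure QuasiHopfAlgebra (k : Type*) (H : Type*) [Field k] [Ring H] [Algebra k H] where
  /-- the coproduct `Δ` -/
  comul : H →ₐ[k] H ⊗[k] H
  /-- the counit `ε` -/
  counit : H →ₐ[k] k
  /-- the reassociator `φ = X ⊗ Y ⊗ Z`, with inverse `φ⁻¹ = X̄ ⊗ Ȳ ⊗ Z̄` -/
  phi : (H ⊗[k] (H ⊗[k] H))ˣ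
  /-- `(id ⊗ Δ)(Δ a) φ = φ (Δ ⊗ id)(Δ a)` -/
  quasi_coassoc : ∀ a : H,
    Algebra.TensorProduct.map (AlgHom.id k H) comul (comul a) * phi.val =
      phi.val * Algebra.TensorProduct.assoc k k k H H H
        (Algebra.TensorProduct.map comul (AlgHom.id k H) (comul a))
  /-- `(id ⊗ id ⊗ Δ)(φ) (Δ ⊗ id ⊗ id)(φ) = (1 ⊗ φ) (id ⊗ Δ ⊗ id)(φ) (φ ⊗ 1)` -/
  pentagon :
    Algebra.TensorProduct.map (AlgHom.id k H)
        (Algebra.TensorProduct.map (AlgHom.id k H) comul) phi.val *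
      Algebra.TensorProduct.assoc k k k H H (H ⊗[k] H)
        (Algebra.TensorProduct.map comul (AlgHom.id k (H ⊗[k] H)) phi.val) =
    ((1 : H) ⊗ₜ[k] phi.val) *
      Algebra.TensorProduct.map (AlgHom.id k H)
        ((Algebra.TensorProduct.assoc k k k H H H).toAlgHom.comp
          (Algebra.TensorProduct.map comul (AlgHom.id k H))) phi.val *
      Algebra.TensorProduct.map (AlgHom.id k H)
        (Algebra.TensorProduct.assoc k k k H H H).toAlgHom
        (Algebra.TensorProduct.assoc k k k H (H ⊗[k] H) H (phi.val ⊗ₜ[k] (1 : H)))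
  /-- `(ε ⊗ id) ∘ Δ = id` -/
  counit_comul : ∀ a : H, Algebra.TensorProduct.lid k H
    (Algebra.TensorProduct.map counit (AlgHom.id k H) (comul a)) = a
  /-- `(id ⊗ ε) ∘ Δ = id` -/
  comul_counit : ∀ a : H, Algebra.TensorProduct.rid k k H
    (Algebra.TensorProduct.map (AlgHom.id k H) counit (comul a)) = a
  /-- `(id ⊗ ε ⊗ id)(φ) = 1 ⊗ 1` -/
  counit_phi : Algebra.TensorProduct.map (AlgHom.id k H)
    ((Algebra.TensorProduct.lid k H).toAlgHom.comp
      (Algebra.TensorProduct.map counit (AlgHom.id k H))) phi.val = 1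
  /-- the (invertible) antipode `S` -/
  S : H ≃ₗ[k] H
  S_one : S 1 = 1
  S_mul : ∀ a b : H, S (a * b) = S b * S a
  /-- the element `α` -/
  alpha : H
  /-- the element `β` -/
  beta : H
  /-- `S(a₍₁₎) α a₍₂₎ = ε(a) α` -/
  antipode_alpha : ∀ a : H, LinearMap.mul' k H
    (TensorProduct.map S.toLinearMap (LinearMap.mulLeft k alpha) (comul a)) = counit a • alpha
  /-- `a₍₁₎ β S(a₍₂₎) = ε(a) β` -/
  antipode_beta : ∀ a : H, LinearMap.mul' k H
    (TensorProduct.map (LinearMap.mulRight k beta) S.toLinearMap (comul a)) = counit a • beta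
  /-- `X β S(Y) α Z = 1` -/
  phi_beta_alpha : LinearMap.mul' k H
    (TensorProduct.map (LinearMap.mulRight k beta)
      (LinearMap.mul' k H ∘ₗ TensorProduct.map S.toLinearMap (LinearMap.mulLeft k alpha))
      phi.val) = 1
  /-- `S(X̄) α Ȳ β S(Z̄) = 1` -/
  phi_inv_alpha_beta : LinearMap.mul' k H
    (TensorProduct.map S.toLinearMap
      (LinearMap.mul' k H ∘ₗ TensorProduct.map (LinearMap.mulLeft k alpha)
        (LinearMap.mulLeft k beta ∘ₗ S.toLinearMap))
      phi.inv) = 1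

namespace QuasiHopfAlgebra

variable {k : Type*} {H : Type*} [Field k] [Ring H] [Algebra k H] (Q : QuasiHopfAlgebra k H)

/-! ### The canonical elements of `H ⊗ H` -/

/-- The flip `x ⊗ y ↦ y ⊗ x`, i.e. `t ↦ t²¹`. -/
def tflip : H ⊗[k] H →ₗ[k] H ⊗[k] H := (TensorProduct.comm k H H).toLinearMap

/-- `S ⊗ S` -/
def SS : H ⊗[k] H →ₗ[k] H ⊗[k] H := TensorProduct.map Q.S.toLinearMap Q.S.toLinearMap

/-- `S⁻¹ ⊗ S⁻¹` -/
def SSinv : H ⊗[k] H →ₗ[k] H ⊗[k] H :=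
  TensorProduct.map Q.S.symm.toLinearMap Q.S.symm.toLinearMap

/-- `T ⊗ U ⊗ V ⊗ W = (1 ⊗ φ⁻¹) (id ⊗ id ⊗ Δ)(φ)` -/
def tuvw : H ⊗[k] (H ⊗[k] (H ⊗[k] H)) :=
  ((1 : H) ⊗ₜ[k] Q.phi.inv) *
    Algebra.TensorProduct.map (AlgHom.id k H)
      (Algebra.TensorProduct.map (AlgHom.id k H) Q.comul) Q.phi.val

/-- The linear map `x ⊗ y ↦ S(x) α y`. -/
def sAlpha : H ⊗[k] H →ₗ[k] H :=
  LinearMap.mul' k H ∘ₗ TensorProduct.map Q.S.toLinearMap (LinearMap.mulLeft k Q.alpha)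

/-- The linear map `x ⊗ y ↦ x β S(y)`. -/
def betaS : H ⊗[k] H →ₗ[k] H :=
  LinearMap.mul' k H ∘ₗ TensorProduct.map (LinearMap.mulRight k Q.beta) Q.S.toLinearMap

/-- `γ = S(U) α V ⊗ S(T) α W` -/
def gamma : H ⊗[k] H :=
  TensorProduct.map Q.sAlpha Q.sAlpha
    (TensorProduct.tensorTensorTensorComm k H H H H
      (TensorProduct.map tflip LinearMap.id
        ((TensorProduct.assoc k H H (H ⊗[k] H)).symm Q.tuvw)))

/-- Drinfeld's twist `f = (S ⊗ S)(Δᵒᵖ(X̄)) γ Δ(Ȳ β S(Z̄))`. -/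
def f : H ⊗[k] H :=
  LinearMap.mul' k (H ⊗[k] H)
    (TensorProduct.map (Q.SS ∘ₗ tflip ∘ₗ Q.comul.toLinearMap)
      (LinearMap.mulLeft k Q.gamma ∘ₗ Q.comul.toLinearMap ∘ₗ Q.betaS) Q.phi.inv)

/-- The inverse of Drinfeld's twist `f`, which is a unit of `H ⊗ H` (a theorem of Drinfeld). -/
def fInv : H ⊗[k] H := Ring.inverse Q.f

/-- `h = (S⁻¹ ⊗ S⁻¹)(f²¹)` -/
def h : H ⊗[k] H := Q.SSinv (tflip Q.f)

/-- `q_R = X ⊗ S⁻¹(α Z) Y` -/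
def qR : H ⊗[k] H :=
  TensorProduct.map LinearMap.id
    (LinearMap.mul' k H ∘ₗ
      TensorProduct.map (Q.S.symm.toLinearMap ∘ₗ LinearMap.mulLeft k Q.alpha) LinearMap.id ∘ₗ
      tflip) Q.phi.val

/-- `p_R = X̄ ⊗ Ȳ β S(Z̄)` -/
def pR : H ⊗[k] H := TensorProduct.map LinearMap.id Q.betaS Q.phi.inv

/-- `U = f⁻¹ (S ⊗ S)(q_R²¹)` -/
def U : H ⊗[k] H := Q.fInv * Q.SS (tflip Q.qR)

/-- `V = (S⁻¹ ⊗ S⁻¹)(p_R²¹) h` -/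
def V : H ⊗[k] H := Q.SSinv (tflip Q.pR) * Q.h

/-- The deformed coproduct `Δ̄(a) = V Δ(a) U`. -/
def barComul : H →ₗ[k] H ⊗[k] H :=
  LinearMap.mulLeft k Q.V ∘ₗ LinearMap.mulRight k Q.U ∘ₗ Q.comul.toLinearMap

/-! ### One-dimensional representations and the modulus -/

/-- For `ν ∈ Alg(H, k)`, the algebra map `a ↦ a ↼ ν = ν(a₍₁₎) a₍₂₎`. -/
def hit (ν : H →ₐ[k] k) : H →ₐ[k] H :=
  ((Algebra.TensorProduct.lid k H).toAlgHom.comp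
    (Algebra.TensorProduct.map ν (AlgHom.id k H))).comp Q.comul

/-- The representation `ν̄ = ν ∘ S`, the inverse of `ν` in the group `Alg(H, k)`. -/
def invRep (ν : H →ₐ[k] k) : H →ₐ[k] k :=
  AlgHom.ofLinearMap (ν.toLinearMap ∘ₗ Q.S.toLinearMap) (by simp [Q.S_one])
    (fun a b => by simp [Q.S_mul, mul_comm])

theorem invRep_apply (ν : H →ₐ[k] k) (a : H) : Q.invRep ν a = ν (Q.S a) := rfl

theorem rep_alpha_ne_zero (ν : H →ₐ[k] k) : ν Q.alpha ≠ 0 := by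
  intro h0
  have key : ∀ t : H ⊗[k] (H ⊗[k] H), ν (LinearMap.mul' k H
      (TensorProduct.map (LinearMap.mulRight k Q.beta)
      (LinearMap.mul' k H ∘ₗ TensorProduct.map Q.S.toLinearMap (LinearMap.mulLeft k Q.alpha))
      t)) = 0 := by
    intro t
    induction t with
    | zero => simp
    | add x y hx hy => simp only [map_add, hx, hy, add_zero]
    | tmul x w =>
      induction w with
      | zero => simp
      | add y z hy hz => simp only [TensorProduct.tmul_add, map_add, hy, hz, add_zero]
      | tmul y z => simp [h0]
  have := key Q.phi.val
  rw [Q.phi_beta_alpha] at this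
  simp at this

theorem rep_beta_ne_zero (ν : H →ₐ[k] k) : ν Q.beta ≠ 0 := by
  intro h0
  have key : ∀ t : H ⊗[k] (H ⊗[k] H), ν (LinearMap.mul' k H
      (TensorProduct.map (LinearMap.mulRight k Q.beta)
      (LinearMap.mul' k H ∘ₗ TensorProduct.map Q.S.toLinearMap (LinearMap.mulLeft k Q.alpha))
      t)) = 0 := by
    intro t
    induction t with
    | zero => simp
    | add x y hx hy => simp only [map_add, hx, hy, add_zero]
    | tmul x w =>
      induction w with
      | zero => simp
      | add y z hy hz => simp only [TensorProduct.tmul_add, map_add, hy, hz, add_zero]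
      | tmul y z => simp [h0]
  have := key Q.phi.val
  rw [Q.phi_beta_alpha] at this
  simp at this

/-- `ν₁ ⊗ ν₂ : H ⊗ H → k` -/
def rep2 (ν₁ ν₂ : H →ₐ[k] k) : H ⊗[k] H →ₐ[k] k :=
  (Algebra.TensorProduct.lid k k).toAlgHom.comp (Algebra.TensorProduct.map ν₁ ν₂)

theorem invRep_conv (ν : H →ₐ[k] k) (a : H) :
    rep2 (Q.invRep ν) ν (Q.comul a) = Q.counit a := by
  have key : ∀ t : H ⊗[k] H, ν (LinearMap.mul' k H
      (TensorProduct.map Q.S.toLinearMap (LinearMap.mulLeft k Q.alpha) t)) =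
      rep2 (Q.invRep ν) ν t * ν Q.alpha := by
    intro t
    induction t with
    | zero => simp
    | add x y hx hy => simp only [map_add, hx, hy, add_mul]
    | tmul x y => simp [rep2, invRep_apply]; ring
  have h1 := key (Q.comul a)
  rw [Q.antipode_alpha, map_smul, smul_eq_mul] at h1
  exact (mul_right_cancel₀ (Q.rep_alpha_ne_zero ν) h1).symm

theorem conv_invRep (ν : H →ₐ[k] k) (a : H) :
    rep2 ν (Q.invRep ν) (Q.comul a) = Q.counit a := by
  have key : ∀ t : H ⊗[k] H, ν (LinearMap.mul' k H
      (TensorProduct.map (LinearMap.mulRight k Q.beta) Q.S.toLinearMap t)) =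
      rep2 ν (Q.invRep ν) t * ν Q.beta := by
    intro t
    induction t with
    | zero => simp
    | add x y hx hy => simp only [map_add, hx, hy, add_mul]
    | tmul x y => simp [rep2, invRep_apply]; ring
  have h1 := key (Q.comul a)
  rw [Q.antipode_beta, map_smul, smul_eq_mul] at h1
  exact (mul_right_cancel₀ (Q.rep_beta_ne_zero ν) h1).symm

/-- If `ν₁ ν₂ = ε`, then `(a ↼ ν₁) ↼ ν₂ = t a t⁻¹` for the unit `t = ν₁(X) ν₂(Y) Z`. -/
theorem hit_hit (ν₁ ν₂ : H →ₐ[k] k) (hν : ∀ a, rep2 ν₁ ν₂ (Q.comul a) = Q.counit a) :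
    ∃ t : Hˣ, ∀ a, Q.hit ν₂ (Q.hit ν₁ a) * t = t * a := by
  let P : H ⊗[k] (H ⊗[k] H) →ₐ[k] H :=
    (Algebra.TensorProduct.lid k H).toAlgHom.comp (Algebra.TensorProduct.map ν₁
      ((Algebra.TensorProduct.lid k H).toAlgHom.comp
        (Algebra.TensorProduct.map ν₂ (AlgHom.id k H))))
  have e1 : ∀ t : H ⊗[k] H, P (Algebra.TensorProduct.map (AlgHom.id k H) Q.comul t) =
      Q.hit ν₂ ((Algebra.TensorProduct.lid k H)
        (Algebra.TensorProduct.map ν₁ (AlgHom.id k H) t)) := by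
    intro t
    induction t with
    | zero => simp
    | add x y hx hy => simp only [map_add, hx, hy]
    | tmul x y => simp [P, hit]
  have e2' : ∀ (s : H ⊗[k] H) (y : H), P (Algebra.TensorProduct.assoc k k k H H H
      (s ⊗ₜ[k] y)) = rep2 ν₁ ν₂ s • y := by
    intro s y
    induction s with
    | zero => simp
    | add x z hx hz => simp only [TensorProduct.add_tmul, map_add, hx, hz, add_smul]
    | tmul x z => simp [P, rep2, smul_smul, mul_comm]
  have e2 : ∀ t : H ⊗[k] H, P (Algebra.TensorProduct.assoc k k k H H H
      (Algebra.TensorProduct.map Q.comul (AlgHom.id k H) t)) =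
      (Algebra.TensorProduct.lid k H)
        (Algebra.TensorProduct.map Q.counit (AlgHom.id k H) t) := by
    intro t
    induction t with
    | zero => simp
    | add x y hx hy => simp only [map_add, hx, hy]
    | tmul x y => simp [e2', hν]
  refine ⟨Units.map (P : _ →* H) Q.phi, fun a => ?_⟩
  have h1 := congrArg P (Q.quasi_coassoc a)
  rw [map_mul, map_mul, e1, e2, Q.counit_comul] at h1
  exact h1

/-- The map `a ↦ a ↼ ν` is an automorphism of `H`. -/
theorem hit_bijective (ν : H →ₐ[k] k) : Function.Bijective (Q.hit ν) := by
  constructor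
  · obtain ⟨t, ht⟩ := Q.hit_hit ν (Q.invRep ν) (Q.conv_invRep ν)
    intro a b hab
    have h1 := ht a
    rw [hab, ht b] at h1
    exact (t.isUnit.mul_left_cancel h1).symm
  · obtain ⟨t, ht⟩ := Q.hit_hit (Q.invRep ν) ν (Q.invRep_conv ν)
    intro b
    refine ⟨Q.hit (Q.invRep ν) (↑t⁻¹ * b * ↑t), ?_⟩
    have h1 := ht (↑t⁻¹ * b * ↑t)
    rw [← mul_assoc, ← mul_assoc, Units.mul_inv, one_mul] at h1
    exact t.isUnit.mul_right_cancel h1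

/-- The automorphism `a ↦ a ↼ ν` of `H`. -/
def hitEquiv (ν : H →ₐ[k] k) : H ≃ₐ[k] H := AlgEquiv.ofBijective (Q.hit ν) (Q.hit_bijective ν)

/-- `a ⇀ ψ`, where `(a ⇀ ψ)(b) = ψ(b a)`. -/
def lharp : H →ₗ[k] Module.Dual k H →ₗ[k] Module.Dual k H :=
  Module.Dual.transpose ∘ₗ (LinearMap.mul k H).flip

/-- `ψ ↼ a`, where `(ψ ↼ a)(b) = ψ(a b)`; the arguments are `a` and `ψ`, in this order. -/
def rharp : H →ₗ[k] Module.Dual k H →ₗ[k] Module.Dual k H :=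
  Module.Dual.transpose ∘ₗ LinearMap.mul k H

/-- `μ` is the modulus: `μ = ε ∘ θ⁻¹`, where `θ` is the modular (Nakayama) automorphism of some
nondegenerate functional `ω` on `H`, i.e. `ω(a b) = ω(b θ(a))`. This does not depend on `ω`. -/
def IsModulus (μ : H →ₐ[k] k) : Prop :=
  ∃ ω : Module.Dual k H, (Function.Bijective fun a : H => lharp a ω) ∧
    ∃ θ : H ≃ₐ[k] H, (∀ a b : H, ω (a * b) = ω (b * θ a)) ∧ ∀ a : H, μ a = Q.counit (θ.symm a)

open Classical in
/-- The modulus of `H`. It exists and is unique for finite-dimensional `H`, because then `H` is a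
Frobenius algebra and the modular automorphism is unique up to inner automorphisms; the
alternative value `ε` is never used then. -/
def modulus : H →ₐ[k] k :=
  if hμ : ∃ μ : H →ₐ[k] k, Q.IsModulus μ then hμ.choose else Q.counit

/-! ### Quasi-Hopf bimodules -/

/-- The structure maps of a quasi-Hopf `H`-bimodule `M`: left action `lact a m = a · m`, right
action `ract b m = m · b` and right coaction `coact : M → M ⊗ H`. -/
structure BimoduleData (k H M : Type*) [Field k] [Ring H] [Algebra k H] [AddCommGroup M]
    [Module k M] where
  lact : H →ₗ[k] M →ₗ[k] M
  ract : H →ₗ[k] M →ₗ[k] M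
  coact : M →ₗ[k] M ⊗[k] H

/-- Morphisms of quasi-Hopf `H`-bimodules: `H`-bimodule maps that intertwine the coactions. -/
def IsMorphism {M N : Type*} [AddCommGroup M] [Module k M] [AddCommGroup N] [Module k N]
    (A : BimoduleData k H M) (B : BimoduleData k H N) (F : M →ₗ[k] N) : Prop :=
  (∀ a m, F (A.lact a m) = B.lact a (F m)) ∧ (∀ a m, F (A.ract a m) = B.ract a (F m)) ∧
    ∀ m, B.coact (F m) = TensorProduct.map F LinearMap.id (A.coact m)

/-- The projection `E(m) = q_R¹ · m₍₀₎ · β S(q_R² m₍₁₎)`. -/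
def E {M : Type*} [AddCommGroup M] [Module k M] (A : BimoduleData k H M) : M →ₗ[k] M :=
  TensorProduct.lift A.ract.flip ∘ₗ
    TensorProduct.map (TensorProduct.lift A.lact)
      (LinearMap.mulLeft k Q.beta ∘ₗ Q.S.toLinearMap ∘ₗ LinearMap.mul' k H) ∘ₗ
    (TensorProduct.tensorTensorTensorComm k H H M H).toLinearMap ∘ₗ
    TensorProduct.mk k (H ⊗[k] H) (M ⊗[k] H) Q.qR ∘ₗ A.coact

/-- The coinvariants `E(M)`. -/
def coinvariants {M : Type*} [AddCommGroup M] [Module k M] (A : BimoduleData k H M) :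
    Submodule k M := LinearMap.range (Q.E A)

/-- `T_ν = ν(X̄) Ȳ ⊗ Z̄` -/
def T (ν : H →ₐ[k] k) : H ⊗[k] H :=
  Algebra.TensorProduct.lid k (H ⊗[k] H)
    (Algebra.TensorProduct.map ν (AlgHom.id k (H ⊗[k] H)) Q.phi.inv)

/-- The quasi-Hopf bimodule `H_ν`: the space `H` with `a · x · b = (a ↼ ν) x b` and
`ρ_ν(x) = T_ν Δ(x)`. -/
def twisted (ν : H →ₐ[k] k) : BimoduleData k H H where
  lact := LinearMap.mul k H ∘ₗ (Q.hit ν).toLinearMap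
  ract := (LinearMap.mul k H).flip
  coact := LinearMap.mulLeft k (Q.T ν) ∘ₗ Q.comul.toLinearMap

/-- For `ψ ∈ Ĥ`, the linear map `a ↦ (id ⊗ ψ)(Δ̄(a))` from `H` to `H`, depending linearly
on `ψ`. -/
def dualCoactHom : Module.Dual k H →ₗ[k] (H →ₗ[k] H) where
  toFun ψ := (TensorProduct.rid k H).toLinearMap ∘ₗ TensorProduct.map LinearMap.id ψ ∘ₗ Q.barComul
  map_add' ψ χ := by ext a; simp [TensorProduct.map_add_right]
  map_smul' c ψ := by ext a; simp [TensorProduct.map_smul_right]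

/-- The quasi-Hopf bimodule `H*` dual to `(H, Δ)`: the space `Ĥ` with
`a · ψ · b = S(b) ⇀ ψ ↼ S⁻¹(a)` and the coaction `ρ(ψ) ∈ Ĥ ⊗ H ≅ Hom(H, H)` given by
`ρ(ψ)(a) = (id ⊗ ψ)(Δ̄(a))`. -/
def dual [FiniteDimensional k H] : BimoduleData k H (Module.Dual k H) where
  lact := rharp ∘ₗ Q.S.symm.toLinearMap
  ract := lharp ∘ₗ Q.S.toLinearMap
  coact := (dualTensorHomEquiv k H H).symm.toLinearMap ∘ₗ Q.dualCoactHom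

/-- The space of left cointegrals on `H`. -/
def leftCointegrals [FiniteDimensional k H] : Submodule k (Module.Dual k H) :=
  Q.coinvariants Q.dual

/-- A Fourier transformation is a nonzero morphism of quasi-Hopf bimodules `H_μ → H*`, where
`μ` is the modulus. -/
def IsFourierTransformation [FiniteDimensional k H] (F : H →ₗ[k] Module.Dual k H) : Prop :=
  F ≠ 0 ∧ IsMorphism (Q.twisted Q.modulus) Q.dual F

/-- `F_λ(a) = S(a) ⇀ λ` -/
def fourier (lam : Module.Dual k H) : H →ₗ[k] Module.Dual k H :=
  lharp.flip lam ∘ₗ Q.S.toLinearMap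

/-- `F'_λ(a) = λ ↼ S⁻¹(τ⁻¹(a))`, where `τ` is the automorphism `τ(a) = a ↼ μ` of `H`. -/
def fourier' (lam : Module.Dual k H) : H →ₗ[k] Module.Dual k H :=
  rharp.flip lam ∘ₗ Q.S.symm.toLinearMap ∘ₗ (Q.hitEquiv Q.modulus).symm.toLinearMap

end QuasiHopfAlgebra

end

/-!
The idea is to apply the structure theorem for quasi-Hopf bimodules to `H*`: every quasi-Hopf
bimodule `M` is `E(M) ⊗ H`, through `n ⊗ h ↦ n · h` (`IsQuasiHopfBimodule.ofCoinvariants_bijective`).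
As `dim H* = dim H`, the space `E(H*)` of left cointegrals is a line, and for a nonzero left
cointegral `λ` the map `F_λ(b) = λ · b` is a bijection `H → H*` (`fourier_bijective`). The left
action followed by `E` acts on this line by a character `ν`, and the formulas
`a · E(m) = E(a₍₁₎ · m) · a₍₂₎` and `ρ(n) = E(X̄ · n) · Ȳ ⊗ Z̄` for coinvariant `n` turn into
`a · λ = λ · (a ↼ ν)` and `ρ(λ · b) = (F_λ ⊗ id)(T_ν Δ(b))`: the map `F_λ` is a morphism
`H_ν → H*`. The first of these says that `λ` is nondegenerate with modular automorphism
`a ↦ S(S(a) ↼ ν)`, whence `ν` is the modulus (`isModulus_of_character`). So left cointegrals satisfy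
all the other conditions.

Conversely, fix a nonzero left cointegral `λ₀` and write `λ = λ₀ · b`. Then
`F_λ(a) = F_{λ₀}(b a)` and `F'_λ(a) = F_{λ₀}(a b)`, so that the last two conditions at `a = 1` read
`T Δ(b) = (b ⊗ 1) T` and `T Δ(b) = T (b ⊗ 1)` with `T = T_μ`. Applying `ε ⊗ id`, which sends `T` to
`1`, gives `b = ε(b) 1`, so `λ` is a multiple of `λ₀` (`fourier_mem_of_coact_eq`).

Most of the work goes into `dual_isQuasiHopfBimodule`: `H*` is a quasi-Hopf bimodule. Through
`H* ⊗ H ≅ Hom(H, H)` its axioms become identities for `U` and `V`. Drinfeld's twist `f` is first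
removed from these elements. The identities `f Δ(S(a)) = (S ⊗ S)(Δᵒᵖ(a)) f` and `f Δ(α) = γ` show
that `f` is a unit, with an explicit left inverse, and that `U` and `V` are equal to elements
`evElt` and `coevElt` which involve only `φ`, `S`, `α` and `β` (`U_eq_evElt`, `V_eq_coevElt`). The
coassociativity of `ρ` is then a pair of identities in `H ⊗ H ⊗ H`
(`phi_inv_mul_idComul_evElt`, `coevOrbit₃'_coevElt_phi`), which are proved by a uniqueness argument:
both sides transform in the same way under multiplication by `1 ⊗ 1 ⊗ S(a)`, and such an element is
determined by its product with `1 ⊗ 1 ⊗ α` since `X β S(Y) α Z = 1`.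
-/

open scoped TensorProduct

noncomputable section

namespace QuasiHopfAlgebra

variable {k : Type*} {H : Type*} [Field k] [Ring H] [Algebra k H] (Q : QuasiHopfAlgebra k H)

/-! ### Tensor powers, counits and the pentagon -/

theorem tensor_induction₃ {A B C : Type*} [AddCommGroup A] [AddCommGroup B] [AddCommGroup C]
    [Module k A] [Module k B] [Module k C] {p : A ⊗[k] (B ⊗[k] C) → Prop}
    (zero : p 0) (pure : ∀ x y z, p (x ⊗ₜ (y ⊗ₜ z))) (add : ∀ s t, p s → p t → p (s + t)) (t) :
    p t := by
  induction t with
  | zero => exact zero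
  | add x y hx hy => exact add x y hx hy
  | tmul x w =>
    induction w with
    | zero => simpa using zero
    | add y z hy hz => rw [TensorProduct.tmul_add]; exact add _ _ hy hz
    | tmul y z => exact pure x y z

theorem tensor_induction₄ {A B C D : Type*} [AddCommGroup A] [AddCommGroup B] [AddCommGroup C]
    [AddCommGroup D] [Module k A] [Module k B] [Module k C] [Module k D]
    {p : A ⊗[k] (B ⊗[k] (C ⊗[k] D)) → Prop}
    (zero : p 0) (pure : ∀ x y z w, p (x ⊗ₜ (y ⊗ₜ (z ⊗ₜ w))))
    (add : ∀ s t, p s → p t → p (s + t)) (t) : p t := by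
  induction t with
  | zero => exact zero
  | add x y hx hy => exact add x y hx hy
  | tmul x w =>
    induction w using tensor_induction₃ with
    | zero => simpa using zero
    | add y z hy hz => rw [TensorProduct.tmul_add]; exact add _ _ hy hz
    | pure y z w => exact pure x y z w

-- Shortcuts for instance search, which does not reach the ring structure of `H⊗⁴` unaided.
instance : Semiring (H ⊗[k] (H ⊗[k] (H ⊗[k] H))) := inferInstance
instance : NonAssocSemiring (H ⊗[k] (H ⊗[k] (H ⊗[k] H))) := inferInstance
instance : NonUnitalNonAssocSemiring (H ⊗[k] (H ⊗[k] (H ⊗[k] H))) := inferInstance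

/-- `id ⊗ Δ` on `H ⊗ H`. -/
def idComul : H ⊗[k] H →ₐ[k] H ⊗[k] (H ⊗[k] H) :=
  Algebra.TensorProduct.map (AlgHom.id k H) Q.comul

/-- `Δ ⊗ id` on `H ⊗ H`. -/
def comulId : H ⊗[k] H →ₐ[k] H ⊗[k] (H ⊗[k] H) :=
  (Algebra.TensorProduct.assoc k k k H H H).toAlgHom.comp
    (Algebra.TensorProduct.map Q.comul (AlgHom.id k H))

/-- `id ⊗ id ⊗ Δ` -/
def coface₃ : H ⊗[k] (H ⊗[k] H) →ₐ[k] H ⊗[k] (H ⊗[k] (H ⊗[k] H)) :=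
  Algebra.TensorProduct.map (AlgHom.id k H) Q.idComul

/-- `id ⊗ Δ ⊗ id` -/
def coface₂ : H ⊗[k] (H ⊗[k] H) →ₐ[k] H ⊗[k] (H ⊗[k] (H ⊗[k] H)) :=
  Algebra.TensorProduct.map (AlgHom.id k H) Q.comulId

/-- `Δ ⊗ id ⊗ id` -/
def coface₁ : H ⊗[k] (H ⊗[k] H) →ₐ[k] H ⊗[k] (H ⊗[k] (H ⊗[k] H)) :=
  (Algebra.TensorProduct.assoc k k k H H (H ⊗[k] H)).toAlgHom.comp
    (Algebra.TensorProduct.map Q.comul (AlgHom.id k (H ⊗[k] H)))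

/-- `t ↦ 1 ⊗ t` -/
def coface₀ : H ⊗[k] (H ⊗[k] H) →ₐ[k] H ⊗[k] (H ⊗[k] (H ⊗[k] H)) :=
  Algebra.TensorProduct.includeRight

/-- `t ↦ t ⊗ 1` -/
def coface₄ : H ⊗[k] (H ⊗[k] H) →ₐ[k] H ⊗[k] (H ⊗[k] (H ⊗[k] H)) :=
  (Algebra.TensorProduct.map (AlgHom.id k H)
      (Algebra.TensorProduct.assoc k k k H H H).toAlgHom).comp
    ((Algebra.TensorProduct.assoc k k k H (H ⊗[k] H) H).toAlgHom.comp
      Algebra.TensorProduct.includeLeft)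

/-- `ε ⊗ id ⊗ id` -/
def eps₁ : H ⊗[k] (H ⊗[k] H) →ₐ[k] H ⊗[k] H :=
  (Algebra.TensorProduct.lid k (H ⊗[k] H)).toAlgHom.comp
    (Algebra.TensorProduct.map Q.counit (AlgHom.id k (H ⊗[k] H)))

/-- `id ⊗ ε ⊗ id` -/
def eps₂ : H ⊗[k] (H ⊗[k] H) →ₐ[k] H ⊗[k] H :=
  Algebra.TensorProduct.map (AlgHom.id k H)
    ((Algebra.TensorProduct.lid k H).toAlgHom.comp
      (Algebra.TensorProduct.map Q.counit (AlgHom.id k H)))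

/-- `id ⊗ id ⊗ ε` -/
def eps₃ : H ⊗[k] (H ⊗[k] H) →ₐ[k] H ⊗[k] H :=
  Algebra.TensorProduct.map (AlgHom.id k H)
    ((Algebra.TensorProduct.rid k k H).toAlgHom.comp
      (Algebra.TensorProduct.map (AlgHom.id k H) Q.counit))

@[simp] theorem idComul_tmul (x y : H) : Q.idComul (x ⊗ₜ y) = x ⊗ₜ[k] Q.comul y := by
  simp [idComul]

theorem comulId_tmul (x y : H) :
    Q.comulId (x ⊗ₜ y) = Algebra.TensorProduct.assoc k k k H H H (Q.comul x ⊗ₜ y) := by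
  simp [comulId]

@[simp] theorem coface₃_tmul (x : H) (t : H ⊗[k] H) :
    Q.coface₃ (x ⊗ₜ t) = x ⊗ₜ[k] Q.idComul t := by
  simp [coface₃]

@[simp] theorem coface₂_tmul (x : H) (t : H ⊗[k] H) :
    Q.coface₂ (x ⊗ₜ t) = x ⊗ₜ[k] Q.comulId t := by
  simp [coface₂]

theorem coface₁_tmul (x : H) (t : H ⊗[k] H) : Q.coface₁ (x ⊗ₜ t) =
    Algebra.TensorProduct.assoc k k k H H (H ⊗[k] H) (Q.comul x ⊗ₜ t) := by
  simp [coface₁]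

@[simp] theorem coface₀_apply (t : H ⊗[k] (H ⊗[k] H)) : coface₀ t = (1 : H) ⊗ₜ[k] t := rfl

@[simp] theorem coface₄_tmul (x y z : H) :
    coface₄ (x ⊗ₜ[k] (y ⊗ₜ[k] z)) = x ⊗ₜ[k] (y ⊗ₜ[k] (z ⊗ₜ[k] (1 : H))) := by
  simp [coface₄]

@[simp] theorem eps₁_tmul (x : H) (t : H ⊗[k] H) : Q.eps₁ (x ⊗ₜ t) = Q.counit x • t := by
  simp [eps₁]

@[simp] theorem eps₂_tmul (x y z : H) :
    Q.eps₂ (x ⊗ₜ (y ⊗ₜ z)) = Q.counit y • (x ⊗ₜ[k] z) := by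
  simp [eps₂]

@[simp] theorem eps₃_tmul (x y z : H) :
    Q.eps₃ (x ⊗ₜ (y ⊗ₜ z)) = Q.counit z • (x ⊗ₜ[k] y) := by
  simp [eps₃]

theorem idComul_comul_mul_phi (a : H) :
    Q.idComul (Q.comul a) * Q.phi.val = Q.phi.val * Q.comulId (Q.comul a) := Q.quasi_coassoc a

theorem phi_inv_mul_idComul (a : H) :
    Q.phi.inv * Q.idComul (Q.comul a) = Q.comulId (Q.comul a) * Q.phi.inv := by
  have h := Q.idComul_comul_mul_phi a
  calc _ = Q.phi.inv * (Q.idComul (Q.comul a) * Q.phi.val) * Q.phi.inv := by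
        rw [mul_assoc, mul_assoc, Q.phi.val_inv, mul_one]
    _ = _ := by rw [h, ← mul_assoc, Q.phi.inv_val, one_mul]

theorem coface_pentagon : Q.coface₃ Q.phi.val * Q.coface₁ Q.phi.val =
    coface₀ Q.phi.val * Q.coface₂ Q.phi.val * coface₄ Q.phi.val := Q.pentagon

section Units

variable {A B : Type*} [Ring A] [Ring B] [Algebra k A] [Algebra k B]

theorem map_val_mul_inv (F : A →ₐ[k] B) (u : Aˣ) : F u.val * F u.inv = 1 := by
  rw [← map_mul, u.val_inv, map_one]

theorem map_inv_eq_one (F : A →ₐ[k] B) (u : Aˣ) (h : F u.val = 1) : F u.inv = 1 := by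
  have := map_val_mul_inv F u
  rwa [h, one_mul] at this

end Units

theorem coface_val_mul_inv
    (F : H ⊗[k] (H ⊗[k] H) →ₐ[k] H ⊗[k] (H ⊗[k] (H ⊗[k] H))) :
    F Q.phi.val * F Q.phi.inv = 1 := by
  rw [← map_mul, Q.phi.val_inv, map_one]

theorem coface_inv_mul_val
    (F : H ⊗[k] (H ⊗[k] H) →ₐ[k] H ⊗[k] (H ⊗[k] (H ⊗[k] H))) :
    F Q.phi.inv * F Q.phi.val = 1 := by
  rw [← map_mul, Q.phi.inv_val, map_one]

theorem eps₂_phi : Q.eps₂ Q.phi.val = 1 := Q.counit_phi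

theorem eps₁_assoc (d : H ⊗[k] H) (y : H) :
    Q.eps₁ (Algebra.TensorProduct.assoc k k k H H H (d ⊗ₜ y)) =
      (Algebra.TensorProduct.lid k H (Algebra.TensorProduct.map Q.counit (AlgHom.id k H) d))
        ⊗ₜ[k] y := by
  induction d with
  | zero => simp
  | add x y hx hy => simp only [map_add, TensorProduct.add_tmul, hx, hy]
  | tmul x y => simp [TensorProduct.smul_tmul']

theorem eps₁_comulId (t : H ⊗[k] H) : Q.eps₁ (Q.comulId t) = t := by
  induction t with
  | zero => simp
  | add x y hx hy => simp only [map_add, hx, hy]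
  | tmul x y => rw [comulId_tmul, eps₁_assoc, Q.counit_comul]

theorem eps₂_idComul (t : H ⊗[k] H) : Q.eps₂ (Q.idComul t) = t := by
  induction t with
  | zero => simp
  | add x y hx hy => simp only [map_add, hx, hy]
  | tmul x y =>
    have := Q.counit_comul y
    simp [eps₂, this]

theorem eps₂_assoc (d : H ⊗[k] H) (y : H) :
    Q.eps₂ (Algebra.TensorProduct.assoc k k k H H H (d ⊗ₜ y)) =
      (Algebra.TensorProduct.rid k k H (Algebra.TensorProduct.map (AlgHom.id k H) Q.counit d))
        ⊗ₜ[k] y := by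
  induction d with
  | zero => simp
  | add x y hx hy => simp only [map_add, TensorProduct.add_tmul, hx, hy]
  | tmul x y => simp [TensorProduct.smul_tmul']

theorem eps₂_comulId (t : H ⊗[k] H) : Q.eps₂ (Q.comulId t) = t := by
  induction t with
  | zero => simp
  | add x y hx hy => simp only [map_add, hx, hy]
  | tmul x y => rw [comulId_tmul, eps₂_assoc, Q.comul_counit]

/-- The normalization `(ε ⊗ id ⊗ id)(φ) = 1`: apply `ε` to the second leg of the pentagon. -/
theorem eps₁_phi : Q.eps₁ Q.phi.val = 1 := by
  let F : H ⊗[k] (H ⊗[k] (H ⊗[k] H)) →ₐ[k] H ⊗[k] (H ⊗[k] H) :=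
    Algebra.TensorProduct.map (AlgHom.id k H) Q.eps₁
  have h3 : ∀ t, F (Q.coface₃ t) = Q.idComul (Q.eps₂ t) := by
    intro t
    induction t using tensor_induction₃ with
    | zero => simp
    | add x y hx hy => simp only [map_add, hx, hy]
    | pure x y z => simp [F]
  have h1' : ∀ (d : H ⊗[k] H) (u : H ⊗[k] H),
      F (Algebra.TensorProduct.assoc k k k H H (H ⊗[k] H) (d ⊗ₜ u)) =
      (Algebra.TensorProduct.rid k k H (Algebra.TensorProduct.map (AlgHom.id k H) Q.counit d))
        ⊗ₜ[k] u := by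
    intro d u
    induction d with
    | zero => simp
    | add x y hx hy => simp only [map_add, TensorProduct.add_tmul, hx, hy]
    | tmul x y => simp [F, TensorProduct.smul_tmul']
  have h1 : ∀ t, F (Q.coface₁ t) = t := by
    intro t
    induction t with
    | zero => simp
    | add x y hx hy => simp only [map_add, hx, hy]
    | tmul x u => rw [coface₁_tmul, h1', Q.comul_counit]
  have h2 : ∀ t, F (Q.coface₂ t) = t := by
    intro t
    induction t with
    | zero => simp
    | add x y hx hy => simp only [map_add, hx, hy]
    | tmul x u => simp [F, eps₁_comulId]
  have h4 : ∀ t, F (coface₄ t) =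
      Algebra.TensorProduct.assoc k k k H H H (Q.eps₂ t ⊗ₜ 1) := by
    intro t
    induction t using tensor_induction₃ with
    | zero => simp
    | add x y hx hy => simp only [map_add, TensorProduct.add_tmul, hx, hy]
    | pure x y z => simp [F, ← TensorProduct.smul_tmul']
  have key := congrArg F Q.coface_pentagon
  rw [map_mul, map_mul, map_mul, h3, h1, h2, h4, eps₂_phi, map_one, one_mul,
    ← Algebra.TensorProduct.one_def, map_one, mul_one] at key
  have key2 : F (coface₀ Q.phi.val) = 1 :=
    (Q.phi.isUnit.mul_right_cancel ((one_mul _).trans key)).symm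
  have key3 : ∀ t, Algebra.TensorProduct.lid k (H ⊗[k] H) (Algebra.TensorProduct.map Q.counit
      (AlgHom.id k _) (F (coface₀ t))) = Q.eps₁ t := by
    intro t
    simp [F]
  rw [← key3, key2, map_one, map_one]

/-- The normalization `(id ⊗ id ⊗ ε)(φ) = 1`: apply `ε` to the third leg of the pentagon. -/
theorem eps₃_phi : Q.eps₃ Q.phi.val = 1 := by
  let F : H ⊗[k] (H ⊗[k] (H ⊗[k] H)) →ₐ[k] H ⊗[k] (H ⊗[k] H) :=
    Algebra.TensorProduct.map (AlgHom.id k H) Q.eps₂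
  have h3 : ∀ t, F (Q.coface₃ t) = t := by
    intro t
    induction t with
    | zero => simp
    | add x y hx hy => simp only [map_add, hx, hy]
    | tmul x u => simp [F, eps₂_idComul]
  have h1' : ∀ (d : H ⊗[k] H) (y z : H),
      F (Algebra.TensorProduct.assoc k k k H H (H ⊗[k] H) (d ⊗ₜ (y ⊗ₜ z))) =
      Q.counit y • Algebra.TensorProduct.assoc k k k H H H (d ⊗ₜ z) := by
    intro d y z
    induction d with
    | zero => simp
    | add x y hx hy => simp only [map_add, TensorProduct.add_tmul, hx, hy, smul_add]
    | tmul x y => simp [F]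
  have h1 : ∀ t, F (Q.coface₁ t) = Q.comulId (Q.eps₂ t) := by
    intro t
    induction t using tensor_induction₃ with
    | zero => simp
    | add x y hx hy => simp only [map_add, hx, hy]
    | pure x y z => rw [coface₁_tmul, h1', eps₂_tmul, map_smul, comulId_tmul]
  have h2 : ∀ t, F (Q.coface₂ t) = t := by
    intro t
    induction t with
    | zero => simp
    | add x y hx hy => simp only [map_add, hx, hy]
    | tmul x u => simp [F, eps₂_comulId]
  have h4 : ∀ t, F (coface₄ t) =
      Algebra.TensorProduct.assoc k k k H H H (Q.eps₃ t ⊗ₜ 1) := by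
    intro t
    induction t using tensor_induction₃ with
    | zero => simp
    | add x y hx hy => simp only [map_add, TensorProduct.add_tmul, hx, hy]
    | pure x y z => simp [F, ← TensorProduct.smul_tmul']
  have h0 : ∀ t, F (coface₀ t) = 1 ⊗ₜ Q.eps₂ t := fun t => by simp [F]
  have key := congrArg F Q.coface_pentagon
  rw [map_mul, map_mul, map_mul, h3, h1, h2, h4, h0, eps₂_phi, map_one, mul_one,
    ← Algebra.TensorProduct.one_def, one_mul] at key
  have key2 : Algebra.TensorProduct.assoc k k k H H H (Q.eps₃ Q.phi.val ⊗ₜ 1) = 1 :=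
    (Q.phi.isUnit.mul_left_cancel ((mul_one _).trans key)).symm
  have key3 : ∀ t, Q.eps₃ (Algebra.TensorProduct.assoc k k k H H H (t ⊗ₜ 1)) = t := by
    intro t
    induction t with
    | zero => simp
    | add x y hx hy => simp only [map_add, TensorProduct.add_tmul, hx, hy]
    | tmul x u => simp
  rw [← key3 (Q.eps₃ Q.phi.val), key2, map_one]

theorem eps₁_phi_inv : Q.eps₁ Q.phi.inv = 1 := map_inv_eq_one _ _ Q.eps₁_phi
theorem eps₂_phi_inv : Q.eps₂ Q.phi.inv = 1 := map_inv_eq_one _ _ Q.eps₂_phi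
theorem eps₃_phi_inv : Q.eps₃ Q.phi.inv = 1 := map_inv_eq_one _ _ Q.eps₃_phi

/-- The pentagon, solved for the element `T ⊗ U ⊗ V ⊗ W` of the definition of `γ`. -/
theorem tuvw_eq : Q.tuvw =
    Q.coface₂ Q.phi.val * (coface₄ Q.phi.val * Q.coface₁ Q.phi.inv) := by
  have h : Q.tuvw = coface₀ Q.phi.inv * Q.coface₃ Q.phi.val := rfl
  calc Q.tuvw = coface₀ Q.phi.inv * (Q.coface₃ Q.phi.val * Q.coface₁ Q.phi.val) *
        Q.coface₁ Q.phi.inv := by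
        rw [h, mul_assoc, mul_assoc, coface_val_mul_inv, mul_one]
    _ = _ := by
        rw [coface_pentagon, ← mul_assoc, ← mul_assoc, coface_inv_mul_val, one_mul, mul_assoc]

theorem tuvw_mul_coface₁ : Q.tuvw * Q.coface₁ Q.phi.val =
    Q.coface₂ Q.phi.val * coface₄ Q.phi.val := by
  rw [tuvw_eq, mul_assoc, mul_assoc, coface_inv_mul_val, mul_one]

theorem coface₁_mul_coface₄_inv : Q.coface₁ Q.phi.val * coface₄ Q.phi.inv =
    Q.coface₃ Q.phi.inv * (coface₀ Q.phi.val * Q.coface₂ Q.phi.val) := by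
  calc _ = Q.coface₃ Q.phi.inv * (Q.coface₃ Q.phi.val * Q.coface₁ Q.phi.val) *
        coface₄ Q.phi.inv := by
        rw [← mul_assoc, coface_inv_mul_val, one_mul]
    _ = _ := by
        rw [coface_pentagon, mul_assoc, mul_assoc, coface_val_mul_inv, mul_one]

theorem coface₂_inv_mul_coface₀_inv : Q.coface₂ Q.phi.inv * coface₀ Q.phi.inv =
    coface₄ Q.phi.val * (Q.coface₁ Q.phi.inv * Q.coface₃ Q.phi.inv) := by
  have h : (Q.coface₂ Q.phi.inv * coface₀ Q.phi.inv) * (Q.coface₃ Q.phi.val *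
      Q.coface₁ Q.phi.val) = coface₄ Q.phi.val := by
    rw [coface_pentagon, mul_assoc (coface₀ _), ← mul_assoc, mul_assoc (Q.coface₂ _),
      coface_inv_mul_val, mul_one, ← mul_assoc, coface_inv_mul_val, one_mul]
  rw [← h, mul_assoc, mul_assoc (Q.coface₃ _), ← mul_assoc (Q.coface₁ _), coface_val_mul_inv,
    one_mul, coface_val_mul_inv, mul_one]

/-! ### Contractions with the antipode -/

@[simp] theorem sAlpha_tmul (x y : H) : Q.sAlpha (x ⊗ₜ y) = Q.S x * (Q.alpha * y) := by
  simp [sAlpha]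

@[simp] theorem betaS_tmul (x y : H) : Q.betaS (x ⊗ₜ y) = x * Q.beta * Q.S y := by
  simp [betaS]

theorem sAlpha_mul_tmul (d : H ⊗[k] H) (x y : H) :
    Q.sAlpha (d * (x ⊗ₜ y)) = Q.S x * Q.sAlpha d * y := by
  induction d with
  | zero => simp
  | add a b ha hb => simp only [map_add, add_mul, mul_add, ha, hb]
  | tmul a b => simp [Q.S_mul, mul_assoc]

theorem sAlpha_comul_mul (b : H) (d : H ⊗[k] H) :
    Q.sAlpha (Q.comul b * d) = Q.counit b • Q.sAlpha d := by
  induction d with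
  | zero => simp
  | add x y hx hy => simp only [map_add, mul_add, smul_add, hx, hy]
  | tmul x y =>
    have h : Q.sAlpha (Q.comul b) = Q.counit b • Q.alpha := Q.antipode_alpha b
    rw [sAlpha_mul_tmul, h]
    simp [mul_assoc]

theorem betaS_tmul_mul (d : H ⊗[k] H) (x y : H) :
    Q.betaS ((x ⊗ₜ y) * d) = x * Q.betaS d * Q.S y := by
  induction d with
  | zero => simp
  | add a b ha hb => simp only [map_add, add_mul, mul_add, ha, hb]
  | tmul a b => simp [Q.S_mul, mul_assoc]

theorem betaS_mul_comul (b : H) (d : H ⊗[k] H) :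
    Q.betaS (d * Q.comul b) = Q.counit b • Q.betaS d := by
  induction d with
  | zero => simp
  | add x y hx hy => simp only [map_add, add_mul, smul_add, hx, hy]
  | tmul x y =>
    have h : Q.betaS (Q.comul b) = Q.counit b • Q.beta := Q.antipode_beta b
    rw [betaS_tmul_mul, h]
    simp

/-- The linear map `x ⊗ y ⊗ z ↦ x β S(y) α z`. -/
def betaSAlpha : H ⊗[k] (H ⊗[k] H) →ₗ[k] H :=
  LinearMap.mul' k H ∘ₗ TensorProduct.map (LinearMap.mulRight k Q.beta) Q.sAlpha

@[simp] theorem betaSAlpha_tmul (x : H) (t : H ⊗[k] H) :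
    Q.betaSAlpha (x ⊗ₜ t) = x * Q.beta * Q.sAlpha t := by
  simp [betaSAlpha]

theorem betaSAlpha_phi : Q.betaSAlpha Q.phi.val = 1 := Q.phi_beta_alpha

/-- The linear map `x ⊗ y ⊗ z ↦ S(x) α y β S(z)`. -/
def sAlphaBetaS : H ⊗[k] (H ⊗[k] H) →ₗ[k] H :=
  LinearMap.mul' k H ∘ₗ TensorProduct.map Q.S.toLinearMap (LinearMap.mulLeft k Q.alpha ∘ₗ Q.betaS)

@[simp] theorem sAlphaBetaS_tmul (x : H) (t : H ⊗[k] H) :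
    Q.sAlphaBetaS (x ⊗ₜ t) = Q.S x * (Q.alpha * Q.betaS t) := by
  simp [sAlphaBetaS]

theorem sAlphaBetaS_phi_inv : Q.sAlphaBetaS Q.phi.inv = 1 := by
  rw [← Q.phi_inv_alpha_beta]
  generalize Q.phi.inv = t
  induction t using tensor_induction₃ with
  | zero => simp
  | add x y hx hy => simp only [map_add, hx, hy]
  | pure x y z => simp [mul_assoc]

theorem betaSAlpha_mul_comulId (u : H ⊗[k] (H ⊗[k] H)) (b c : H) :
    Q.betaSAlpha (u * Q.comulId (b ⊗ₜ c)) = Q.counit b • (Q.betaSAlpha u * c) := by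
  have key : ∀ (x y z : H) (d : H ⊗[k] H), Q.betaSAlpha ((x ⊗ₜ (y ⊗ₜ z)) *
      Algebra.TensorProduct.assoc k k k H H H (d ⊗ₜ c)) =
      x * Q.betaS d * Q.S y * (Q.alpha * z * c) := by
    intro x y z d
    induction d with
    | zero => simp
    | add a b ha hb => simp only [map_add, TensorProduct.add_tmul, mul_add, add_mul, ha, hb]
    | tmul a b => simp [Q.S_mul, mul_assoc]
  induction u using tensor_induction₃ with
  | zero => simp
  | add x y hx hy => simp only [map_add, add_mul, smul_add, hx, hy]
  | pure x y z =>
    have h : Q.betaS (Q.comul b) = Q.counit b • Q.beta := Q.antipode_beta b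
    rw [comulId_tmul, key, h]
    simp [mul_assoc]

theorem betaSAlpha_idComul_mul (u : H ⊗[k] (H ⊗[k] H)) (b c : H) :
    Q.betaSAlpha (Q.idComul (b ⊗ₜ c) * u) = Q.counit c • (b * Q.betaSAlpha u) := by
  induction u with
  | zero => simp
  | add x y hx hy => simp only [map_add, mul_add, smul_add, hx, hy]
  | tmul x t => simp [sAlpha_comul_mul, mul_assoc]

/-- The linear map `x ⊗ y ⊗ z ⊗ w ↦ x ⊗ y β S(z) α w`. -/
def contractTail : H ⊗[k] (H ⊗[k] (H ⊗[k] H)) →ₗ[k] H ⊗[k] H :=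
  TensorProduct.map LinearMap.id Q.betaSAlpha

@[simp] theorem contractTail_tmul (x : H) (t : H ⊗[k] (H ⊗[k] H)) :
    Q.contractTail (x ⊗ₜ t) = x ⊗ₜ[k] Q.betaSAlpha t := by
  simp [contractTail]

theorem contractTail_mul_coface₂ (s : H ⊗[k] (H ⊗[k] (H ⊗[k] H))) (t : H ⊗[k] (H ⊗[k] H)) :
    Q.contractTail (s * Q.coface₂ t) = Q.contractTail s * Q.eps₂ t := by
  induction s with
  | zero => simp
  | add x y hx hy => simp only [map_add, add_mul, hx, hy]
  | tmul s u =>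
    induction t using tensor_induction₃ with
    | zero => simp
    | add x y hx hy => simp only [map_add, mul_add, hx, hy]
    | pure x y z => simp [betaSAlpha_mul_comulId]

theorem contractTail_coface₃_mul (s : H ⊗[k] (H ⊗[k] (H ⊗[k] H))) (t : H ⊗[k] (H ⊗[k] H)) :
    Q.contractTail (Q.coface₃ t * s) = Q.eps₃ t * Q.contractTail s := by
  induction s with
  | zero => simp
  | add x y hx hy => simp only [map_add, mul_add, hx, hy]
  | tmul s u =>
    induction t using tensor_induction₃ with
    | zero => simp
    | add x y hx hy => simp only [map_add, add_mul, hx, hy]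
    | pure x y z =>
      rw [coface₃_tmul, Algebra.TensorProduct.tmul_mul_tmul, contractTail_tmul,
        betaSAlpha_idComul_mul]
      simp

/-- The linear map `x ⊗ y ⊗ z ⊗ w ↦ x β S(y) α z ⊗ w`. -/
def contractHead : H ⊗[k] (H ⊗[k] (H ⊗[k] H)) →ₗ[k] H ⊗[k] H :=
  TensorProduct.map (LinearMap.mul' k H ∘ₗ
      TensorProduct.map (LinearMap.mulRight k Q.beta) LinearMap.id) LinearMap.id ∘ₗ
    (TensorProduct.assoc k H H H).symm.toLinearMap ∘ₗ
    TensorProduct.map LinearMap.id (TensorProduct.map Q.sAlpha LinearMap.id ∘ₗ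
      (TensorProduct.assoc k H H H).symm.toLinearMap)

@[simp] theorem contractHead_tmul (x y z w : H) :
    Q.contractHead (x ⊗ₜ (y ⊗ₜ (z ⊗ₜ w))) =
      (x * Q.beta * (Q.S y * (Q.alpha * z))) ⊗ₜ[k] w := by
  simp [contractHead]

theorem contractHead_coface₂_mul (s : H ⊗[k] (H ⊗[k] (H ⊗[k] H))) (t : H ⊗[k] (H ⊗[k] H)) :
    Q.contractHead (Q.coface₂ t * s) = Q.eps₂ t * Q.contractHead s := by
  have key : ∀ (d : H ⊗[k] H) (a c x y z w : H), Q.contractHead (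
      (a ⊗ₜ Algebra.TensorProduct.assoc k k k H H H (d ⊗ₜ c)) * (x ⊗ₜ (y ⊗ₜ (z ⊗ₜ w)))) =
      (a * x * Q.beta * (Q.sAlpha (d * (y ⊗ₜ z)))) ⊗ₜ[k] (c * w) := by
    intro d a c x y z w
    induction d with
    | zero => simp
    | add x y hx hy =>
      simp only [map_add, TensorProduct.add_tmul, TensorProduct.tmul_add, add_mul, mul_add, hx, hy]
    | tmul d e => simp
  induction s using tensor_induction₄ with
  | zero => simp
  | add x y hx hy => simp only [map_add, mul_add, hx, hy]
  | pure x y z w =>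
    induction t using tensor_induction₃ with
    | zero => simp
    | add x y hx hy => simp only [map_add, add_mul, hx, hy]
    | pure a b c =>
      rw [coface₂_tmul, comulId_tmul, key, sAlpha_comul_mul]
      simp [mul_assoc]
      simp only [TensorProduct.smul_tmul']

theorem contractHead_mul_coface₁ (s : H ⊗[k] (H ⊗[k] (H ⊗[k] H))) (t : H ⊗[k] (H ⊗[k] H)) :
    Q.contractHead (s * Q.coface₁ t) = Q.contractHead s * Q.eps₁ t := by
  have key : ∀ (d : H ⊗[k] H) (a c x y z w : H), Q.contractHead ((x ⊗ₜ (y ⊗ₜ (z ⊗ₜ w))) *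
      Algebra.TensorProduct.assoc k k k H H (H ⊗[k] H) (d ⊗ₜ (a ⊗ₜ c))) =
      (x * Q.betaS d * Q.S y * (Q.alpha * z * a)) ⊗ₜ[k] (w * c) := by
    intro d a c x y z w
    induction d with
    | zero => simp
    | add x y hx hy =>
      simp only [map_add, TensorProduct.add_tmul, add_mul, mul_add, hx, hy]
    | tmul d e => simp [Q.S_mul, mul_assoc]
  induction s using tensor_induction₄ with
  | zero => simp
  | add x y hx hy => simp only [map_add, add_mul, hx, hy]
  | pure x y z w =>
    induction t using tensor_induction₃ with
    | zero => simp
    | add x y hx hy => simp only [map_add, mul_add, hx, hy]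
    | pure a b c =>
      have h : Q.betaS (Q.comul a) = Q.counit a • Q.beta := Q.antipode_beta a
      rw [coface₁_tmul, key, h]
      simp [mul_assoc, TensorProduct.smul_tmul']

/-- The snake identity `X β S(x̄ Y) α ȳ Z₍₁₎ ⊗ z̄ Z₍₂₎ = 1 ⊗ 1`. -/
theorem contractHead_tuvw : Q.contractHead Q.tuvw = 1 := by
  have h4 : ∀ t, Q.contractHead (coface₄ t) = Q.betaSAlpha t ⊗ₜ 1 := by
    intro t
    induction t using tensor_induction₃ with
    | zero => simp
    | add x y hx hy => simp only [map_add, TensorProduct.add_tmul, hx, hy]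
    | pure x y z => simp
  rw [tuvw_eq, contractHead_coface₂_mul, contractHead_mul_coface₁, h4, eps₂_phi, eps₁_phi_inv,
    betaSAlpha_phi, one_mul, mul_one, Algebra.TensorProduct.one_def]

theorem contractTail_coface₃_coface₀_coface₂ : Q.contractTail
    (Q.coface₃ Q.phi.inv * (coface₀ Q.phi.val * Q.coface₂ Q.phi.val)) = 1 := by
  rw [contractTail_coface₃_mul, contractTail_mul_coface₂, eps₃_phi_inv, eps₂_phi, coface₀_apply,
    contractTail_tmul, betaSAlpha_phi, one_mul, mul_one, Algebra.TensorProduct.one_def]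

/-! ### The elements `p_R` and `q_R` -/

/-- The linear map `x ⊗ y ⊗ z ↦ x ⊗ y β S(z)`, which sends `φ⁻¹` to `p_R`. -/
def idBetaS : H ⊗[k] (H ⊗[k] H) →ₗ[k] H ⊗[k] H := TensorProduct.map LinearMap.id Q.betaS

@[simp] theorem idBetaS_tmul (x : H) (t : H ⊗[k] H) :
    Q.idBetaS (x ⊗ₜ t) = x ⊗ₜ[k] Q.betaS t := by
  simp [idBetaS]

theorem pR_eq : Q.pR = Q.idBetaS Q.phi.inv := rfl

theorem idBetaS_mul_idComul (s : H ⊗[k] (H ⊗[k] H)) (d : H ⊗[k] H) :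
    Q.idBetaS (s * Q.idComul d) = Q.idBetaS s *
      ((Algebra.TensorProduct.rid k k H
        (Algebra.TensorProduct.map (AlgHom.id k H) Q.counit d)) ⊗ₜ 1) := by
  induction s with
  | zero => simp
  | add x y hx hy => simp only [map_add, add_mul, hx, hy]
  | tmul x t =>
    induction d with
    | zero => simp
    | add x y hx hy => simp only [map_add, mul_add, TensorProduct.add_tmul, hx, hy]
    | tmul a b => simp [betaS_mul_comul, TensorProduct.smul_tmul']

theorem idBetaS_assoc_mul (e : H ⊗[k] H) (b : H) (s : H ⊗[k] (H ⊗[k] H)) :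
    Q.idBetaS (Algebra.TensorProduct.assoc k k k H H H (e ⊗ₜ b) * s) =
      e * Q.idBetaS s * (1 ⊗ₜ Q.S b) := by
  induction s using tensor_induction₃ with
  | zero => simp
  | add x y hx hy => simp only [map_add, mul_add, add_mul, hx, hy]
  | pure x y z =>
    induction e with
    | zero => simp
    | add x y hx hy => simp only [map_add, add_mul, TensorProduct.add_tmul, hx, hy]
    | tmul u v => simp [Q.S_mul, mul_assoc]

/-- The linear map `x ⊗ y ↦ Δ(x) p_R (1 ⊗ S(y))`. -/
def pROrbit : H ⊗[k] H →ₗ[k] H ⊗[k] H :=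
  LinearMap.mul' k (H ⊗[k] H) ∘ₗ
    TensorProduct.map (LinearMap.mulRight k Q.pR ∘ₗ Q.comul.toLinearMap)
      ((Algebra.TensorProduct.includeRight : H →ₐ[k] H ⊗[k] H).toLinearMap ∘ₗ Q.S.toLinearMap)

@[simp] theorem pROrbit_tmul (x y : H) :
    Q.pROrbit (x ⊗ₜ y) = Q.comul x * Q.pR * (1 ⊗ₜ Q.S y) := by
  simp [pROrbit]

/-- `p_R (a ⊗ 1) = Δ(a₍₁₎) p_R (1 ⊗ S(a₍₂₎))` -/
theorem pR_mul_tmul_one (a : H) : Q.pR * (a ⊗ₜ 1) = Q.pROrbit (Q.comul a) := by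
  have h : ∀ d, Q.idBetaS (Q.comulId d * Q.phi.inv) = Q.pROrbit d := by
    intro d
    induction d with
    | zero => simp
    | add x y hx hy => simp only [map_add, add_mul, hx, hy]
    | tmul x y => rw [comulId_tmul, idBetaS_assoc_mul, pROrbit_tmul, pR_eq]
  rw [← h, ← phi_inv_mul_idComul, idBetaS_mul_idComul, Q.comul_counit, pR_eq]

/-- The linear map `x ⊗ y ⊗ z ↦ Δ(x) p_R (1 ⊗ S(y) α z)`. -/
def pRSandwich : H ⊗[k] (H ⊗[k] H) →ₗ[k] H ⊗[k] H :=
  LinearMap.mul' k (H ⊗[k] H) ∘ₗ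
    TensorProduct.map (LinearMap.mulRight k Q.pR ∘ₗ Q.comul.toLinearMap)
      ((Algebra.TensorProduct.includeRight : H →ₐ[k] H ⊗[k] H).toLinearMap ∘ₗ Q.sAlpha)

@[simp] theorem pRSandwich_tmul (x : H) (t : H ⊗[k] H) :
    Q.pRSandwich (x ⊗ₜ t) = Q.comul x * Q.pR * (1 ⊗ₜ Q.sAlpha t) := by
  simp [pRSandwich]

theorem contractTail_assoc_mul (e u : H ⊗[k] H) (s : H ⊗[k] (H ⊗[k] (H ⊗[k] H))) :
    Q.contractTail (Algebra.TensorProduct.assoc k k k H H (H ⊗[k] H) (e ⊗ₜ u) * s) =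
      e * Q.contractTail ((1 ⊗ₜ (1 ⊗ₜ u)) * s) := by
  induction s using tensor_induction₄ with
  | zero => simp
  | add x y hx hy => simp only [map_add, mul_add, hx, hy]
  | pure x y z w =>
    induction e with
    | zero => simp
    | add x y hx hy => simp only [map_add, add_mul, TensorProduct.add_tmul, hx, hy]
    | tmul a b => simp [mul_assoc]

/-- The identity `Δ(q_R¹) p_R (1 ⊗ S(q_R²)) = 1 ⊗ 1`, written out as
`Δ(X) p_R (1 ⊗ S(Y) α Z) = 1 ⊗ 1`. -/
theorem pRSandwich_phi : Q.pRSandwich Q.phi.val = 1 := by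
  have h1 : ∀ (u : H ⊗[k] H) (s : H ⊗[k] (H ⊗[k] H)),
      Q.contractTail ((1 ⊗ₜ (1 ⊗ₜ u)) * coface₄ s) = Q.idBetaS s * (1 ⊗ₜ Q.sAlpha u) := by
    intro u s
    induction s using tensor_induction₃ with
    | zero => simp
    | add x y hx hy => simp only [map_add, mul_add, add_mul, hx, hy]
    | pure x y z =>
      induction u with
      | zero => simp
      | add x y hx hy =>
        simp only [map_add, mul_add, add_mul, TensorProduct.tmul_add, hx, hy]
      | tmul a b => simp [Q.S_mul, mul_assoc]
  have h : ∀ t, Q.contractTail (Q.coface₁ t * coface₄ Q.phi.inv) = Q.pRSandwich t := by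
    intro t
    induction t with
    | zero => simp
    | add x y hx hy => simp only [map_add, add_mul, hx, hy]
    | tmul x u => rw [coface₁_tmul, contractTail_assoc_mul, h1, pRSandwich_tmul, pR_eq, mul_assoc]
  rw [← h, coface₁_mul_coface₄_inv, contractTail_coface₃_coface₀_coface₂]

section Equivariant

variable {B : Type*} [AddCommGroup B] [Module k B]

/-- A functional on `H ⊗ H` that is invariant under left multiplication by `Δ(H)` sees `p_R` as a
device that moves `a` from the first leg to `S(a)` in the second. -/
theorem equivariant_pR_mul (K : H ⊗[k] H →ₗ[k] B)
    (hK : ∀ a s, K (Q.comul a * s) = Q.counit a • K s) (a : H) :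
    K (Q.pR * (a ⊗ₜ 1)) = K (Q.pR * (1 ⊗ₜ Q.S a)) := by
  have h : ∀ d, K (Q.pROrbit d) = K (Q.pR * (1 ⊗ₜ Q.S (Algebra.TensorProduct.lid k H
      (Algebra.TensorProduct.map Q.counit (AlgHom.id k H) d)))) := by
    intro d
    induction d with
    | zero => simp
    | add x y hx hy => simp only [map_add, mul_add, TensorProduct.tmul_add, hx, hy]
    | tmul x y => rw [pROrbit_tmul, mul_assoc, hK]; simp
  rw [pR_mul_tmul_one, h, Q.counit_comul]

/-- A functional on `H ⊗ H` that is invariant under left multiplication by `Δ(H)` takes the same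
value at `p_R (1 ⊗ α)` and at `1 ⊗ 1`. -/
theorem equivariant_pR_alpha (K : H ⊗[k] H →ₗ[k] B)
    (hK : ∀ a s, K (Q.comul a * s) = Q.counit a • K s) :
    K (Q.pR * (1 ⊗ₜ Q.alpha)) = K 1 := by
  have h4 : ∀ s, Q.contractTail (coface₄ s) = Q.idBetaS s * (1 ⊗ₜ Q.alpha) := by
    intro s
    induction s using tensor_induction₃ with
    | zero => simp
    | add x y hx hy => simp only [map_add, add_mul, hx, hy]
    | pure x y z => simp [mul_assoc]
  have h1 : ∀ t s, K (Q.contractTail (Q.coface₁ t * s)) =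
      K (Q.contractTail ((1 ⊗ₜ (1 ⊗ₜ Q.eps₁ t)) * s)) := by
    intro t s
    induction t with
    | zero => simp
    | add x y hx hy => simp only [map_add, add_mul, TensorProduct.tmul_add, hx, hy]
    | tmul x u =>
      rw [coface₁_tmul, contractTail_assoc_mul, hK, eps₁_tmul, TensorProduct.tmul_smul,
        TensorProduct.tmul_smul, smul_mul_assoc, map_smul, map_smul]
  have h : coface₄ Q.phi.inv = Q.coface₁ Q.phi.inv *
      (Q.coface₃ Q.phi.inv * (coface₀ Q.phi.val * Q.coface₂ Q.phi.val)) := by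
    rw [← coface₁_mul_coface₄_inv, ← mul_assoc, coface_inv_mul_val, one_mul]
  rw [pR_eq, ← h4, h, h1, eps₁_phi_inv, ← Algebra.TensorProduct.one_def,
    ← Algebra.TensorProduct.one_def, one_mul, contractTail_coface₃_coface₀_coface₂]

end Equivariant

/-! ### The element `γ` and Drinfeld's twist -/

/-- The anti-automorphism `x ⊗ y ↦ S(y) ⊗ S(x)` of `H ⊗ H`. -/
def flipS : H ⊗[k] H →ₗ[k] H ⊗[k] H := Q.SS ∘ₗ tflip

@[simp] theorem flipS_tmul (x y : H) : Q.flipS (x ⊗ₜ y) = Q.S y ⊗ₜ[k] Q.S x := by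
  simp [flipS, SS, tflip]

theorem flipS_mul (s t : H ⊗[k] H) : Q.flipS (s * t) = Q.flipS t * Q.flipS s := by
  induction s with
  | zero => simp
  | add x y hx hy => simp only [map_add, add_mul, mul_add, hx, hy]
  | tmul x y =>
    induction t with
    | zero => simp
    | add x y hx hy => simp only [map_add, add_mul, mul_add, hx, hy]
    | tmul a b => simp [Q.S_mul]

/-- The inverse `x ⊗ y ↦ S⁻¹(y) ⊗ S⁻¹(x)` of `flipS`. -/
def flipSinv : H ⊗[k] H →ₗ[k] H ⊗[k] H := Q.SSinv ∘ₗ tflip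

@[simp] theorem flipSinv_tmul (x y : H) :
    Q.flipSinv (x ⊗ₜ y) = Q.S.symm y ⊗ₜ[k] Q.S.symm x := by
  simp [flipSinv, SSinv, tflip]

theorem flipSinv_flipS (t : H ⊗[k] H) : Q.flipSinv (Q.flipS t) = t := by
  induction t with
  | zero => simp
  | add x y hx hy => simp only [map_add, hx, hy]
  | tmul x y => simp

theorem flipS_flipSinv (t : H ⊗[k] H) : Q.flipS (Q.flipSinv t) = t := by
  induction t with
  | zero => simp
  | add x y hx hy => simp only [map_add, hx, hy]
  | tmul x y => simp

theorem flipSinv_mul (s t : H ⊗[k] H) : Q.flipSinv (s * t) = Q.flipSinv t * Q.flipSinv s := by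
  rw [← Q.flipS_flipSinv s, ← Q.flipS_flipSinv t, ← flipS_mul, flipSinv_flipS, flipSinv_flipS,
    flipSinv_flipS]

/-- The anti-homomorphism `(S ⊗ S) ∘ Δᵒᵖ`. -/
def opComulS : H →ₗ[k] H ⊗[k] H := Q.flipS ∘ₗ Q.comul.toLinearMap

theorem opComulS_apply (a : H) : Q.opComulS a = Q.flipS (Q.comul a) := rfl

theorem opComulS_mul (a b : H) : Q.opComulS (a * b) = Q.opComulS b * Q.opComulS a := by
  rw [opComulS_apply, map_mul, flipS_mul]; rfl

/-- The linear map `x ⊗ y ⊗ z ⊗ w ↦ S(y) α z ⊗ S(x) α w`. -/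
def gammaMap : H ⊗[k] (H ⊗[k] (H ⊗[k] H)) →ₗ[k] H ⊗[k] H :=
  TensorProduct.map Q.sAlpha Q.sAlpha ∘ₗ
    (TensorProduct.tensorTensorTensorComm k H H H H).toLinearMap ∘ₗ
    TensorProduct.map tflip LinearMap.id ∘ₗ
    (TensorProduct.assoc k H H (H ⊗[k] H)).symm.toLinearMap

@[simp] theorem gammaMap_tmul (x y z w : H) : Q.gammaMap (x ⊗ₜ (y ⊗ₜ (z ⊗ₜ w))) =
    (Q.S y * (Q.alpha * z)) ⊗ₜ[k] (Q.S x * (Q.alpha * w)) := by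
  simp [gammaMap, tflip]

theorem gammaMap_tuvw : Q.gammaMap Q.tuvw = Q.gamma := rfl

theorem gammaMap_mul_tmul (t : H ⊗[k] (H ⊗[k] (H ⊗[k] H))) (x y : H) (u : H ⊗[k] H) :
    Q.gammaMap (t * (x ⊗ₜ (y ⊗ₜ u))) = (Q.S y ⊗ₜ Q.S x) * Q.gammaMap t * u := by
  induction t using tensor_induction₄ with
  | zero => simp
  | add x y hx hy => simp only [map_add, add_mul, mul_add, hx, hy]
  | pure a b c d =>
    induction u with
    | zero => simp
    | add x y hx hy => simp only [map_add, TensorProduct.tmul_add, mul_add, hx, hy]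
    | tmul z w => simp [Q.S_mul, mul_assoc]

theorem gammaMap_mul_assoc (t : H ⊗[k] (H ⊗[k] (H ⊗[k] H))) (e u : H ⊗[k] H) :
    Q.gammaMap (t * Algebra.TensorProduct.assoc k k k H H (H ⊗[k] H) (e ⊗ₜ u)) =
      Q.flipS e * Q.gammaMap t * u := by
  induction e with
  | zero => simp
  | add x y hx hy => simp only [map_add, TensorProduct.add_tmul, add_mul, mul_add, hx, hy]
  | tmul x y => simp [gammaMap_mul_tmul]

/-- The linear map `x ⊗ z ↦ x ⊗ 1 ⊗ 1 ⊗ z`. -/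
def outerLegs : H ⊗[k] H →ₗ[k] H ⊗[k] (H ⊗[k] (H ⊗[k] H)) :=
  TensorProduct.map LinearMap.id
    (TensorProduct.mk k H (H ⊗[k] H) 1 ∘ₗ TensorProduct.mk k H H 1)

@[simp] theorem outerLegs_tmul (x z : H) : (outerLegs (x ⊗ₜ z) : H ⊗[k] (H ⊗[k] (H ⊗[k] H))) =
    x ⊗ₜ[k] (1 ⊗ₜ[k] (1 ⊗ₜ[k] z)) := by
  simp [outerLegs]

theorem gammaMap_coface₂_mul (t : H ⊗[k] (H ⊗[k] H)) (s : H ⊗[k] (H ⊗[k] (H ⊗[k] H))) :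
    Q.gammaMap (Q.coface₂ t * s) = Q.gammaMap (outerLegs (Q.eps₂ t) * s) := by
  have key : ∀ (d : H ⊗[k] H) (a c x y z w : H), Q.gammaMap (
      (a ⊗ₜ Algebra.TensorProduct.assoc k k k H H H (d ⊗ₜ c)) * (x ⊗ₜ (y ⊗ₜ (z ⊗ₜ w)))) =
      (Q.sAlpha (d * (y ⊗ₜ z))) ⊗ₜ[k] (Q.S x * Q.S a * (Q.alpha * (c * w))) := by
    intro d a c x y z w
    induction d with
    | zero => simp
    | add x y hx hy =>
      simp only [map_add, TensorProduct.add_tmul, TensorProduct.tmul_add, add_mul, hx, hy]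
    | tmul d e => simp [Q.S_mul]
  induction s using tensor_induction₄ with
  | zero => simp
  | add x y hx hy => simp only [map_add, mul_add, hx, hy]
  | pure x y z w =>
    induction t using tensor_induction₃ with
    | zero => simp
    | add x y hx hy => simp only [map_add, add_mul, hx, hy]
    | pure a b c =>
      rw [coface₂_tmul, comulId_tmul, key, sAlpha_comul_mul, eps₂_tmul, map_smul, smul_mul_assoc,
        map_smul]
      simp [Q.S_mul, TensorProduct.smul_tmul']

theorem gammaMap_outerLegs_comul_mul (a : H) (s : H ⊗[k] (H ⊗[k] (H ⊗[k] H))) :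
    Q.gammaMap (outerLegs (Q.comul a) * s) = Q.counit a • Q.gammaMap s := by
  have key : ∀ (d : H ⊗[k] H) (x y z w : H), Q.gammaMap (outerLegs d * (x ⊗ₜ (y ⊗ₜ (z ⊗ₜ w)))) =
      (Q.S y * (Q.alpha * z)) ⊗ₜ[k] (Q.S x * Q.sAlpha d * w) := by
    intro d x y z w
    induction d with
    | zero => simp
    | add x y hx hy =>
      simp only [map_add, TensorProduct.tmul_add, add_mul, mul_add, hx, hy]
    | tmul d e => simp [Q.S_mul, mul_assoc]
  have h : Q.sAlpha (Q.comul a) = Q.counit a • Q.alpha := Q.antipode_alpha a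
  induction s using tensor_induction₄ with
  | zero => simp
  | add x y hx hy => simp only [map_add, mul_add, smul_add, hx, hy]
  | pure x y z w => rw [key, h]; simp [mul_assoc]

theorem coface₀_inv_mul_coface₃_idComul (d : H ⊗[k] H) :
    coface₀ Q.phi.inv * Q.coface₃ (Q.idComul d) =
      Q.coface₂ (Q.idComul d) * coface₀ Q.phi.inv := by
  induction d with
  | zero => simp
  | add x y hx hy => simp only [map_add, mul_add, add_mul, hx, hy]
  | tmul x y =>
    rw [idComul_tmul, coface₃_tmul, coface₂_tmul, coface₀_apply,
      Algebra.TensorProduct.tmul_mul_tmul, Algebra.TensorProduct.tmul_mul_tmul,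
      phi_inv_mul_idComul, one_mul, mul_one]

/-- The linear map `x ⊗ y ↦ (S ⊗ S)(Δᵒᵖ(x)) γ Δ(y)`. -/
def twistMap : H ⊗[k] H →ₗ[k] H ⊗[k] H :=
  LinearMap.mul' k (H ⊗[k] H) ∘ₗ
    TensorProduct.map (LinearMap.mulRight k Q.gamma ∘ₗ Q.opComulS) Q.comul.toLinearMap

@[simp] theorem twistMap_tmul (x y : H) :
    Q.twistMap (x ⊗ₜ y) = Q.opComulS x * Q.gamma * Q.comul y := by
  simp [twistMap]

theorem twistMap_pR : Q.twistMap Q.pR = Q.f := by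
  rw [pR_eq, f]
  generalize Q.phi.inv = t
  induction t with
  | zero => simp
  | add x y hx hy => simp only [map_add, hx, hy]
  | tmul x u => simp [mul_assoc, opComulS, flipS]

/-- `(S ⊗ S)(Δᵒᵖ(a₍₁₎)) γ Δ(a₍₂₎) = ε(a) γ` -/
theorem twistMap_comul (a : H) : Q.twistMap (Q.comul a) = Q.counit a • Q.gamma := by
  have h : ∀ d, Q.twistMap d = Q.gammaMap (Q.tuvw * Q.coface₃ (Q.comulId d)) := by
    have key : ∀ (e : H ⊗[k] H) (y : H),
        Q.coface₃ (Algebra.TensorProduct.assoc k k k H H H (e ⊗ₜ y)) =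
        Algebra.TensorProduct.assoc k k k H H (H ⊗[k] H) (e ⊗ₜ Q.comul y) := by
      intro e y
      induction e with
      | zero => simp
      | add x y hx hy => simp only [map_add, TensorProduct.add_tmul, hx, hy]
      | tmul d e => simp
    intro d
    induction d with
    | zero => simp
    | add x y hx hy => simp only [map_add, mul_add, hx, hy]
    | tmul x y =>
      rw [comulId_tmul, key, gammaMap_mul_assoc, gammaMap_tuvw, twistMap_tmul, opComulS_apply]
  have h2 : Q.tuvw * Q.coface₃ (Q.comulId (Q.comul a)) =
      Q.coface₂ (Q.idComul (Q.comul a)) * Q.tuvw := by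
    have e : Q.tuvw = coface₀ Q.phi.inv * Q.coface₃ Q.phi.val := rfl
    rw [e, mul_assoc, ← map_mul, ← idComul_comul_mul_phi, map_mul, ← mul_assoc,
      coface₀_inv_mul_coface₃_idComul, mul_assoc]
  rw [h, h2, gammaMap_coface₂_mul, eps₂_idComul, gammaMap_outerLegs_comul_mul, gammaMap_tuvw]

theorem twistMap_mul_tmul (s : H ⊗[k] H) (x y : H) :
    Q.twistMap (s * (x ⊗ₜ y)) = Q.opComulS x * Q.twistMap s * Q.comul y := by
  induction s with
  | zero => simp
  | add a b ha hb => simp only [map_add, add_mul, mul_add, ha, hb]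
  | tmul a b => simp [opComulS_mul, mul_assoc]

theorem twistMap_comul_mul (a : H) (s : H ⊗[k] H) :
    Q.twistMap (Q.comul a * s) = Q.counit a • Q.twistMap s := by
  induction s with
  | zero => simp
  | add x y hx hy => simp only [map_add, mul_add, smul_add, hx, hy]
  | tmul x y => rw [twistMap_mul_tmul, twistMap_comul]; simp

theorem opComulS_one : Q.opComulS 1 = 1 := by
  rw [opComulS_apply, map_one, Algebra.TensorProduct.one_def, flipS_tmul, Q.S_one]

/-- `f Δ(S(a)) = (S ⊗ S)(Δᵒᵖ(a)) f` -/
theorem f_mul_comul_S (a : H) : Q.f * Q.comul (Q.S a) = Q.opComulS a * Q.f := by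
  have h := Q.equivariant_pR_mul Q.twistMap Q.twistMap_comul_mul a
  rw [twistMap_mul_tmul, twistMap_mul_tmul, twistMap_pR, opComulS_one, map_one, mul_one,
    one_mul] at h
  exact h.symm

/-- `f Δ(α) = γ` -/
theorem f_mul_comul_alpha : Q.f * Q.comul Q.alpha = Q.gamma := by
  have h := Q.equivariant_pR_alpha Q.twistMap Q.twistMap_comul_mul
  rw [twistMap_mul_tmul, twistMap_pR, Algebra.TensorProduct.one_def, twistMap_tmul, opComulS_one,
    map_one, mul_one, one_mul, one_mul] at h
  exact h

/-! ### A formula for `U` without the twist -/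

/-- The linear map `x ⊗ t ↦ Δ(S(x) α) t`. -/
def comulSAlpha : H ⊗[k] (H ⊗[k] H) →ₗ[k] H ⊗[k] H :=
  LinearMap.mul' k (H ⊗[k] H) ∘ₗ TensorProduct.map
    (Q.comul.toLinearMap ∘ₗ LinearMap.mulRight k Q.alpha ∘ₗ Q.S.toLinearMap) LinearMap.id

@[simp] theorem comulSAlpha_tmul (x : H) (t : H ⊗[k] H) :
    Q.comulSAlpha (x ⊗ₜ t) = Q.comul (Q.S x * Q.alpha) * t := by
  simp [comulSAlpha]

theorem comulSAlpha_mul_tmul (s : H ⊗[k] (H ⊗[k] H)) (x : H) (t : H ⊗[k] H) :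
    Q.comulSAlpha (s * (x ⊗ₜ t)) = Q.comul (Q.S x) * Q.comulSAlpha s * t := by
  induction s with
  | zero => simp
  | add x y hx hy => simp only [map_add, add_mul, mul_add, hx, hy]
  | tmul a b => simp [Q.S_mul, mul_assoc]

theorem comulSAlpha_idComul_comul_mul (a : H) (s : H ⊗[k] (H ⊗[k] H)) :
    Q.comulSAlpha (Q.idComul (Q.comul a) * s) = Q.counit a • Q.comulSAlpha s := by
  have key : ∀ (d : H ⊗[k] H) (x : H) (t : H ⊗[k] H),
      Q.comulSAlpha (Q.idComul d * (x ⊗ₜ t)) = Q.comul (Q.S x * Q.sAlpha d) * t := by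
    intro d x t
    induction d with
    | zero => simp
    | add x y hx hy => simp only [map_add, add_mul, mul_add, hx, hy]
    | tmul a b => simp [Q.S_mul, mul_assoc]
  have h : Q.sAlpha (Q.comul a) = Q.counit a • Q.alpha := Q.antipode_alpha a
  induction s with
  | zero => simp
  | add x y hx hy => simp only [map_add, mul_add, smul_add, hx, hy]
  | tmul x t => rw [key, h]; simp

/-- The linear map `x ⊗ y ↦ Δ(S(X x₍₁₎) α) (Y x₍₂₎ ⊗ Z y)`. -/
def evMap : H ⊗[k] H →ₗ[k] H ⊗[k] H :=
  Q.comulSAlpha ∘ₗ LinearMap.mulLeft k Q.phi.val ∘ₗ Q.comulId.toLinearMap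

theorem evMap_apply (d : H ⊗[k] H) :
    Q.evMap d = Q.comulSAlpha (Q.phi.val * Q.comulId d) := rfl

theorem evMap_comul_mul (a : H) (s : H ⊗[k] H) :
    Q.evMap (Q.comul a * s) = Q.counit a • Q.evMap s := by
  rw [evMap_apply, map_mul Q.comulId, ← mul_assoc, ← idComul_comul_mul_phi, mul_assoc,
    comulSAlpha_idComul_comul_mul, evMap_apply]

/-- The element `Δ(S(X x̄₍₁₎) α) (Y x̄₍₂₎ ⊗ Z ȳ β S(z̄))`, which turns out to be `U`. -/
def evElt : H ⊗[k] H := Q.evMap Q.pR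

/-- For `P ∈ H ⊗ H`, the linear map `x ⊗ y ↦ Δ(S(x)) P (y ⊗ 1)`. -/
def evOrbit (P : H ⊗[k] H) : H ⊗[k] H →ₗ[k] H ⊗[k] H :=
  LinearMap.mul' k (H ⊗[k] H) ∘ₗ
    TensorProduct.map (LinearMap.mulRight k P ∘ₗ Q.comul.toLinearMap ∘ₗ Q.S.toLinearMap)
      (Algebra.TensorProduct.includeLeft : H →ₐ[k] H ⊗[k] H).toLinearMap

@[simp] theorem evOrbit_tmul (P : H ⊗[k] H) (x y : H) :
    Q.evOrbit P (x ⊗ₜ y) = Q.comul (Q.S x) * P * (y ⊗ₜ 1) := by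
  simp [evOrbit]

/-- `U (1 ⊗ S(a)) = Δ(S(a₍₁₎)) U (a₍₂₎ ⊗ 1)`, for `U` in the form `evElt`. -/
theorem evElt_mul_one_tmul_S (a : H) :
    Q.evElt * (1 ⊗ₜ Q.S a) = Q.evOrbit Q.evElt (Q.comul a) := by
  have h := Q.equivariant_pR_mul Q.evMap Q.evMap_comul_mul a
  have h1 : ∀ (s : H ⊗[k] H) (b : H), Q.evMap (s * (1 ⊗ₜ b)) = Q.evMap s * (1 ⊗ₜ b) := by
    intro s b
    rw [evMap_apply, map_mul Q.comulId, ← mul_assoc, comulId_tmul, map_one,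
      Algebra.TensorProduct.one_def, Algebra.TensorProduct.assoc_tmul, comulSAlpha_mul_tmul,
      Q.S_one, map_one, one_mul, evMap_apply]
  have h2 : ∀ (s : H ⊗[k] (H ⊗[k] H)) (e : H ⊗[k] H), Q.comulSAlpha (s *
      Algebra.TensorProduct.assoc k k k H H H (e ⊗ₜ 1)) = Q.evOrbit (Q.comulSAlpha s) e := by
    intro s e
    induction e with
    | zero => simp
    | add x y hx hy => simp only [map_add, TensorProduct.add_tmul, mul_add, hx, hy]
    | tmul x y => simp [comulSAlpha_mul_tmul]
  rw [h1, evMap_apply, map_mul Q.comulId, ← mul_assoc, comulId_tmul, h2] at h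
  exact h.symm

/-- `U (1 ⊗ α) = Δ(S(X) α) (Y ⊗ Z)`, for `U` in the form `evElt`. -/
theorem evElt_mul_one_tmul_alpha :
    Q.evElt * (1 ⊗ₜ Q.alpha) = Q.comulSAlpha Q.phi.val := by
  have h := Q.equivariant_pR_alpha Q.evMap Q.evMap_comul_mul
  have h1 : ∀ (s : H ⊗[k] H) (b : H), Q.evMap (s * (1 ⊗ₜ b)) = Q.evMap s * (1 ⊗ₜ b) := by
    intro s b
    rw [evMap_apply, map_mul Q.comulId, ← mul_assoc, comulId_tmul, map_one,
      Algebra.TensorProduct.one_def, Algebra.TensorProduct.assoc_tmul, comulSAlpha_mul_tmul,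
      Q.S_one, map_one, one_mul, evMap_apply]
  rw [h1, Q.evMap_apply 1, map_one, mul_one] at h
  exact h

theorem sAlpha_idBetaS (t : H ⊗[k] (H ⊗[k] H)) : Q.sAlpha (Q.idBetaS t) = Q.sAlphaBetaS t := by
  induction t with
  | zero => simp
  | add x y hx hy => simp only [map_add, hx, hy]
  | tmul x t => simp

theorem sAlpha_pR : Q.sAlpha Q.pR = 1 := by
  rw [pR_eq, sAlpha_idBetaS, sAlphaBetaS_phi_inv]

/-- `f U = (S ⊗ S)(q_R²¹)`, for `U` in the form `evElt`. -/
theorem f_mul_evElt : Q.f * Q.evElt = Q.flipS Q.qR := by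
  have h1 : ∀ s, Q.f * Q.comulSAlpha s = Q.gammaMap (Q.tuvw * Q.coface₁ s) := by
    intro s
    induction s with
    | zero => simp
    | add x y hx hy => simp only [map_add, mul_add, hx, hy]
    | tmul x u =>
      rw [coface₁_tmul, gammaMap_mul_assoc, gammaMap_tuvw, comulSAlpha_tmul, map_mul, ← mul_assoc,
        ← mul_assoc, f_mul_comul_S, mul_assoc (Q.opComulS x), f_mul_comul_alpha, opComulS_apply]
  have h2 : ∀ x y : H, Q.coface₁ (Q.comulId (x ⊗ₜ y)) =
      coface₄ (Q.comulId (Q.comul x)) * (1 ⊗ₜ (1 ⊗ₜ (1 ⊗ₜ y))) := by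
    intro x y
    have key2 : ∀ (e : H ⊗[k] H) (b : H),
        Algebra.TensorProduct.assoc k k k H H (H ⊗[k] H) (e ⊗ₜ (b ⊗ₜ y)) =
        coface₄ (Algebra.TensorProduct.assoc k k k H H H (e ⊗ₜ b)) *
          (1 ⊗ₜ (1 ⊗ₜ (1 ⊗ₜ y))) := by
      intro e b
      induction e with
      | zero => simp
      | add x y hx hy => simp only [map_add, TensorProduct.add_tmul, add_mul, hx, hy]
      | tmul d e => simp
    have key : ∀ (e : H ⊗[k] H),
        Q.coface₁ (Algebra.TensorProduct.assoc k k k H H H (e ⊗ₜ y)) =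
        coface₄ (Q.comulId e) * (1 ⊗ₜ (1 ⊗ₜ (1 ⊗ₜ y))) := by
      intro e
      induction e with
      | zero => simp
      | add x y hx hy => simp only [map_add, TensorProduct.add_tmul, add_mul, hx, hy]
      | tmul d e =>
        rw [Algebra.TensorProduct.assoc_tmul, coface₁_tmul, key2, comulId_tmul]
    rw [comulId_tmul, key]
  have h3 : ∀ d : H ⊗[k] H, coface₄ (Q.idComul d) =
      Q.coface₂ (Algebra.TensorProduct.assoc k k k H H H (d ⊗ₜ 1)) := by
    intro d
    have key : ∀ (a : H) (e : H ⊗[k] H), coface₄ (a ⊗ₜ e) =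
        a ⊗ₜ[k] (Algebra.TensorProduct.assoc k k k H H H (e ⊗ₜ 1)) := by
      intro a e
      induction e with
      | zero => simp
      | add x y hx hy =>
        simp only [map_add, TensorProduct.add_tmul, TensorProduct.tmul_add, hx, hy]
      | tmul d e => simp
    induction d with
    | zero => simp
    | add x y hx hy => simp only [map_add, TensorProduct.add_tmul, hx, hy]
    | tmul x y =>
      rw [idComul_tmul, key, Algebra.TensorProduct.assoc_tmul, coface₂_tmul, comulId_tmul]
  have h4 : ∀ (x y : H) (s : H ⊗[k] (H ⊗[k] H)),
      Q.gammaMap ((x ⊗ₜ (1 ⊗ₜ (1 ⊗ₜ 1))) * (coface₄ s * (1 ⊗ₜ (1 ⊗ₜ (1 ⊗ₜ y))))) =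
      Q.flipS (TensorProduct.map LinearMap.id (LinearMap.mul' k H ∘ₗ
        TensorProduct.map (Q.S.symm.toLinearMap ∘ₗ LinearMap.mulLeft k Q.alpha) LinearMap.id ∘ₗ
        tflip) s) * (1 ⊗ₜ Q.sAlpha (x ⊗ₜ y)) := by
    intro x y s
    induction s using tensor_induction₃ with
    | zero => simp
    | add x y hx hy => simp only [map_add, add_mul, mul_add, hx, hy]
    | pure a b c => simp [Q.S_mul, tflip, mul_assoc]
  have h5 : ∀ d, Q.f * Q.evMap d = Q.flipS Q.qR * (1 ⊗ₜ Q.sAlpha d) := by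
    intro d
    induction d with
    | zero => simp
    | add x y hx hy => simp only [map_add, mul_add, TensorProduct.tmul_add, hx, hy]
    | tmul x y =>
      rw [evMap_apply, h1, map_mul Q.coface₁, ← mul_assoc, tuvw_mul_coface₁, mul_assoc,
        gammaMap_coface₂_mul, eps₂_phi, h2, ← mul_assoc (coface₄ _), ← map_mul,
        ← idComul_comul_mul_phi, map_mul (coface₄ (k := k) (H := H)), h3, Algebra.TensorProduct.one_def, outerLegs_tmul,
        ← Algebra.TensorProduct.one_def, ← Algebra.TensorProduct.one_def,
        ← Algebra.TensorProduct.one_def, one_mul, mul_assoc, gammaMap_coface₂_mul, eps₂_assoc,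
        Q.comul_counit, outerLegs_tmul, h4]
      rfl
  rw [evElt, h5, sAlpha_pR, ← Algebra.TensorProduct.one_def, mul_one]

/-! ### Invertibility of Drinfeld's twist -/

/-- The inverse of Drinfeld's twist. -/
def twistInv : H ⊗[k] H := Q.evOrbit Q.evElt Q.pR

theorem evOrbit_evElt_mul (d : H ⊗[k] H) (x y : H) :
    Q.evOrbit Q.evElt d * (Q.S y ⊗ₜ Q.S x) =
      Q.evOrbit Q.evElt (Q.comul x * d * (1 ⊗ₜ Q.S y)) := by
  have key : ∀ (e : H ⊗[k] H) (a b : H), Q.evOrbit Q.evElt (e * (a ⊗ₜ b)) =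
      Q.comul (Q.S a) * Q.evOrbit Q.evElt e * (b ⊗ₜ 1) := by
    intro e a b
    induction e with
    | zero => simp
    | add x y hx hy => simp only [map_add, add_mul, mul_add, hx, hy]
    | tmul x y => simp [Q.S_mul, mul_assoc]
  induction d with
  | zero => simp
  | add x y hx hy => simp only [map_add, add_mul, mul_add, hx, hy]
  | tmul a b =>
    rw [mul_assoc, Algebra.TensorProduct.tmul_mul_tmul, key, ← evElt_mul_one_tmul_S, evOrbit_tmul]
    simp [mul_assoc]

theorem twistInv_mul_flipS (e : H ⊗[k] H) :
    Q.twistInv * Q.flipS e = Q.evOrbit Q.evElt (Q.pROrbit e) := by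
  induction e with
  | zero => simp
  | add x y hx hy => simp only [map_add, mul_add, hx, hy]
  | tmul x y => rw [flipS_tmul, twistInv, evOrbit_evElt_mul, pROrbit_tmul]

theorem twistInv_mul_opComulS (a : H) :
    Q.twistInv * Q.opComulS a = Q.comul (Q.S a) * Q.twistInv := by
  rw [opComulS_apply, twistInv_mul_flipS, ← pR_mul_tmul_one, twistInv]
  generalize Q.pR = d
  induction d with
  | zero => simp
  | add x y hx hy => simp only [map_add, add_mul, mul_add, hx, hy]
  | tmul x y => simp [Q.S_mul, mul_assoc]

/-- The linear map `x ⊗ y ⊗ z ⊗ w ↦ Δ(x) p_R (1 ⊗ S(y) α z) ⊗ w`. -/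
def pRSandwichId : H ⊗[k] (H ⊗[k] (H ⊗[k] H)) →ₗ[k] H ⊗[k] (H ⊗[k] H) :=
  (TensorProduct.assoc k H H H).toLinearMap ∘ₗ
    TensorProduct.map Q.pRSandwich LinearMap.id ∘ₗ
    (TensorProduct.assoc k H (H ⊗[k] H) H).symm.toLinearMap ∘ₗ
    TensorProduct.map LinearMap.id (TensorProduct.assoc k H H H).symm.toLinearMap

@[simp] theorem pRSandwichId_tmul (x y z w : H) : Q.pRSandwichId (x ⊗ₜ (y ⊗ₜ (z ⊗ₜ w))) =
    TensorProduct.assoc k H H H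
      ((Q.comul x * Q.pR * (1 ⊗ₜ (Q.S y * (Q.alpha * z)))) ⊗ₜ[k] w) := by
  simp [pRSandwichId]

theorem assoc_mul_assoc (d e : H ⊗[k] H) (x y : H) :
    TensorProduct.assoc k H H H (d ⊗ₜ x) * TensorProduct.assoc k H H H (e ⊗ₜ y) =
      TensorProduct.assoc k H H H ((d * e) ⊗ₜ (x * y)) := by
  induction d with
  | zero => simp
  | add x y hx hy => simp only [map_add, TensorProduct.add_tmul, add_mul, hx, hy]
  | tmul a b =>
    induction e with
    | zero => simp
    | add x y hx hy => simp only [map_add, TensorProduct.add_tmul, mul_add, hx, hy]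
    | tmul c d => simp

theorem pRSandwichId_coface₂_mul (t : H ⊗[k] (H ⊗[k] H)) (s : H ⊗[k] (H ⊗[k] (H ⊗[k] H))) :
    Q.pRSandwichId (Q.coface₂ t * s) = Q.comulId (Q.eps₂ t) * Q.pRSandwichId s := by
  have key : ∀ (d : H ⊗[k] H) (a c x y z w : H), Q.pRSandwichId (
      (a ⊗ₜ Algebra.TensorProduct.assoc k k k H H H (d ⊗ₜ c)) * (x ⊗ₜ (y ⊗ₜ (z ⊗ₜ w)))) =
      TensorProduct.assoc k H H H ((Q.comul (a * x) * Q.pR *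
        (1 ⊗ₜ (Q.sAlpha (d * (y ⊗ₜ z))))) ⊗ₜ[k] (c * w)) := by
    intro d a c x y z w
    induction d with
    | zero => simp
    | add x y hx hy =>
      simp only [map_add, TensorProduct.add_tmul, TensorProduct.tmul_add, add_mul, mul_add, hx, hy]
    | tmul d e => simp
  induction s using tensor_induction₄ with
  | zero => simp
  | add x y hx hy => simp only [map_add, mul_add, hx, hy]
  | pure x y z w =>
    induction t using tensor_induction₃ with
    | zero => simp
    | add x y hx hy => simp only [map_add, add_mul, hx, hy]
    | pure a b c =>
      have e : Q.comulId (a ⊗ₜ c) = TensorProduct.assoc k H H H (Q.comul a ⊗ₜ c) :=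
        Q.comulId_tmul a c
      rw [coface₂_tmul, comulId_tmul, key, sAlpha_comul_mul, eps₂_tmul, map_smul, smul_mul_assoc,
        pRSandwichId_tmul, e, assoc_mul_assoc]
      simp [mul_assoc, ← TensorProduct.smul_tmul']

theorem pRSandwichId_coface₄_mul_coface₁ (u v : H ⊗[k] (H ⊗[k] H)) :
    Q.pRSandwichId (coface₄ u * Q.coface₁ v) =
      TensorProduct.assoc k H H H (Q.pRSandwich u ⊗ₜ 1) * v := by
  induction u using tensor_induction₃ with
  | zero => simp
  | add x y hx hy => simp only [map_add, TensorProduct.add_tmul, add_mul, hx, hy]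
  | pure x y z =>
    induction v using tensor_induction₃ with
    | zero => simp
    | add x y hx hy => simp only [map_add, mul_add, hx, hy]
    | pure a b c =>
      have key : ∀ e : H ⊗[k] H, Q.pRSandwichId ((x ⊗ₜ (y ⊗ₜ (z ⊗ₜ 1))) *
          Algebra.TensorProduct.assoc k k k H H (H ⊗[k] H) (e ⊗ₜ (b ⊗ₜ c))) =
          TensorProduct.assoc k H H H ((Q.comul x * Q.pROrbit e *
            (1 ⊗ₜ (Q.S y * (Q.alpha * (z * b))))) ⊗ₜ c) := by
        intro e
        induction e with
        | zero => simp
        | add x y hx hy => simp only [map_add, TensorProduct.add_tmul, add_mul, mul_add, hx, hy]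
        | tmul d e => simp [mul_assoc, Q.S_mul]
      have e : (a ⊗ₜ (b ⊗ₜ c) : H ⊗[k] (H ⊗[k] H)) =
        TensorProduct.assoc k H H H ((a ⊗ₜ b) ⊗ₜ c) := rfl
      rw [coface₁_tmul, coface₄_tmul, key, ← pR_mul_tmul_one, e, assoc_mul_assoc]
      simp [mul_assoc]

theorem pRSandwichId_tuvw : Q.pRSandwichId Q.tuvw = Q.phi.inv := by
  rw [tuvw_eq, pRSandwichId_coface₂_mul, pRSandwichId_coface₄_mul_coface₁, eps₂_phi,
    pRSandwich_phi, map_one, one_mul]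
  exact one_mul _

theorem twistInv_mul_gamma : Q.twistInv * Q.gamma = Q.comul Q.alpha := by
  have h : ∀ t, Q.twistInv * Q.gammaMap t =
      Q.comulSAlpha (Q.phi.val * Q.pRSandwichId t) := by
    intro t
    induction t using tensor_induction₄ with
    | zero => simp
    | add x y hx hy => simp only [map_add, mul_add, hx, hy]
    | pure x y z w =>
      have key : ∀ d : H ⊗[k] H,
          Q.evOrbit Q.evElt d * ((Q.alpha * z) ⊗ₜ (Q.alpha * w)) = Q.comulSAlpha (Q.phi.val *
            TensorProduct.assoc k H H H ((d * (1 ⊗ₜ (Q.alpha * z))) ⊗ₜ w)) := by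
        intro d
        induction d with
        | zero => simp
        | add x y hx hy => simp only [map_add, TensorProduct.add_tmul, add_mul, mul_add, hx, hy]
        | tmul a b =>
          have e : ((b * (Q.alpha * z)) ⊗ₜ (Q.alpha * w) : H ⊗[k] H) =
            (1 ⊗ₜ Q.alpha) * ((b * (Q.alpha * z)) ⊗ₜ w) := by simp
          rw [evOrbit_tmul, mul_assoc, Algebra.TensorProduct.tmul_mul_tmul, one_mul, e, mul_assoc,
            ← mul_assoc Q.evElt, evElt_mul_one_tmul_alpha, Algebra.TensorProduct.tmul_mul_tmul,
            TensorProduct.assoc_tmul, comulSAlpha_mul_tmul]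
          simp [mul_assoc]
      have e : ((Q.S y * (Q.alpha * z)) ⊗ₜ (Q.S x * (Q.alpha * w)) : H ⊗[k] H) =
        (Q.S y ⊗ₜ Q.S x) * ((Q.alpha * z) ⊗ₜ (Q.alpha * w)) := by simp
      rw [gammaMap_tmul, e, ← mul_assoc, twistInv, evOrbit_evElt_mul, key, pRSandwichId_tmul,
        mul_assoc _ (1 ⊗ₜ _) (1 ⊗ₜ _)]
      simp
  rw [← gammaMap_tuvw, h, pRSandwichId_tuvw, Q.phi.val_inv, Algebra.TensorProduct.one_def,
    comulSAlpha_tmul, Q.S_one, one_mul, mul_one]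

theorem twistInv_mul_f : Q.twistInv * Q.f = 1 := by
  have h : ∀ d, Q.twistInv * Q.twistMap d = Q.comul (Q.sAlpha d) := by
    intro d
    induction d with
    | zero => simp
    | add x y hx hy => simp only [map_add, mul_add, hx, hy]
    | tmul x y =>
      rw [twistMap_tmul, ← mul_assoc, ← mul_assoc, twistInv_mul_opComulS, mul_assoc _ Q.twistInv,
        twistInv_mul_gamma, sAlpha_tmul, map_mul, map_mul, mul_assoc]
  rw [← twistMap_pR, h, sAlpha_pR, map_one]

theorem isUnit_f [FiniteDimensional k H] : IsUnit Q.f := by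
  have : IsNoetherianRing (H ⊗[k] H) := isNoetherian_of_tower k inferInstance
  exact IsUnit.of_mul_eq_one_right _ Q.twistInv_mul_f

theorem U_eq_evElt [FiniteDimensional k H] : Q.U = Q.evElt := by
  have h : Q.SS (tflip Q.qR) = Q.f * Q.evElt := Q.f_mul_evElt.symm
  rw [U, h, fInv, ← mul_assoc, Ring.inverse_mul_cancel _ Q.isUnit_f, one_mul]

/-! ### A formula for `V` without the twist -/

/-- The linear map `x ⊗ y ⊗ z ↦ Δ(S(x) α y) p_R (1 ⊗ S(z))`. -/
def evMap' : H ⊗[k] (H ⊗[k] H) →ₗ[k] H ⊗[k] H :=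
  Q.comulSAlpha ∘ₗ TensorProduct.map LinearMap.id Q.pROrbit

@[simp] theorem evMap'_tmul (x y z : H) : Q.evMap' (x ⊗ₜ (y ⊗ₜ z)) =
    Q.comul (Q.S x * Q.alpha * y) * Q.pR * (1 ⊗ₜ Q.S z) := by
  simp [evMap', mul_assoc]

/-- `U = Δ(S(x̄) α ȳ) p_R (1 ⊗ S(z̄))`, by the pentagon. -/
theorem evMap'_phi_inv : Q.evMap' Q.phi.inv = Q.evElt := by
  let C : H ⊗[k] (H ⊗[k] (H ⊗[k] H)) →ₗ[k] H ⊗[k] (H ⊗[k] H) :=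
    TensorProduct.map LinearMap.id Q.idBetaS
  have h1 : ∀ t, C (Q.coface₂ t * coface₀ Q.phi.inv) =
      TensorProduct.map LinearMap.id Q.pROrbit t := by
    intro t
    induction t using tensor_induction₃ with
    | zero => simp
    | add x y hx hy => simp only [map_add, add_mul, hx, hy]
    | pure x y z =>
      rw [coface₂_tmul, coface₀_apply, Algebra.TensorProduct.tmul_mul_tmul, comulId_tmul]
      simp [C, idBetaS_assoc_mul, pR_eq]
  have h2 : ∀ s t, C (s * Q.coface₃ t) =
      C s * Algebra.TensorProduct.assoc k k k H H H (Q.eps₃ t ⊗ₜ 1) := by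
    intro s t
    induction s with
    | zero => simp
    | add x y hx hy => simp only [map_add, add_mul, hx, hy]
    | tmul s u =>
      induction t using tensor_induction₃ with
      | zero => simp
      | add x y hx hy => simp only [map_add, mul_add, TensorProduct.add_tmul, hx, hy]
      | pure x y z =>
        rw [coface₃_tmul, Algebra.TensorProduct.tmul_mul_tmul]
        simp [C, idBetaS_mul_idComul, ← TensorProduct.smul_tmul', mul_smul_comm,
          -idComul_tmul]
  have h3 : ∀ s t, C (coface₄ s * Q.coface₁ t) = s * Q.comulId (Q.idBetaS t) := by
    intro s t
    induction t using tensor_induction₃ with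
    | zero => simp
    | add x y hx hy => simp only [map_add, mul_add, hx, hy]
    | pure x y z =>
      rw [coface₁_tmul, idBetaS_tmul, comulId_tmul]
      generalize Q.comul x = e
      induction s using tensor_induction₃ with
      | zero => simp
      | add x y hx hy => simp only [map_add, add_mul, hx, hy]
      | pure a b c =>
        induction e with
        | zero => simp
        | add x y hx hy => simp only [map_add, mul_add, TensorProduct.add_tmul, hx, hy]
        | tmul d e => simp [C, mul_assoc]
  have h := congrArg (fun t => Q.comulSAlpha (C t)) Q.coface₂_inv_mul_coface₀_inv
  simp only [h1] at h
  rw [← mul_assoc, h2, h3, eps₃_phi_inv, ← Algebra.TensorProduct.one_def, map_one, mul_one] at h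
  exact h

/-- The linear map `x ⊗ y ⊗ z ↦ Δ(x β S(y)) U (z ⊗ 1)`, for `U` in the form `evElt`. -/
def coevEv : H ⊗[k] (H ⊗[k] H) →ₗ[k] H ⊗[k] H :=
  LinearMap.mul' k (H ⊗[k] H) ∘ₗ
    TensorProduct.map (LinearMap.mulRight k Q.evElt ∘ₗ Q.comul.toLinearMap ∘ₗ Q.betaS)
      (Algebra.TensorProduct.includeLeft : H →ₐ[k] H ⊗[k] H).toLinearMap ∘ₗ
    (TensorProduct.assoc k H H H).symm.toLinearMap

@[simp] theorem coevEv_tmul (x y z : H) : Q.coevEv (x ⊗ₜ (y ⊗ₜ z)) =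
    Q.comul (x * Q.beta * Q.S y) * Q.evElt * (z ⊗ₜ 1) := by
  simp [coevEv]

/-- `Δ(X β S(Y)) U (Z ⊗ 1) = p_R` -/
theorem coevEv_phi : Q.coevEv Q.phi.val = Q.pR := by
  have h1 : ∀ (x y z : H) (s : H ⊗[k] (H ⊗[k] H)),
      Q.comul (x * Q.beta * Q.S y) * Q.evMap' s * (z ⊗ₜ 1) =
      Q.pROrbit (Q.contractHead (coface₀ s * Q.coface₃ (x ⊗ₜ (y ⊗ₜ z)))) := by
    intro x y z s
    induction s using tensor_induction₃ with
    | zero => simp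
    | add x y hx hy => simp only [map_add, mul_add, add_mul, hx, hy]
    | pure a b c =>
      have e : ((1 : H) ⊗ₜ Q.S c : H ⊗[k] H) * (z ⊗ₜ 1) = (z ⊗ₜ 1) * (1 ⊗ₜ Q.S c) := by simp
      rw [evMap'_tmul, mul_assoc _ _ (z ⊗ₜ 1), mul_assoc _ _ (z ⊗ₜ 1), e, mul_assoc _ Q.pR,
        ← mul_assoc Q.pR, pR_mul_tmul_one,
        coface₃_tmul, idComul_tmul]
      generalize Q.comul z = w
      induction w with
      | zero => simp
      | add x y hx hy =>
        simp only [map_add, mul_add, add_mul, TensorProduct.tmul_add, hx, hy]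
      | tmul d e => simp [Q.S_mul, mul_assoc]
  have h2 : ∀ t, Q.coevEv t =
      Q.pROrbit (Q.contractHead (coface₀ Q.phi.inv * Q.coface₃ t)) := by
    intro t
    induction t using tensor_induction₃ with
    | zero => simp
    | add x y hx hy => simp only [map_add, mul_add, hx, hy]
    | pure x y z => rw [coevEv_tmul, ← h1, evMap'_phi_inv]
  have e : Q.tuvw = coface₀ Q.phi.inv * Q.coface₃ Q.phi.val := rfl
  rw [h2, ← e, contractHead_tuvw, Algebra.TensorProduct.one_def, pROrbit_tmul]
  simp [Q.S_one, ← Algebra.TensorProduct.one_def]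

/-- The linear map `x ⊗ y ⊗ z ↦ (1 ⊗ S⁻¹(z)) q_R Δ(y S⁻¹(x β))`. -/
def coevMap' : H ⊗[k] (H ⊗[k] H) →ₗ[k] H ⊗[k] H :=
  LinearMap.mul' k (H ⊗[k] H) ∘ₗ
    TensorProduct.map ((Algebra.TensorProduct.includeRight : H →ₐ[k] H ⊗[k] H).toLinearMap ∘ₗ
        Q.S.symm.toLinearMap)
      (LinearMap.mulLeft k Q.qR ∘ₗ Q.comul.toLinearMap ∘ₗ Q.S.symm.toLinearMap ∘ₗ Q.betaS) ∘ₗ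
    (TensorProduct.comm k (H ⊗[k] H) H).toLinearMap ∘ₗ
    (TensorProduct.assoc k H H H).symm.toLinearMap

theorem S_symm_mul (a b : H) : Q.S.symm (a * b) = Q.S.symm b * Q.S.symm a := by
  apply Q.S.injective
  simp [Q.S_mul]

theorem S_symm_one : Q.S.symm 1 = 1 := by
  rw [LinearEquiv.symm_apply_eq, Q.S_one]

@[simp] theorem coevMap'_tmul (x y z : H) : Q.coevMap' (x ⊗ₜ (y ⊗ₜ z)) =
    (1 ⊗ₜ Q.S.symm z) * (Q.qR * Q.comul (y * Q.S.symm (x * Q.beta))) := by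
  simp [coevMap', S_symm_mul]

/-- `V = (1 ⊗ S⁻¹(Z)) q_R Δ(Y S⁻¹(X β))` -/
theorem V_eq_coevMap' : Q.V = Q.coevMap' Q.phi.val := by
  have h : ∀ t, Q.flipS (Q.coevMap' t) = Q.f * Q.coevEv t := by
    intro t
    induction t using tensor_induction₃ with
    | zero => simp
    | add x y hx hy => simp only [map_add, mul_add, hx, hy]
    | pure x y z =>
      rw [coevMap'_tmul, flipS_mul, flipS_mul, ← opComulS_apply, ← f_mul_evElt, coevEv_tmul,
        ← mul_assoc, ← f_mul_comul_S, flipS_tmul]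
      simp [Q.S_mul, Q.S_one, mul_assoc]
  have e : Q.V = Q.flipSinv Q.pR * Q.flipSinv Q.f := rfl
  rw [e, ← flipSinv_mul, ← coevEv_phi, ← h, flipSinv_flipS]

/-- The linear map `x ⊗ y ⊗ z ↦ x ⊗ S⁻¹(α z) y`, which sends `φ` to `q_R`. -/
def idSinvAlpha : H ⊗[k] (H ⊗[k] H) →ₗ[k] H ⊗[k] H :=
  TensorProduct.map LinearMap.id (Q.S.symm.toLinearMap ∘ₗ Q.sAlpha)

@[simp] theorem idSinvAlpha_tmul (x : H) (t : H ⊗[k] H) :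
    Q.idSinvAlpha (x ⊗ₜ t) = x ⊗ₜ[k] Q.S.symm (Q.sAlpha t) := by
  simp [idSinvAlpha]

theorem qR_eq : Q.qR = Q.idSinvAlpha Q.phi.val := by
  rw [qR]
  generalize Q.phi.val = t
  induction t using tensor_induction₃ with
  | zero => simp
  | add x y hx hy => simp only [map_add, hx, hy]
  | pure x y z => simp [tflip, S_symm_mul]

theorem idSinvAlpha_idComul_mul (s : H ⊗[k] (H ⊗[k] H)) (d : H ⊗[k] H) :
    Q.idSinvAlpha (Q.idComul d * s) =
      ((Algebra.TensorProduct.rid k k H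
        (Algebra.TensorProduct.map (AlgHom.id k H) Q.counit d)) ⊗ₜ 1) * Q.idSinvAlpha s := by
  induction s with
  | zero => simp
  | add x y hx hy => simp only [map_add, mul_add, hx, hy]
  | tmul x t =>
    induction d with
    | zero => simp
    | add x y hx hy => simp only [map_add, add_mul, TensorProduct.add_tmul, hx, hy]
    | tmul a b => simp [sAlpha_comul_mul, TensorProduct.smul_tmul']

theorem idSinvAlpha_mul_assoc (e : H ⊗[k] H) (b : H) (s : H ⊗[k] (H ⊗[k] H)) :
    Q.idSinvAlpha (s * Algebra.TensorProduct.assoc k k k H H H (e ⊗ₜ b)) =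
      (1 ⊗ₜ Q.S.symm b) * (Q.idSinvAlpha s * e) := by
  induction s using tensor_induction₃ with
  | zero => simp
  | add x y hx hy => simp only [map_add, mul_add, add_mul, hx, hy]
  | pure x y z =>
    induction e with
    | zero => simp
    | add x y hx hy => simp only [map_add, mul_add, TensorProduct.add_tmul, hx, hy]
    | tmul u v => simp [Q.S_mul, S_symm_mul, mul_assoc]

/-- The linear map `x ⊗ y ↦ (1 ⊗ S⁻¹(y)) q_R Δ(x)`. -/
def qROrbit : H ⊗[k] H →ₗ[k] H ⊗[k] H :=
  LinearMap.mul' k (H ⊗[k] H) ∘ₗ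
    TensorProduct.map ((Algebra.TensorProduct.includeRight : H →ₐ[k] H ⊗[k] H).toLinearMap ∘ₗ
        Q.S.symm.toLinearMap)
      (LinearMap.mulLeft k Q.qR ∘ₗ Q.comul.toLinearMap) ∘ₗ tflip

@[simp] theorem qROrbit_tmul (x y : H) :
    Q.qROrbit (x ⊗ₜ y) = (1 ⊗ₜ Q.S.symm y) * (Q.qR * Q.comul x) := by
  simp [qROrbit, tflip]

/-- `(a ⊗ 1) q_R = (1 ⊗ S⁻¹(a₍₂₎)) q_R Δ(a₍₁₎)` -/
theorem tmul_one_mul_qR (a : H) : (a ⊗ₜ 1) * Q.qR = Q.qROrbit (Q.comul a) := by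
  have h : ∀ d, Q.idSinvAlpha (Q.phi.val * Q.comulId d) = Q.qROrbit d := by
    intro d
    induction d with
    | zero => simp
    | add x y hx hy => simp only [map_add, mul_add, hx, hy]
    | tmul x y => rw [comulId_tmul, idSinvAlpha_mul_assoc, qROrbit_tmul, qR_eq]
  rw [← h, ← idComul_comul_mul_phi, idSinvAlpha_idComul_mul, Q.comul_counit, qR_eq]

theorem sAlphaBetaS_mul_idComul (u : H ⊗[k] (H ⊗[k] H)) (b c : H) :
    Q.sAlphaBetaS (u * Q.idComul (b ⊗ₜ c)) = Q.counit c • (Q.S b * Q.sAlphaBetaS u) := by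
  induction u with
  | zero => simp
  | add x y hx hy => simp only [map_add, add_mul, mul_add, smul_add, hx, hy]
  | tmul x t => simp [betaS_mul_comul, Q.S_mul, mul_assoc]

theorem sAlphaBetaS_comulId_mul (u : H ⊗[k] (H ⊗[k] H)) (b c : H) :
    Q.sAlphaBetaS (Q.comulId (b ⊗ₜ c) * u) = Q.counit b • (Q.sAlphaBetaS u * Q.S c) := by
  have key : ∀ (x y z : H) (d : H ⊗[k] H), Q.sAlphaBetaS (
      Algebra.TensorProduct.assoc k k k H H H (d ⊗ₜ c) * (x ⊗ₜ (y ⊗ₜ z))) =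
      Q.S x * Q.sAlpha d * (y * Q.beta * Q.S z * Q.S c) := by
    intro x y z d
    induction d with
    | zero => simp
    | add a b ha hb => simp only [map_add, TensorProduct.add_tmul, mul_add, add_mul, ha, hb]
    | tmul a b => simp [Q.S_mul, mul_assoc]
  induction u using tensor_induction₃ with
  | zero => simp
  | add x y hx hy => simp only [map_add, mul_add, add_mul, smul_add, hx, hy]
  | pure x y z =>
    have h : Q.sAlpha (Q.comul b) = Q.counit b • Q.alpha := Q.antipode_alpha b
    rw [comulId_tmul, key, h]
    simp [mul_assoc]

/-- The linear map `x ⊗ y ⊗ z ⊗ w ↦ x ⊗ S⁻¹(S(y) α z β S(w))`. -/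
def contractTail' : H ⊗[k] (H ⊗[k] (H ⊗[k] H)) →ₗ[k] H ⊗[k] H :=
  TensorProduct.map LinearMap.id (Q.S.symm.toLinearMap ∘ₗ Q.sAlphaBetaS)

@[simp] theorem contractTail'_tmul (x : H) (t : H ⊗[k] (H ⊗[k] H)) :
    Q.contractTail' (x ⊗ₜ t) = x ⊗ₜ[k] Q.S.symm (Q.sAlphaBetaS t) := by
  simp [contractTail']

theorem contractTail'_coface₂_mul (s : H ⊗[k] (H ⊗[k] (H ⊗[k] H))) (t : H ⊗[k] (H ⊗[k] H)) :
    Q.contractTail' (Q.coface₂ t * s) = Q.eps₂ t * Q.contractTail' s := by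
  induction s with
  | zero => simp
  | add x y hx hy => simp only [map_add, mul_add, hx, hy]
  | tmul s u =>
    induction t using tensor_induction₃ with
    | zero => simp
    | add x y hx hy => simp only [map_add, add_mul, hx, hy]
    | pure x y z => simp [sAlphaBetaS_comulId_mul, S_symm_mul]

theorem contractTail'_mul_coface₃ (s : H ⊗[k] (H ⊗[k] (H ⊗[k] H))) (t : H ⊗[k] (H ⊗[k] H)) :
    Q.contractTail' (s * Q.coface₃ t) = Q.contractTail' s * Q.eps₃ t := by
  induction s with
  | zero => simp
  | add x y hx hy => simp only [map_add, add_mul, hx, hy]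
  | tmul s u =>
    induction t using tensor_induction₃ with
    | zero => simp
    | add x y hx hy => simp only [map_add, mul_add, hx, hy]
    | pure x y z =>
      rw [coface₃_tmul, Algebra.TensorProduct.tmul_mul_tmul, contractTail'_tmul,
        sAlphaBetaS_mul_idComul]
      simp [S_symm_mul]

theorem contractTail'_mul_assoc (e u : H ⊗[k] H) (s : H ⊗[k] (H ⊗[k] (H ⊗[k] H))) :
    Q.contractTail' (s * Algebra.TensorProduct.assoc k k k H H (H ⊗[k] H) (e ⊗ₜ u)) =
      Q.contractTail' (s * (1 ⊗ₜ (1 ⊗ₜ u))) * e := by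
  induction s using tensor_induction₄ with
  | zero => simp
  | add x y hx hy => simp only [map_add, add_mul, hx, hy]
  | pure x y z w =>
    induction e with
    | zero => simp
    | add x y hx hy => simp only [map_add, mul_add, TensorProduct.add_tmul, hx, hy]
    | tmul a b => simp [mul_assoc, Q.S_mul, S_symm_mul]

section Equivariant

variable {B : Type*} [AddCommGroup B] [Module k B]

/-- The mirror image of `equivariant_pR_mul`. -/
theorem equivariant_mul_qR (K : H ⊗[k] H →ₗ[k] B)
    (hK : ∀ a s, K (s * Q.comul a) = Q.counit a • K s) (a : H) :
    K ((a ⊗ₜ 1) * Q.qR) = K ((1 ⊗ₜ Q.S.symm a) * Q.qR) := by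
  have h : ∀ d, K (Q.qROrbit d) = K ((1 ⊗ₜ Q.S.symm (Algebra.TensorProduct.lid k H
      (Algebra.TensorProduct.map Q.counit (AlgHom.id k H) d))) * Q.qR) := by
    intro d
    induction d with
    | zero => simp
    | add x y hx hy => simp only [map_add, add_mul, TensorProduct.tmul_add, hx, hy]
    | tmul x y => rw [qROrbit_tmul, ← mul_assoc, hK]; simp
  rw [tmul_one_mul_qR, h, Q.counit_comul]

/-- The mirror image of `equivariant_pR_alpha`. -/
theorem equivariant_beta_qR (K : H ⊗[k] H →ₗ[k] B)
    (hK : ∀ a s, K (s * Q.comul a) = Q.counit a • K s) :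
    K ((1 ⊗ₜ Q.S.symm Q.beta) * Q.qR) = K 1 := by
  have h4 : ∀ s, Q.contractTail' (coface₄ s) = (1 ⊗ₜ Q.S.symm Q.beta) * Q.idSinvAlpha s := by
    intro s
    induction s using tensor_induction₃ with
    | zero => simp
    | add x y hx hy => simp only [map_add, mul_add, hx, hy]
    | pure x y z => simp [mul_assoc, S_symm_mul, Q.S_one]
  have h1 : ∀ t s, K (Q.contractTail' (s * Q.coface₁ t)) =
      K (Q.contractTail' (s * (1 ⊗ₜ (1 ⊗ₜ Q.eps₁ t)))) := by
    intro t s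
    induction t with
    | zero => simp
    | add x y hx hy => simp only [map_add, mul_add, TensorProduct.tmul_add, hx, hy]
    | tmul x u =>
      rw [coface₁_tmul, contractTail'_mul_assoc, hK, eps₁_tmul, TensorProduct.tmul_smul,
        TensorProduct.tmul_smul, mul_smul_comm, map_smul, map_smul]
  have h : coface₄ Q.phi.val = Q.coface₂ Q.phi.inv *
      (coface₀ Q.phi.inv * Q.coface₃ Q.phi.val) * Q.coface₁ Q.phi.val := by
    rw [← mul_assoc, coface₂_inv_mul_coface₀_inv, mul_assoc, mul_assoc, mul_assoc,
      ← mul_assoc (Q.coface₃ _), coface_inv_mul_val, one_mul, coface_inv_mul_val, mul_one]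
  rw [qR_eq, ← h4, h, h1, eps₁_phi, ← Algebra.TensorProduct.one_def,
    ← Algebra.TensorProduct.one_def, mul_one, contractTail'_coface₂_mul,
    contractTail'_mul_coface₃, eps₂_phi_inv, eps₃_phi, one_mul, mul_one, coface₀_apply,
    contractTail'_tmul, sAlphaBetaS_phi_inv, S_symm_one, ← Algebra.TensorProduct.one_def]

end Equivariant

/-- The linear map `x ⊗ t ↦ t Δ(S⁻¹(x β))`. -/
def comulSinvBeta : H ⊗[k] (H ⊗[k] H) →ₗ[k] H ⊗[k] H :=
  LinearMap.mul' k (H ⊗[k] H) ∘ₗ TensorProduct.map LinearMap.id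
    (Q.comul.toLinearMap ∘ₗ Q.S.symm.toLinearMap ∘ₗ LinearMap.mulRight k Q.beta) ∘ₗ
    (TensorProduct.comm k H (H ⊗[k] H)).toLinearMap

@[simp] theorem comulSinvBeta_tmul (x : H) (t : H ⊗[k] H) :
    Q.comulSinvBeta (x ⊗ₜ t) = t * Q.comul (Q.S.symm (x * Q.beta)) := by
  simp [comulSinvBeta]

theorem comulSinvBeta_tmul_mul (s : H ⊗[k] (H ⊗[k] H)) (x : H) (t : H ⊗[k] H) :
    Q.comulSinvBeta ((x ⊗ₜ t) * s) =
      t * (Q.comulSinvBeta s * Q.comul (Q.S.symm x)) := by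
  induction s with
  | zero => simp
  | add x y hx hy => simp only [map_add, add_mul, mul_add, hx, hy]
  | tmul a b => simp [S_symm_mul, mul_assoc]

theorem comulSinvBeta_mul_idComul_comul (a : H) (s : H ⊗[k] (H ⊗[k] H)) :
    Q.comulSinvBeta (s * Q.idComul (Q.comul a)) = Q.counit a • Q.comulSinvBeta s := by
  have key : ∀ (d : H ⊗[k] H) (x : H) (t : H ⊗[k] H), Q.comulSinvBeta ((x ⊗ₜ t) * Q.idComul d) =
      t * Q.comul (Q.S.symm (x * Q.betaS d)) := by
    intro d x t
    induction d with
    | zero => simp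
    | add x y hx hy => simp only [map_add, mul_add, hx, hy]
    | tmul a b => simp [S_symm_mul, mul_assoc]
  have h : Q.betaS (Q.comul a) = Q.counit a • Q.beta := Q.antipode_beta a
  induction s with
  | zero => simp
  | add x y hx hy => simp only [map_add, add_mul, smul_add, hx, hy]
  | tmul x t => rw [key, h]; simp

/-- The linear map `x ⊗ y ↦ (x₍₂₎ ȳ ⊗ y z̄) Δ(S⁻¹(x₍₁₎ x̄ β))`. -/
def coevMap : H ⊗[k] H →ₗ[k] H ⊗[k] H :=
  Q.comulSinvBeta ∘ₗ LinearMap.mulRight k Q.phi.inv ∘ₗ Q.comulId.toLinearMap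

theorem coevMap_apply (d : H ⊗[k] H) :
    Q.coevMap d = Q.comulSinvBeta (Q.comulId d * Q.phi.inv) := rfl

theorem coevMap_mul_comul (a : H) (s : H ⊗[k] H) :
    Q.coevMap (s * Q.comul a) = Q.counit a • Q.coevMap s := by
  rw [coevMap_apply, map_mul Q.comulId, mul_assoc, ← phi_inv_mul_idComul, ← mul_assoc,
    comulSinvBeta_mul_idComul_comul, coevMap_apply]

/-- The mirror image of `evElt`, which turns out to be `V`. -/
def coevElt : H ⊗[k] H := Q.coevMap Q.qR

/-- For `P ∈ H ⊗ H`, the linear map `x ⊗ y ↦ (y ⊗ 1) P Δ(S⁻¹(x))`. -/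
def coevOrbit (P : H ⊗[k] H) : H ⊗[k] H →ₗ[k] H ⊗[k] H :=
  LinearMap.mul' k (H ⊗[k] H) ∘ₗ
    TensorProduct.map (Algebra.TensorProduct.includeLeft : H →ₐ[k] H ⊗[k] H).toLinearMap
      (LinearMap.mulLeft k P ∘ₗ Q.comul.toLinearMap ∘ₗ Q.S.symm.toLinearMap) ∘ₗ tflip

@[simp] theorem coevOrbit_tmul (P : H ⊗[k] H) (x y : H) :
    Q.coevOrbit P (x ⊗ₜ y) = (y ⊗ₜ 1) * (P * Q.comul (Q.S.symm x)) := by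
  simp [coevOrbit, tflip]

theorem coevMap_one_tmul_mul (s : H ⊗[k] H) (b : H) :
    Q.coevMap ((1 ⊗ₜ b) * s) = (1 ⊗ₜ b) * Q.coevMap s := by
  rw [coevMap_apply, map_mul Q.comulId, mul_assoc, comulId_tmul, map_one,
    Algebra.TensorProduct.one_def, Algebra.TensorProduct.assoc_tmul, comulSinvBeta_tmul_mul,
    S_symm_one, map_one, mul_one, coevMap_apply]

/-- `(1 ⊗ S⁻¹(a)) V = (a₍₂₎ ⊗ 1) V Δ(S⁻¹(a₍₁₎))`, for `V` in the form `coevElt`. -/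
theorem one_tmul_S_symm_mul_coevElt (a : H) :
    (1 ⊗ₜ Q.S.symm a) * Q.coevElt = Q.coevOrbit Q.coevElt (Q.comul a) := by
  have h := Q.equivariant_mul_qR Q.coevMap Q.coevMap_mul_comul a
  have h2 : ∀ (s : H ⊗[k] (H ⊗[k] H)) (e : H ⊗[k] H), Q.comulSinvBeta (
      Algebra.TensorProduct.assoc k k k H H H (e ⊗ₜ 1) * s) =
      Q.coevOrbit (Q.comulSinvBeta s) e := by
    intro s e
    induction e with
    | zero => simp
    | add x y hx hy => simp only [map_add, TensorProduct.add_tmul, add_mul, hx, hy]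
    | tmul x y => simp [comulSinvBeta_tmul_mul]
  rw [coevMap_one_tmul_mul, coevMap_apply, map_mul Q.comulId, mul_assoc, comulId_tmul, h2] at h
  exact h.symm

/-- `(1 ⊗ S⁻¹(β)) V = (ȳ ⊗ z̄) Δ(S⁻¹(x̄ β))`, for `V` in the form `coevElt`. -/
theorem one_tmul_S_symm_beta_mul_coevElt :
    (1 ⊗ₜ Q.S.symm Q.beta) * Q.coevElt = Q.comulSinvBeta Q.phi.inv := by
  have h := Q.equivariant_beta_qR Q.coevMap Q.coevMap_mul_comul
  rw [coevMap_one_tmul_mul, Q.coevMap_apply 1, map_one, one_mul] at h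
  exact h

/-- `(1 ⊗ S⁻¹(Z)) q_R Δ(Y S⁻¹(X β)) = V`, by the pentagon; the mirror image of
`evMap'_phi_inv`. -/
theorem coevMap'_phi : Q.coevMap' Q.phi.val = Q.coevElt := by
  let C : H ⊗[k] (H ⊗[k] (H ⊗[k] H)) →ₗ[k] H ⊗[k] (H ⊗[k] H) :=
    TensorProduct.map LinearMap.id Q.idSinvAlpha
  have h1 : ∀ t, Q.comulSinvBeta (C (coface₀ Q.phi.val * Q.coface₂ t)) = Q.coevMap' t := by
    intro t
    induction t using tensor_induction₃ with
    | zero => simp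
    | add x y hx hy => simp only [map_add, mul_add, hx, hy]
    | pure x y z =>
      rw [coface₂_tmul, coface₀_apply, Algebra.TensorProduct.tmul_mul_tmul, comulId_tmul]
      simp [C, idSinvAlpha_mul_assoc, qR_eq, mul_assoc]
  have h2 : ∀ s t, C (Q.coface₃ t * s) =
      Algebra.TensorProduct.assoc k k k H H H (Q.eps₃ t ⊗ₜ 1) * C s := by
    intro s t
    induction s with
    | zero => simp
    | add x y hx hy => simp only [map_add, mul_add, hx, hy]
    | tmul s u =>
      induction t using tensor_induction₃ with
      | zero => simp
      | add x y hx hy => simp only [map_add, add_mul, TensorProduct.add_tmul, hx, hy]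
      | pure x y z =>
        rw [coface₃_tmul, Algebra.TensorProduct.tmul_mul_tmul]
        simp [C, idSinvAlpha_idComul_mul, ← TensorProduct.smul_tmul', smul_mul_assoc,
          -idComul_tmul]
  have h3 : ∀ s t, C (Q.coface₁ t * coface₄ s) = Q.comulId (Q.idSinvAlpha t) * s := by
    intro s t
    induction t using tensor_induction₃ with
    | zero => simp
    | add x y hx hy => simp only [map_add, add_mul, hx, hy]
    | pure x y z =>
      rw [coface₁_tmul, idSinvAlpha_tmul, comulId_tmul]
      generalize Q.comul x = e
      induction s using tensor_induction₃ with
      | zero => simp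
      | add x y hx hy => simp only [map_add, mul_add, hx, hy]
      | pure a b c =>
        induction e with
        | zero => simp
        | add x y hx hy => simp only [map_add, add_mul, TensorProduct.add_tmul, hx, hy]
        | tmul d e => simp [C, mul_assoc, Q.S_mul, S_symm_mul]
  have h : coface₀ Q.phi.val * Q.coface₂ Q.phi.val =
      Q.coface₃ Q.phi.val * (Q.coface₁ Q.phi.val * coface₄ Q.phi.inv) := by
    rw [coface₁_mul_coface₄_inv, ← mul_assoc, coface_val_mul_inv, one_mul]
  rw [← h1, h, h2, h3, eps₃_phi, ← Algebra.TensorProduct.one_def, map_one, one_mul,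
    coevElt, coevMap_apply, qR_eq]

theorem V_eq_coevElt : Q.V = Q.coevElt := by
  rw [V_eq_coevMap', coevMap'_phi]

/-! ### Iterated coproducts of `U` and `V` -/

/-- `ε ⊗ id` on `H ⊗ H`. -/
def epsId : H ⊗[k] H →ₐ[k] H :=
  (Algebra.TensorProduct.lid k H).toAlgHom.comp
    (Algebra.TensorProduct.map Q.counit (AlgHom.id k H))

@[simp] theorem epsId_tmul (x y : H) : Q.epsId (x ⊗ₜ y) = Q.counit x • y := by
  simp [epsId]

theorem epsId_comul (a : H) : Q.epsId (Q.comul a) = a := Q.counit_comul a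

theorem epsId_evElt : Q.epsId Q.evElt = 1 := by
  have h : ∀ s, Q.epsId (Q.comulSAlpha s) = Q.sAlpha (Q.eps₂ s) := by
    intro s
    induction s using tensor_induction₃ with
    | zero => simp
    | add x y hx hy => simp only [map_add, hx, hy]
    | pure x y z => simp [epsId_comul, mul_assoc]
  rw [evElt, evMap_apply, h, map_mul, eps₂_phi, one_mul, eps₂_comulId, sAlpha_pR]

theorem betaS_qR : Q.betaS Q.qR = 1 := by
  have h : ∀ t, Q.betaS (Q.idSinvAlpha t) = Q.betaSAlpha t := by
    intro t
    induction t with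
    | zero => simp
    | add x y hx hy => simp only [map_add, hx, hy]
    | tmul x t => simp
  rw [qR_eq, h, betaSAlpha_phi]

theorem epsId_coevElt : Q.epsId Q.coevElt = 1 := by
  have h : ∀ s, Q.epsId (Q.comulSinvBeta s) = Q.S.symm (Q.betaS (Q.eps₂ s)) := by
    intro s
    induction s using tensor_induction₃ with
    | zero => simp
    | add x y hx hy => simp only [map_add, hx, hy]
    | pure x y z => simp [epsId_comul, S_symm_mul]
  rw [coevElt, coevMap_apply, h, map_mul, eps₂_phi_inv, mul_one, eps₂_comulId, betaS_qR,
    S_symm_one]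

/-- The embedding `t ↦ t ⊗ 1` of `H ⊗ H` into `H ⊗ H ⊗ H`. -/
def tmulOne : H ⊗[k] H →ₐ[k] H ⊗[k] (H ⊗[k] H) :=
  (Algebra.TensorProduct.assoc k k k H H H).toAlgHom.comp Algebra.TensorProduct.includeLeft

@[simp] theorem tmulOne_tmul (x y : H) :
    tmulOne (x ⊗ₜ[k] y) = x ⊗ₜ[k] (y ⊗ₜ[k] (1 : H)) := by
  simp [tmulOne]

theorem tmulOne_commute (t : H ⊗[k] H) (h : H) :
    tmulOne t * ((1 : H) ⊗ₜ[k] ((1 : H) ⊗ₜ[k] h)) =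
      ((1 : H) ⊗ₜ[k] ((1 : H) ⊗ₜ[k] h)) * tmulOne t := by
  induction t with
  | zero => simp
  | add x y hx hy => simp only [map_add, mul_add, add_mul, hx, hy]
  | tmul x y => simp

theorem comulId_one_tmul (h : H) : Q.comulId (1 ⊗ₜ h) = 1 ⊗ₜ (1 ⊗ₜ h) := by
  rw [comulId_tmul, map_one, Algebra.TensorProduct.one_def, Algebra.TensorProduct.assoc_tmul]

theorem comulId_tmul_one (h : H) : Q.comulId (h ⊗ₜ 1) = tmulOne (Q.comul h) :=
  Q.comulId_tmul h 1

/-- For `P ∈ H⊗³`, the linear map `x ⊗ t ↦ (Δ ⊗ id)(Δ(S(x))) P (t ⊗ 1)`. -/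
def evOrbit₃ (P : H ⊗[k] (H ⊗[k] H)) : H ⊗[k] (H ⊗[k] H) →ₗ[k] H ⊗[k] (H ⊗[k] H) :=
  LinearMap.mul' k (H ⊗[k] (H ⊗[k] H)) ∘ₗ
    TensorProduct.map (LinearMap.mulRight k P ∘ₗ Q.comulId.toLinearMap ∘ₗ
      Q.comul.toLinearMap ∘ₗ Q.S.toLinearMap) tmulOne.toLinearMap

@[simp] theorem evOrbit₃_tmul (P : H ⊗[k] (H ⊗[k] H)) (x : H) (t : H ⊗[k] H) :
    Q.evOrbit₃ P (x ⊗ₜ t) = Q.comulId (Q.comul (Q.S x)) * P * tmulOne t := by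
  simp [evOrbit₃]

theorem evOrbit₃_add_left (P R w : H ⊗[k] (H ⊗[k] H)) :
    Q.evOrbit₃ (P + R) w = Q.evOrbit₃ P w + Q.evOrbit₃ R w := by
  induction w with
  | zero => simp
  | add x y hx hy => simp only [map_add, hx, hy]; abel
  | tmul x t => simp only [evOrbit₃_tmul, mul_add, add_mul]

theorem evOrbit₃_mul_one_tmul (P w : H ⊗[k] (H ⊗[k] H)) (h : H) :
    Q.evOrbit₃ P w * (1 ⊗ₜ (1 ⊗ₜ h)) = Q.evOrbit₃ (P * (1 ⊗ₜ (1 ⊗ₜ h))) w := by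
  induction w with
  | zero => simp
  | add x y hx hy => simp only [map_add, add_mul, hx, hy]
  | tmul x t => simp [mul_assoc, tmulOne_commute]

theorem evOrbit₃_mul (P s w : H ⊗[k] (H ⊗[k] H)) :
    Q.evOrbit₃ P (s * w) = Q.evOrbit₃ (Q.evOrbit₃ P s) w := by
  induction w with
  | zero => simp
  | add x y hx hy => simp only [map_add, mul_add, hx, hy]
  | tmul x t =>
    induction s with
    | zero => simp
    | add x y hx hy => simp only [map_add, mul_add, add_mul, evOrbit₃_tmul, hx, hy]
    | tmul y u => simp [Q.S_mul, mul_assoc]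

/-- An element `P` of `H⊗³` with `P (1 ⊗ 1 ⊗ S(a)) = (Δ ⊗ id)(Δ(S(a₍₁₎₍₁₎))) P (a₍₁₎₍₂₎ ⊗ a₍₂₎ ⊗ 1)`
is determined by `P (1 ⊗ 1 ⊗ α)`, because `S(x̄) α ȳ β S(z̄) = 1`. -/
theorem eq_of_mul_alpha_eq {P R : H ⊗[k] (H ⊗[k] H)}
    (hP : ∀ a, P * (1 ⊗ₜ (1 ⊗ₜ Q.S a)) = Q.evOrbit₃ P (Q.comulId (Q.comul a)))
    (hR : ∀ a, R * (1 ⊗ₜ (1 ⊗ₜ Q.S a)) = Q.evOrbit₃ R (Q.comulId (Q.comul a)))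
    (h : P * (1 ⊗ₜ (1 ⊗ₜ Q.alpha)) = R * (1 ⊗ₜ (1 ⊗ₜ Q.alpha))) : P = R := by
  have e : ∀ a b c : H, ((1 : H) ⊗ₜ[k] ((1 : H) ⊗ₜ[k] (a * (b * c)))) =
      (1 ⊗ₜ (1 ⊗ₜ a)) * (1 ⊗ₜ (1 ⊗ₜ b)) * (1 ⊗ₜ (1 ⊗ₜ c)) := by
    intro a b c
    simp [mul_assoc]
  have key : ∀ t, P * (1 ⊗ₜ (1 ⊗ₜ Q.sAlphaBetaS t)) = R * (1 ⊗ₜ (1 ⊗ₜ Q.sAlphaBetaS t)) := by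
    intro t
    induction t with
    | zero => simp
    | add x y hx hy => simp only [map_add, mul_add, TensorProduct.tmul_add, hx, hy]
    | tmul x t =>
      rw [sAlphaBetaS_tmul, e]
      simp only [← mul_assoc]
      rw [hP, hR, Q.evOrbit₃_mul_one_tmul P, Q.evOrbit₃_mul_one_tmul R, h]
  have := key Q.phi.inv
  rwa [sAlphaBetaS_phi_inv, ← Algebra.TensorProduct.one_def, ← Algebra.TensorProduct.one_def,
    mul_one, mul_one] at this

/-- `φ⁻¹ (id ⊗ Δ)(U) (1 ⊗ U) = (Δ ⊗ id)(Δ(S(X)) U) (Y ⊗ Z ⊗ 1)`, for `U` in the form `evElt`. -/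
theorem phi_inv_mul_idComul_evElt : Q.phi.inv * (Q.idComul Q.evElt * (1 ⊗ₜ Q.evElt)) =
    Q.evOrbit₃ (Q.comulId Q.evElt) Q.phi.val := by
  have one_mul_tmul : ∀ s t : H ⊗[k] H, (1 : H) ⊗ₜ[k] (s * t) = (1 ⊗ₜ s) * (1 ⊗ₜ t) := by
    intro s t; simp
  apply Q.eq_of_mul_alpha_eq
  · intro a
    have h1 : ∀ (e : H ⊗[k] H) (y : H), Q.phi.inv * (Q.idComul (Q.evOrbit Q.evElt e) *
        ((1 ⊗ₜ Q.evElt) * (1 ⊗ₜ (y ⊗ₜ 1)))) =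
        Q.evOrbit₃ (Q.phi.inv * (Q.idComul Q.evElt * (1 ⊗ₜ Q.evElt)))
          (Algebra.TensorProduct.assoc k k k H H H (e ⊗ₜ y)) := by
      intro e y
      induction e with
      | zero => simp
      | add x y hx hy => simp only [map_add, add_mul, mul_add, TensorProduct.add_tmul, hx, hy]
      | tmul c d =>
        have e1 : Q.idComul (d ⊗ₜ 1) * ((1 ⊗ₜ Q.evElt) * (1 ⊗ₜ (y ⊗ₜ 1))) =
            (1 ⊗ₜ Q.evElt) * tmulOne (d ⊗ₜ y) := by
          simp
        rw [evOrbit_tmul, Algebra.TensorProduct.assoc_tmul, evOrbit₃_tmul, map_mul, map_mul,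
          mul_assoc, mul_assoc, e1, ← mul_assoc, phi_inv_mul_idComul]
        simp only [mul_assoc]
    have h2 : ∀ d : H ⊗[k] H, Q.phi.inv * (Q.idComul Q.evElt * (1 ⊗ₜ Q.evOrbit Q.evElt d)) =
        Q.evOrbit₃ (Q.phi.inv * (Q.idComul Q.evElt * (1 ⊗ₜ Q.evElt))) (Q.comulId d) := by
      intro d
      induction d with
      | zero => simp
      | add x y hx hy => simp only [map_add, mul_add, TensorProduct.tmul_add, hx, hy]
      | tmul x y =>
        rw [comulId_tmul, ← h1, ← evElt_mul_one_tmul_S, evOrbit_tmul, one_mul_tmul, one_mul_tmul,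
          map_mul, idComul_tmul]
        simp only [mul_assoc]
    rw [← h2, ← evElt_mul_one_tmul_S, one_mul_tmul]
    simp only [mul_assoc]
  · intro a
    have h1 : ∀ (d : H ⊗[k] H) (x : H) (t : H ⊗[k] H),
        Q.comulId (Q.comul (Q.S x)) * Q.comulId (Q.evOrbit Q.evElt d) * tmulOne t =
        Q.evOrbit₃ (Q.comulId Q.evElt) (Q.idComul d * (x ⊗ₜ t)) := by
      intro d x t
      induction d with
      | zero => simp
      | add x y hx hy => simp only [map_add, mul_add, add_mul, hx, hy]
      | tmul c d =>
        rw [evOrbit_tmul, idComul_tmul, Algebra.TensorProduct.tmul_mul_tmul, evOrbit₃_tmul,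
          map_mul Q.comulId, map_mul Q.comulId, comulId_tmul_one, Q.S_mul, map_mul Q.comul,
          map_mul Q.comulId, map_mul tmulOne]
        simp only [mul_assoc]
    have h2 : ∀ s, Q.evOrbit₃ (Q.comulId Q.evElt) s * (1 ⊗ₜ (1 ⊗ₜ Q.S a)) =
        Q.evOrbit₃ (Q.comulId Q.evElt) (Q.idComul (Q.comul a) * s) := by
      intro s
      induction s with
      | zero => simp
      | add x y hx hy => simp only [map_add, mul_add, add_mul, hx, hy]
      | tmul x t =>
        rw [← h1, ← evElt_mul_one_tmul_S, evOrbit₃_mul_one_tmul, evOrbit₃_tmul, map_mul,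
          comulId_one_tmul]
    rw [h2, idComul_comul_mul_phi, evOrbit₃_mul]
  · let F : H ⊗[k] (H ⊗[k] (H ⊗[k] H)) →ₗ[k] H ⊗[k] (H ⊗[k] H) :=
      LinearMap.mul' k (H ⊗[k] (H ⊗[k] H)) ∘ₗ TensorProduct.map
        (Q.comulId.toLinearMap ∘ₗ Q.comul.toLinearMap ∘ₗ LinearMap.mulRight k Q.alpha ∘ₗ
          Q.S.toLinearMap) (LinearMap.mulLeft k Q.phi.inv)
    have hF : ∀ x u, F (x ⊗ₜ u) = Q.comulId (Q.comul (Q.S x * Q.alpha)) * (Q.phi.inv * u) := by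
      intro x u; simp [F]
    have h1 : ∀ (s : H ⊗[k] (H ⊗[k] H)) (t : H ⊗[k] H),
        Q.phi.inv * (Q.idComul (Q.comulSAlpha s) * (1 ⊗ₜ t)) =
        F (Q.coface₃ s * (1 ⊗ₜ (1 ⊗ₜ t))) := by
      intro s t
      induction s with
      | zero => simp
      | add x y hx hy => simp only [map_add, mul_add, add_mul, hx, hy]
      | tmul x u =>
        rw [coface₃_tmul, Algebra.TensorProduct.tmul_mul_tmul, hF, comulSAlpha_tmul,
          map_mul Q.idComul, mul_assoc, ← mul_assoc, phi_inv_mul_idComul, mul_one, mul_assoc]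
    have h2 : ∀ (e t : H ⊗[k] H), Q.phi.inv * (Q.idComul (Q.evOrbit Q.evElt e * (1 ⊗ₜ Q.alpha)) *
        (1 ⊗ₜ t)) = F (Q.coface₃ Q.phi.val *
          Algebra.TensorProduct.assoc k k k H H (H ⊗[k] H) (e ⊗ₜ t)) := by
      intro e t
      induction e with
      | zero => simp
      | add x y hx hy => simp only [map_add, add_mul, mul_add, TensorProduct.add_tmul, hx, hy]
      | tmul c d =>
        have e1 : ((d ⊗ₜ 1 : H ⊗[k] H)) * (1 ⊗ₜ Q.alpha) = (1 ⊗ₜ Q.alpha) * (d ⊗ₜ 1) := by simp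
        have e2 : Q.coface₃ (c ⊗ₜ (d ⊗ₜ 1)) * (1 ⊗ₜ (1 ⊗ₜ t)) = c ⊗ₜ (d ⊗ₜ t) := by simp
        rw [evOrbit_tmul, mul_assoc _ (d ⊗ₜ 1), e1, mul_assoc _ Q.evElt, ← mul_assoc Q.evElt,
          evElt_mul_one_tmul_alpha, ← mul_assoc (Q.comul _), ← comulSAlpha_mul_tmul, h1, map_mul Q.coface₃,
          mul_assoc, e2, Algebra.TensorProduct.assoc_tmul]
    have h3 : ∀ s, Q.phi.inv * (Q.idComul Q.evElt * (1 ⊗ₜ Q.comulSAlpha s)) =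
        F (Q.coface₃ Q.phi.val * Q.coface₁ s) := by
      intro s
      induction s with
      | zero => simp
      | add x y hx hy => simp only [map_add, mul_add, TensorProduct.tmul_add, hx, hy]
      | tmul x t =>
        rw [coface₁_tmul, ← h2, ← evElt_mul_one_tmul_S, comulSAlpha_tmul, one_mul_tmul,
          map_mul Q.comul, one_mul_tmul, map_mul, map_mul, idComul_tmul, idComul_tmul]
        simp only [mul_assoc]
    have h4 : ∀ s t, Q.comulId (Q.comul (Q.S (1 : H))) * Q.evOrbit₃ (Q.comulId
        (Q.comulSAlpha t)) s = F (coface₀ Q.phi.val * (Q.coface₂ t * coface₄ s)) := by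
      intro s t
      rw [Q.S_one, map_one, map_one, one_mul]
      induction s using tensor_induction₃ with
      | zero => simp
      | add x y hx hy => simp only [map_add, mul_add, hx, hy]
      | pure x y z =>
        induction t with
        | zero => simp
        | add x y hx hy => simp only [map_add, mul_add, add_mul, evOrbit₃_add_left, hx, hy]
        | tmul a b =>
          have e1 : coface₄ (x ⊗ₜ (y ⊗ₜ z)) = x ⊗ₜ[k] (tmulOne (y ⊗ₜ[k] z)) := by simp
          rw [e1, coface₂_tmul, coface₀_apply, Algebra.TensorProduct.tmul_mul_tmul,
            Algebra.TensorProduct.tmul_mul_tmul, hF, ← mul_assoc Q.phi.inv, Q.phi.inv_val,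
            evOrbit₃_tmul, comulSAlpha_tmul, one_mul, one_mul, Q.S_mul]
          simp only [map_mul, mul_assoc]
    have h5 := h4 Q.phi.val Q.phi.val
    rw [Q.S_one, map_one, map_one, one_mul, ← mul_assoc (coface₀ _), ← coface_pentagon] at h5
    have e2 : (1 ⊗ₜ Q.evElt : H ⊗[k] (H ⊗[k] H)) * (1 ⊗ₜ (1 ⊗ₜ Q.alpha)) =
        1 ⊗ₜ Q.comulSAlpha Q.phi.val := by
      rw [← one_mul_tmul, evElt_mul_one_tmul_alpha]
    rw [mul_assoc, mul_assoc, e2, h3, ← h5, evOrbit₃_mul_one_tmul, ← comulId_one_tmul,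
      ← map_mul Q.comulId, evElt_mul_one_tmul_alpha]

/-- For `P ∈ H⊗³`, the linear map `x ⊗ t ↦ (t ⊗ 1) P (Δ ⊗ id)(Δ(S⁻¹(x)))`. -/
def coevOrbit₃ (P : H ⊗[k] (H ⊗[k] H)) : H ⊗[k] (H ⊗[k] H) →ₗ[k] H ⊗[k] (H ⊗[k] H) :=
  LinearMap.mul' k (H ⊗[k] (H ⊗[k] H)) ∘ₗ
    TensorProduct.map tmulOne.toLinearMap (LinearMap.mulLeft k P ∘ₗ Q.comulId.toLinearMap ∘ₗ
      Q.comul.toLinearMap ∘ₗ Q.S.symm.toLinearMap) ∘ₗ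
    (TensorProduct.comm k H (H ⊗[k] H)).toLinearMap

@[simp] theorem coevOrbit₃_tmul (P : H ⊗[k] (H ⊗[k] H)) (x : H) (t : H ⊗[k] H) :
    Q.coevOrbit₃ P (x ⊗ₜ t) = tmulOne t * (P * Q.comulId (Q.comul (Q.S.symm x))) := by
  simp [coevOrbit₃]

theorem coevOrbit₃_add_left (P R w : H ⊗[k] (H ⊗[k] H)) :
    Q.coevOrbit₃ (P + R) w = Q.coevOrbit₃ P w + Q.coevOrbit₃ R w := by
  induction w with
  | zero => simp
  | add x y hx hy => simp only [map_add, hx, hy]; abel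
  | tmul x t => simp only [coevOrbit₃_tmul, mul_add, add_mul]

theorem one_tmul_mul_coevOrbit₃ (P w : H ⊗[k] (H ⊗[k] H)) (h : H) :
    (1 ⊗ₜ (1 ⊗ₜ h)) * Q.coevOrbit₃ P w = Q.coevOrbit₃ ((1 ⊗ₜ (1 ⊗ₜ h)) * P) w := by
  induction w with
  | zero => simp
  | add x y hx hy => simp only [map_add, mul_add, hx, hy]
  | tmul x t => rw [coevOrbit₃_tmul, coevOrbit₃_tmul, ← mul_assoc, ← tmulOne_commute]
                simp only [mul_assoc]

theorem coevOrbit₃_mul (P s w : H ⊗[k] (H ⊗[k] H)) :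
    Q.coevOrbit₃ P (w * s) = Q.coevOrbit₃ (Q.coevOrbit₃ P s) w := by
  induction w with
  | zero => simp
  | add x y hx hy => simp only [map_add, add_mul, hx, hy]
  | tmul x t =>
    induction s with
    | zero => simp
    | add x y hx hy => simp only [map_add, mul_add, add_mul, coevOrbit₃_tmul, hx, hy]
    | tmul y u => simp [S_symm_mul, mul_assoc]

/-- The mirror image of `eq_of_mul_alpha_eq`. -/
theorem eq_of_beta_mul_eq {P R : H ⊗[k] (H ⊗[k] H)}
    (hP : ∀ a, (1 ⊗ₜ (1 ⊗ₜ Q.S.symm a)) * P = Q.coevOrbit₃ P (Q.comulId (Q.comul a)))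
    (hR : ∀ a, (1 ⊗ₜ (1 ⊗ₜ Q.S.symm a)) * R = Q.coevOrbit₃ R (Q.comulId (Q.comul a)))
    (h : (1 ⊗ₜ (1 ⊗ₜ Q.S.symm Q.beta)) * P = (1 ⊗ₜ (1 ⊗ₜ Q.S.symm Q.beta)) * R) : P = R := by
  have e : ∀ a b c : H, ((1 : H) ⊗ₜ[k] ((1 : H) ⊗ₜ[k] (a * (b * c)))) =
      (1 ⊗ₜ (1 ⊗ₜ a)) * (1 ⊗ₜ (1 ⊗ₜ b)) * (1 ⊗ₜ (1 ⊗ₜ c)) := by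
    intro a b c
    simp [mul_assoc]
  have key : ∀ t, (1 ⊗ₜ (1 ⊗ₜ Q.S.symm (Q.betaSAlpha t))) * P =
      (1 ⊗ₜ (1 ⊗ₜ Q.S.symm (Q.betaSAlpha t))) * R := by
    intro t
    induction t with
    | zero => simp
    | add x y hx hy => simp only [map_add, add_mul, TensorProduct.tmul_add, hx, hy]
    | tmul x t =>
      rw [betaSAlpha_tmul, S_symm_mul, S_symm_mul, e]
      simp only [mul_assoc]
      rw [hP, hR, Q.one_tmul_mul_coevOrbit₃ P, Q.one_tmul_mul_coevOrbit₃ R, h]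
  have := key Q.phi.val
  rwa [betaSAlpha_phi, S_symm_one, ← Algebra.TensorProduct.one_def,
    ← Algebra.TensorProduct.one_def, one_mul, one_mul] at this

/-- `(1 ⊗ V) (id ⊗ Δ)(V) φ = (ȳ ⊗ z̄ ⊗ 1) (Δ ⊗ id)(V Δ(S⁻¹(x̄)))`, for `V` in the form `coevElt`;
the mirror image of `phi_inv_mul_idComul_evElt`. -/
theorem coevElt_mul_idComul_mul_phi :
    (1 ⊗ₜ Q.coevElt) * (Q.idComul Q.coevElt * Q.phi.val) =
    Q.coevOrbit₃ (Q.comulId Q.coevElt) Q.phi.inv := by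
  have one_mul_tmul : ∀ s t : H ⊗[k] H, (1 : H) ⊗ₜ[k] (s * t) = (1 ⊗ₜ s) * (1 ⊗ₜ t) := by
    intro s t; simp
  apply Q.eq_of_beta_mul_eq
  · intro a
    have h1 : ∀ (e : H ⊗[k] H) (y : H), (1 ⊗ₜ (y ⊗ₜ 1)) * ((1 ⊗ₜ Q.coevElt) *
        (Q.idComul (Q.coevOrbit Q.coevElt e) * Q.phi.val)) =
        Q.coevOrbit₃ ((1 ⊗ₜ Q.coevElt) * (Q.idComul Q.coevElt * Q.phi.val))
          (Algebra.TensorProduct.assoc k k k H H H (e ⊗ₜ y)) := by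
      intro e y
      induction e with
      | zero => simp
      | add x y hx hy => simp only [map_add, add_mul, mul_add, TensorProduct.add_tmul, hx, hy]
      | tmul c d =>
        have e1 : (1 ⊗ₜ (y ⊗ₜ 1)) * ((1 ⊗ₜ Q.coevElt) * Q.idComul (d ⊗ₜ 1)) =
            tmulOne (d ⊗ₜ y) * (1 ⊗ₜ Q.coevElt) := by
          simp
        rw [coevOrbit_tmul, Algebra.TensorProduct.assoc_tmul, coevOrbit₃_tmul, mul_assoc,
          mul_assoc, ← idComul_comul_mul_phi, map_mul, map_mul, ← mul_assoc (tmulOne _), ← e1]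
        simp only [mul_assoc]
    have h2 : ∀ d : H ⊗[k] H,
        (1 ⊗ₜ Q.coevOrbit Q.coevElt d) * (Q.idComul Q.coevElt * Q.phi.val) =
        Q.coevOrbit₃ ((1 ⊗ₜ Q.coevElt) * (Q.idComul Q.coevElt * Q.phi.val)) (Q.comulId d) := by
      intro d
      induction d with
      | zero => simp
      | add x y hx hy => simp only [map_add, add_mul, TensorProduct.tmul_add, hx, hy]
      | tmul x y =>
        rw [comulId_tmul, ← h1, ← one_tmul_S_symm_mul_coevElt, coevOrbit_tmul, one_mul_tmul,
          one_mul_tmul, map_mul, idComul_tmul]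
        simp only [mul_assoc]
    rw [← h2, ← one_tmul_S_symm_mul_coevElt, one_mul_tmul]
    simp only [mul_assoc]
  · intro a
    have h1 : ∀ (d : H ⊗[k] H) (x : H) (t : H ⊗[k] H),
        tmulOne t * (Q.comulId (Q.coevOrbit Q.coevElt d) * Q.comulId (Q.comul (Q.S.symm x))) =
        Q.coevOrbit₃ (Q.comulId Q.coevElt) ((x ⊗ₜ t) * Q.idComul d) := by
      intro d x t
      induction d with
      | zero => simp
      | add x y hx hy => simp only [map_add, mul_add, add_mul, hx, hy]
      | tmul c d =>
        rw [coevOrbit_tmul, idComul_tmul, Algebra.TensorProduct.tmul_mul_tmul, coevOrbit₃_tmul,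
          map_mul Q.comulId, map_mul Q.comulId, comulId_tmul_one, S_symm_mul, map_mul Q.comul,
          map_mul Q.comulId, map_mul tmulOne]
        simp only [mul_assoc]
    have h2 : ∀ s, (1 ⊗ₜ (1 ⊗ₜ Q.S.symm a)) * Q.coevOrbit₃ (Q.comulId Q.coevElt) s =
        Q.coevOrbit₃ (Q.comulId Q.coevElt) (s * Q.idComul (Q.comul a)) := by
      intro s
      induction s with
      | zero => simp
      | add x y hx hy => simp only [map_add, mul_add, add_mul, hx, hy]
      | tmul x t =>
        rw [← h1, ← one_tmul_S_symm_mul_coevElt, one_tmul_mul_coevOrbit₃, coevOrbit₃_tmul,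
          map_mul Q.comulId, comulId_one_tmul]
    rw [h2, phi_inv_mul_idComul, coevOrbit₃_mul]
  · let F : H ⊗[k] (H ⊗[k] (H ⊗[k] H)) →ₗ[k] H ⊗[k] (H ⊗[k] H) :=
      LinearMap.mul' k (H ⊗[k] (H ⊗[k] H)) ∘ₗ TensorProduct.map
        (LinearMap.mulRight k Q.phi.val) (Q.comulId.toLinearMap ∘ₗ Q.comul.toLinearMap ∘ₗ
          Q.S.symm.toLinearMap ∘ₗ LinearMap.mulRight k Q.beta) ∘ₗ
        (TensorProduct.comm k H (H ⊗[k] (H ⊗[k] H))).toLinearMap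
    have hF : ∀ x u, F (x ⊗ₜ u) =
        u * Q.phi.val * Q.comulId (Q.comul (Q.S.symm (x * Q.beta))) := by
      intro x u; simp [F]
    have h1 : ∀ (s : H ⊗[k] (H ⊗[k] H)) (t : H ⊗[k] H),
        (1 ⊗ₜ t) * (Q.idComul (Q.comulSinvBeta s) * Q.phi.val) =
        F ((1 ⊗ₜ (1 ⊗ₜ t)) * Q.coface₃ s) := by
      intro s t
      induction s with
      | zero => simp
      | add x y hx hy => simp only [map_add, mul_add, add_mul, hx, hy]
      | tmul x u =>
        rw [coface₃_tmul, Algebra.TensorProduct.tmul_mul_tmul, hF, comulSinvBeta_tmul,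
          map_mul Q.idComul, mul_assoc _ _ Q.phi.val, idComul_comul_mul_phi, one_mul]
        simp only [mul_assoc]
    have h2 : ∀ (e t : H ⊗[k] H), (1 ⊗ₜ t) *
        (Q.idComul ((1 ⊗ₜ Q.S.symm Q.beta) * Q.coevOrbit Q.coevElt e) * Q.phi.val) =
        F (Algebra.TensorProduct.assoc k k k H H (H ⊗[k] H) (e ⊗ₜ t) *
          Q.coface₃ Q.phi.inv) := by
      intro e t
      induction e with
      | zero => simp
      | add x y hx hy => simp only [map_add, add_mul, mul_add, TensorProduct.add_tmul, hx, hy]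
      | tmul c d =>
        have e1 : (1 ⊗ₜ Q.S.symm Q.beta) * ((d ⊗ₜ 1 : H ⊗[k] H)) =
          (d ⊗ₜ 1) * (1 ⊗ₜ Q.S.symm Q.beta) := by simp
        have e2 : (1 ⊗ₜ (1 ⊗ₜ t)) * Q.coface₃ (c ⊗ₜ (d ⊗ₜ 1)) = c ⊗ₜ (d ⊗ₜ t) := by simp
        rw [coevOrbit_tmul, ← mul_assoc (1 ⊗ₜ Q.S.symm Q.beta), e1, mul_assoc (d ⊗ₜ 1),
          ← mul_assoc (1 ⊗ₜ Q.S.symm Q.beta), one_tmul_S_symm_beta_mul_coevElt,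
          ← comulSinvBeta_tmul_mul, h1, map_mul Q.coface₃, ← mul_assoc, e2,
          Algebra.TensorProduct.assoc_tmul]
    have h3 : ∀ s, (1 ⊗ₜ Q.comulSinvBeta s) * (Q.idComul Q.coevElt * Q.phi.val) =
        F (Q.coface₁ s * Q.coface₃ Q.phi.inv) := by
      intro s
      induction s with
      | zero => simp
      | add x y hx hy => simp only [map_add, add_mul, TensorProduct.tmul_add, hx, hy]
      | tmul x t =>
        rw [coface₁_tmul, ← h2, ← one_tmul_S_symm_mul_coevElt, comulSinvBeta_tmul, one_mul_tmul,
          S_symm_mul, map_mul Q.comul, one_mul_tmul, map_mul Q.idComul, map_mul Q.idComul,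
          idComul_tmul, idComul_tmul]
        simp only [mul_assoc]
    have h4 : ∀ s t, Q.coevOrbit₃ (Q.comulId (Q.comulSinvBeta t)) s =
        F (coface₄ s * (Q.coface₂ t * coface₀ Q.phi.inv)) := by
      intro s t
      induction s using tensor_induction₃ with
      | zero => simp
      | add x y hx hy => simp only [map_add, add_mul, hx, hy]
      | pure x y z =>
        induction t with
        | zero => simp
        | add x y hx hy => simp only [map_add, mul_add, add_mul, coevOrbit₃_add_left, hx, hy]
        | tmul a b =>
          have e1 : coface₄ (x ⊗ₜ (y ⊗ₜ z)) = x ⊗ₜ[k] (tmulOne (y ⊗ₜ[k] z)) := by simp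
          rw [e1, coface₂_tmul, coface₀_apply, Algebra.TensorProduct.tmul_mul_tmul,
            Algebra.TensorProduct.tmul_mul_tmul, hF, ← mul_assoc, mul_assoc _ Q.phi.inv,
            Q.phi.inv_val, coevOrbit₃_tmul, comulSinvBeta_tmul, mul_one, mul_one]
          simp only [map_mul, mul_assoc, S_symm_mul]
    have hp : Q.coface₁ Q.phi.inv * Q.coface₃ Q.phi.inv =
        coface₄ Q.phi.inv * (Q.coface₂ Q.phi.inv * coface₀ Q.phi.inv) := by
      rw [coface₂_inv_mul_coface₀_inv, ← mul_assoc, coface_inv_mul_val, one_mul]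
    rw [← mul_assoc, ← one_mul_tmul, one_tmul_S_symm_beta_mul_coevElt, h3, hp, ← h4,
      one_tmul_mul_coevOrbit₃, ← comulId_one_tmul, ← map_mul Q.comulId,
      one_tmul_S_symm_beta_mul_coevElt]

/-- For `P ∈ H⊗³`, the linear map `x ⊗ t ↦ (t ⊗ 1) P (id ⊗ Δ)(Δ(S⁻¹(x)))`. -/
def coevOrbit₃' (P : H ⊗[k] (H ⊗[k] H)) : H ⊗[k] (H ⊗[k] H) →ₗ[k] H ⊗[k] (H ⊗[k] H) :=
  LinearMap.mul' k (H ⊗[k] (H ⊗[k] H)) ∘ₗ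
    TensorProduct.map tmulOne.toLinearMap (LinearMap.mulLeft k P ∘ₗ Q.idComul.toLinearMap ∘ₗ
      Q.comul.toLinearMap ∘ₗ Q.S.symm.toLinearMap) ∘ₗ
    (TensorProduct.comm k H (H ⊗[k] H)).toLinearMap

@[simp] theorem coevOrbit₃'_tmul (P : H ⊗[k] (H ⊗[k] H)) (x : H) (t : H ⊗[k] H) :
    Q.coevOrbit₃' P (x ⊗ₜ t) = tmulOne t * (P * Q.idComul (Q.comul (Q.S.symm x))) := by
  simp [coevOrbit₃']

/-- `(Y ⊗ Z ⊗ 1) (1 ⊗ V) (id ⊗ Δ)(V Δ(S⁻¹(X))) = (Δ ⊗ id)(V) φ⁻¹`, for `V` in the form `coevElt`. -/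
theorem coevOrbit₃'_coevElt_phi :
    Q.coevOrbit₃' ((1 ⊗ₜ Q.coevElt) * Q.idComul Q.coevElt) Q.phi.val =
      Q.comulId Q.coevElt * Q.phi.inv := by
  have h : ∀ (P w : H ⊗[k] (H ⊗[k] H)), Q.coevOrbit₃' P w =
      Q.coevOrbit₃ (P * Q.phi.val) w * Q.phi.inv := by
    intro P w
    induction w with
    | zero => simp
    | add x y hx hy => simp only [map_add, add_mul, hx, hy]
    | tmul x t =>
      rw [coevOrbit₃'_tmul, coevOrbit₃_tmul, mul_assoc P, ← idComul_comul_mul_phi, mul_assoc,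
        mul_assoc, mul_assoc, Q.phi.val_inv, mul_one]
  rw [h, mul_assoc, coevElt_mul_idComul_mul_phi, ← coevOrbit₃_mul, Q.phi.val_inv,
    Algebra.TensorProduct.one_def, coevOrbit₃_tmul, S_symm_one, map_one, map_one, map_one, mul_one,
    one_mul]

/-! ### Axioms of quasi-Hopf bimodules -/

section

variable {M : Type*} [AddCommGroup M] [Module k M] (A : BimoduleData k H M)

/-- The left action of `H ⊗ B` on `M ⊗ B`, for an algebra `B`. -/
def BimoduleData.lactT (B : Type*) [Ring B] [Algebra k B] :
    H ⊗[k] B →ₗ[k] M ⊗[k] B →ₗ[k] M ⊗[k] B :=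
  TensorProduct.map₂ A.lact (LinearMap.mul k B)

/-- The right action of `H ⊗ B` on `M ⊗ B`, for an algebra `B`. -/
def BimoduleData.ractT (B : Type*) [Ring B] [Algebra k B] :
    H ⊗[k] B →ₗ[k] M ⊗[k] B →ₗ[k] M ⊗[k] B :=
  TensorProduct.map₂ A.ract (LinearMap.mul k B).flip

variable {B : Type*} [Ring B] [Algebra k B]

@[simp] theorem BimoduleData.lactT_tmul (a : H) (b : B) (m : M) (c : B) :
    A.lactT B (a ⊗ₜ b) (m ⊗ₜ c) = A.lact a m ⊗ₜ (b * c) := by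
  simp [BimoduleData.lactT]

@[simp] theorem BimoduleData.ractT_tmul (a : H) (b : B) (m : M) (c : B) :
    A.ractT B (a ⊗ₜ b) (m ⊗ₜ c) = A.ract a m ⊗ₜ (c * b) := by
  simp [BimoduleData.ractT]

/-- The axioms of a quasi-Hopf `H`-bimodule: `M` is an `H`-bimodule, the coaction `ρ` is a bimodule
map and counital, and `φ · (ρ ⊗ id)(ρ(m)) = (id ⊗ Δ)(ρ(m)) · φ`. -/
structure IsQuasiHopfBimodule : Prop where
  lact_one : ∀ m, A.lact 1 m = m
  lact_mul : ∀ a b m, A.lact (a * b) m = A.lact a (A.lact b m)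
  ract_one : ∀ m, A.ract 1 m = m
  ract_mul : ∀ a b m, A.ract (a * b) m = A.ract b (A.ract a m)
  lact_ract : ∀ a b m, A.lact a (A.ract b m) = A.ract b (A.lact a m)
  coact_lact : ∀ a m, A.coact (A.lact a m) = A.lactT H (Q.comul a) (A.coact m)
  coact_ract : ∀ a m, A.coact (A.ract a m) = A.ractT H (Q.comul a) (A.coact m)
  counit : ∀ m, TensorProduct.rid k M
    (TensorProduct.map LinearMap.id Q.counit.toLinearMap (A.coact m)) = m
  coassoc : ∀ m, A.lactT (H ⊗[k] H) Q.phi.val (TensorProduct.assoc k M H H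
      (TensorProduct.map A.coact LinearMap.id (A.coact m))) =
    A.ractT (H ⊗[k] H) Q.phi.val
      (TensorProduct.map LinearMap.id Q.comul.toLinearMap (A.coact m))

end

/-! ### The dual of `H` is a quasi-Hopf bimodule -/

/-- `id ⊗ ψ : H ⊗ H → H` -/
def idEval (ψ : Module.Dual k H) : H ⊗[k] H →ₗ[k] H :=
  (TensorProduct.rid k H).toLinearMap ∘ₗ TensorProduct.map LinearMap.id ψ

@[simp] theorem idEval_tmul (ψ : Module.Dual k H) (x y : H) :
    idEval ψ (x ⊗ₜ y) = ψ y • x := by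
  simp [idEval]

theorem mul_idEval (ψ : Module.Dual k H) (y : H) (t : H ⊗[k] H) :
    y * idEval ψ t = idEval ψ ((y ⊗ₜ 1) * t) := by
  induction t with
  | zero => simp
  | add x y hx hy => simp only [map_add, mul_add, hx, hy]
  | tmul a b => simp

theorem idEval_mul (ψ : Module.Dual k H) (y : H) (t : H ⊗[k] H) :
    idEval ψ t * y = idEval ψ (t * (y ⊗ₜ 1)) := by
  induction t with
  | zero => simp
  | add x y hx hy => simp only [map_add, add_mul, hx, hy]
  | tmul a b => simp

/-- `id ⊗ id ⊗ ψ : H ⊗ H ⊗ H → H ⊗ H` -/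
def ididEval (ψ : Module.Dual k H) : H ⊗[k] (H ⊗[k] H) →ₗ[k] H ⊗[k] H :=
  TensorProduct.map LinearMap.id (idEval ψ)

@[simp] theorem ididEval_tmul (ψ : Module.Dual k H) (x : H) (t : H ⊗[k] H) :
    ididEval ψ (x ⊗ₜ t) = x ⊗ₜ idEval ψ t := by
  simp [ididEval]

theorem mul_ididEval (ψ : Module.Dual k H) (t : H ⊗[k] H) (s : H ⊗[k] (H ⊗[k] H)) :
    t * ididEval ψ s = ididEval ψ (tmulOne t * s) := by
  induction s with
  | zero => simp
  | add x y hx hy => simp only [map_add, mul_add, hx, hy]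
  | tmul a b =>
    induction t with
    | zero => simp
    | add x y hx hy => simp only [map_add, add_mul, hx, hy]
    | tmul x y => simp [mul_idEval]

theorem ididEval_mul (ψ : Module.Dual k H) (t : H ⊗[k] H) (s : H ⊗[k] (H ⊗[k] H)) :
    ididEval ψ s * t = ididEval ψ (s * tmulOne t) := by
  induction s with
  | zero => simp
  | add x y hx hy => simp only [map_add, add_mul, hx, hy]
  | tmul a b =>
    induction t with
    | zero => simp
    | add x y hx hy => simp only [map_add, mul_add, hx, hy]
    | tmul x y => simp [idEval_mul]

theorem comul_idEval (ψ : Module.Dual k H) (t : H ⊗[k] H) :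
    Q.comul (idEval ψ t) = ididEval ψ (Q.comulId t) := by
  induction t with
  | zero => simp
  | add x y hx hy => simp only [map_add, hx, hy]
  | tmul a b =>
    rw [comulId_tmul, idEval_tmul, map_smul]
    induction Q.comul a with
    | zero => simp
    | add x y hx hy => simp only [map_add, TensorProduct.add_tmul, smul_add, hx, hy]
    | tmul x y => simp

section

variable [FiniteDimensional k H]

theorem barComul_apply (c : H) : Q.barComul c = Q.coevElt * (Q.comul c * Q.evElt) := by
  simp [barComul, U_eq_evElt, V_eq_coevElt]

theorem dualTensorHom_coact (ψ : Module.Dual k H) (c : H) :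
    dualTensorHom k H H (Q.dual.coact ψ) c =
      idEval ψ (Q.coevElt * (Q.comul c * Q.evElt)) := by
  have : dualTensorHom k H H (Q.dual.coact ψ) = Q.dualCoactHom ψ :=
    (dualTensorHomEquiv k H H).apply_symm_apply (Q.dualCoactHom ψ)
  rw [this, ← barComul_apply]
  rfl

@[simp] theorem dual_lact_apply (a : H) (ψ : Module.Dual k H) (c : H) :
    Q.dual.lact a ψ c = ψ (Q.S.symm a * c) := rfl

@[simp] theorem dual_ract_apply (a : H) (ψ : Module.Dual k H) (c : H) :
    Q.dual.ract a ψ c = ψ (c * Q.S a) := rfl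

section

variable {B : Type*} [Ring B] [Algebra k B]

theorem dualTensorHom_lactT (a : H) (b : B) (w : Module.Dual k H ⊗[k] B) (c : H) :
    dualTensorHom k H B (Q.dual.lactT B (a ⊗ₜ b) w) c =
      b * dualTensorHom k H B w (Q.S.symm a * c) := by
  induction w with
  | zero => simp
  | add x y hx hy => simp only [map_add, LinearMap.add_apply, mul_add, hx, hy]
  | tmul ψ d => simp [dualTensorHom_apply]

theorem dualTensorHom_ractT (a : H) (b : B) (w : Module.Dual k H ⊗[k] B) (c : H) :
    dualTensorHom k H B (Q.dual.ractT B (a ⊗ₜ b) w) c =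
      dualTensorHom k H B w (c * Q.S a) * b := by
  induction w with
  | zero => simp
  | add x y hx hy => simp only [map_add, LinearMap.add_apply, add_mul, hx, hy]
  | tmul ψ d => simp [dualTensorHom_apply]

end

theorem dualTensorHom_ext {B : Type*} [Ring B] [Algebra k B] {v w : Module.Dual k H ⊗[k] B}
    (h : ∀ c, dualTensorHom k H B v c = dualTensorHom k H B w c) : v = w :=
  (dualTensorHomEquiv k H B).injective (LinearMap.ext h)

theorem idEval_lact (a : H) (ψ : Module.Dual k H) (t : H ⊗[k] H) :
    idEval (Q.dual.lact a ψ) t = idEval ψ ((1 ⊗ₜ Q.S.symm a) * t) := by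
  induction t with
  | zero => simp
  | add x y hx hy => simp only [map_add, mul_add, hx, hy]
  | tmul x y => simp

theorem idEval_ract (a : H) (ψ : Module.Dual k H) (t : H ⊗[k] H) :
    idEval (Q.dual.ract a ψ) t = idEval ψ (t * (1 ⊗ₜ Q.S a)) := by
  induction t with
  | zero => simp
  | add x y hx hy => simp only [map_add, add_mul, hx, hy]
  | tmul x y => simp

theorem dual_coact_lact (a : H) (ψ : Module.Dual k H) :
    Q.dual.coact (Q.dual.lact a ψ) = Q.dual.lactT H (Q.comul a) (Q.dual.coact ψ) := by
  apply dualTensorHom_ext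
  intro c
  have h : ∀ t, dualTensorHom k H H (Q.dual.lactT H t (Q.dual.coact ψ)) c =
      idEval ψ (Q.coevOrbit Q.coevElt t * (Q.comul c * Q.evElt)) := by
    intro t
    induction t with
    | zero => simp
    | add x y hx hy => simp only [map_add, LinearMap.add_apply, add_mul, hx, hy]
    | tmul x y =>
      rw [dualTensorHom_lactT, dualTensorHom_coact, mul_idEval, coevOrbit_tmul, map_mul Q.comul]
      simp only [mul_assoc]
  rw [h, ← one_tmul_S_symm_mul_coevElt, dualTensorHom_coact, idEval_lact, mul_assoc]

theorem dual_coact_ract (a : H) (ψ : Module.Dual k H) :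
    Q.dual.coact (Q.dual.ract a ψ) = Q.dual.ractT H (Q.comul a) (Q.dual.coact ψ) := by
  apply dualTensorHom_ext
  intro c
  have h : ∀ t, dualTensorHom k H H (Q.dual.ractT H t (Q.dual.coact ψ)) c =
      idEval ψ (Q.coevElt * (Q.comul c * Q.evOrbit Q.evElt t)) := by
    intro t
    induction t with
    | zero => simp
    | add x y hx hy => simp only [map_add, LinearMap.add_apply, mul_add, hx, hy]
    | tmul x y =>
      rw [dualTensorHom_ractT, dualTensorHom_coact, idEval_mul, evOrbit_tmul, map_mul Q.comul]
      simp only [mul_assoc]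
  rw [h, ← evElt_mul_one_tmul_S, dualTensorHom_coact, idEval_ract]
  simp only [mul_assoc]

theorem dual_counit (ψ : Module.Dual k H) : TensorProduct.rid k (Module.Dual k H)
    (TensorProduct.map LinearMap.id Q.counit.toLinearMap (Q.dual.coact ψ)) = ψ := by
  have h1 : ∀ (w : Module.Dual k H ⊗[k] H) (c : H), TensorProduct.rid k (Module.Dual k H)
      (TensorProduct.map LinearMap.id Q.counit.toLinearMap w) c =
      Q.counit (dualTensorHom k H H w c) := by
    intro w c
    induction w with
    | zero => simp
    | add x y hx hy => simp only [map_add, LinearMap.add_apply, hx, hy]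
    | tmul χ d => simp [dualTensorHom_apply, mul_comm]
  have h2 : ∀ t, Q.counit (idEval ψ t) = ψ (Q.epsId t) := by
    intro t
    induction t with
    | zero => simp
    | add x y hx hy => simp only [map_add, hx, hy]
    | tmul x y => simp [mul_comm]
  ext c
  rw [h1, dualTensorHom_coact, h2, map_mul Q.epsId, epsId_coevElt, map_mul Q.epsId, epsId_evElt,
    epsId_comul, one_mul, mul_one]

theorem dualTensorHom_map_coact (ψ : Module.Dual k H) (c : H) :
    dualTensorHom k H (H ⊗[k] H) (TensorProduct.assoc k (Module.Dual k H) H H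
      (TensorProduct.map Q.dual.coact LinearMap.id (Q.dual.coact ψ))) c =
    ididEval ψ ((1 ⊗ₜ Q.coevElt) * (Q.idComul Q.coevElt * (Q.idComul (Q.comul c) *
      (Q.idComul Q.evElt * (1 ⊗ₜ Q.evElt))))) := by
  have h1 : ∀ (v : Module.Dual k H ⊗[k] H) (b c : H), dualTensorHom k H (H ⊗[k] H)
      (TensorProduct.assoc k (Module.Dual k H) H H (v ⊗ₜ b)) c =
      dualTensorHom k H H v c ⊗ₜ b := by
    intro v b c
    induction v with
    | zero => simp
    | add x y hx hy => simp only [map_add, LinearMap.add_apply, TensorProduct.add_tmul, hx, hy]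
    | tmul χ d => simp [dualTensorHom_apply, TensorProduct.smul_tmul']
  have h2 : ∀ (χ : Module.Dual k H) (b : H) (t : H ⊗[k] H),
      idEval χ t ⊗ₜ[k] b = TensorProduct.map LinearMap.id (dualTensorHom k H H (χ ⊗ₜ b)) t := by
    intro χ b t
    induction t with
    | zero => simp
    | add x y hx hy => simp only [map_add, TensorProduct.add_tmul, hx, hy]
    | tmul x y => simp [dualTensorHom_apply, TensorProduct.smul_tmul']
  have h3 : ∀ w : Module.Dual k H ⊗[k] H, dualTensorHom k H (H ⊗[k] H)
      (TensorProduct.assoc k (Module.Dual k H) H H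
        (TensorProduct.map Q.dual.coact LinearMap.id w)) c =
      TensorProduct.map LinearMap.id (dualTensorHom k H H w)
        (Q.coevElt * (Q.comul c * Q.evElt)) := by
    intro w
    induction w with
    | zero => simp
    | add x y hx hy => simp only [map_add, LinearMap.add_apply, TensorProduct.map_add_right, hx, hy]
    | tmul χ d => rw [TensorProduct.map_tmul, h1, dualTensorHom_coact, h2, LinearMap.id_apply]
  have h4 : ∀ t, TensorProduct.map LinearMap.id (dualTensorHom k H H (Q.dual.coact ψ)) t =
      ididEval ψ ((1 ⊗ₜ Q.coevElt) * (Q.idComul t * (1 ⊗ₜ Q.evElt))) := by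
    intro t
    induction t with
    | zero => simp
    | add x y hx hy => simp only [map_add, mul_add, add_mul, hx, hy]
    | tmul x y => simp [dualTensorHom_coact]
  rw [h3, h4, map_mul Q.idComul, map_mul Q.idComul]
  simp only [mul_assoc]

theorem dual_coassoc (ψ : Module.Dual k H) :
    Q.dual.lactT (H ⊗[k] H) Q.phi.val (TensorProduct.assoc k (Module.Dual k H) H H
      (TensorProduct.map Q.dual.coact LinearMap.id (Q.dual.coact ψ))) =
    Q.dual.ractT (H ⊗[k] H) Q.phi.val
      (TensorProduct.map LinearMap.id Q.comul.toLinearMap (Q.dual.coact ψ)) := by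
  apply dualTensorHom_ext
  intro c
  have h1 : ∀ t, dualTensorHom k H (H ⊗[k] H) (Q.dual.lactT (H ⊗[k] H) t
      (TensorProduct.assoc k (Module.Dual k H) H H
        (TensorProduct.map Q.dual.coact LinearMap.id (Q.dual.coact ψ)))) c =
      ididEval ψ (Q.coevOrbit₃' ((1 ⊗ₜ Q.coevElt) * Q.idComul Q.coevElt) t *
        (Q.idComul (Q.comul c) * (Q.idComul Q.evElt * (1 ⊗ₜ Q.evElt)))) := by
    intro t
    induction t with
    | zero => simp
    | add x y hx hy => simp only [map_add, LinearMap.add_apply, add_mul, hx, hy]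
    | tmul x t =>
      rw [dualTensorHom_lactT, dualTensorHom_map_coact, mul_ididEval, coevOrbit₃'_tmul,
        map_mul Q.comul, map_mul Q.idComul]
      simp only [mul_assoc]
  have h2 : ∀ w : Module.Dual k H ⊗[k] H, dualTensorHom k H (H ⊗[k] H)
      (TensorProduct.map LinearMap.id Q.comul.toLinearMap w) =
      Q.comul.toLinearMap ∘ₗ dualTensorHom k H H w := by
    intro w
    ext c
    induction w with
    | zero => simp
    | add x y hx hy => simp only [map_add, LinearMap.comp_add, LinearMap.add_apply, hx, hy]
    | tmul χ d => simp [dualTensorHom_apply]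
  have h3 : ∀ t, dualTensorHom k H (H ⊗[k] H) (Q.dual.ractT (H ⊗[k] H) t
      (TensorProduct.map LinearMap.id Q.comul.toLinearMap (Q.dual.coact ψ))) c =
      ididEval ψ (Q.comulId Q.coevElt * (Q.comulId (Q.comul c) *
        Q.evOrbit₃ (Q.comulId Q.evElt) t)) := by
    intro t
    induction t with
    | zero => simp
    | add x y hx hy => simp only [map_add, LinearMap.add_apply, mul_add, hx, hy]
    | tmul x t =>
      rw [dualTensorHom_ractT, h2, LinearMap.comp_apply, AlgHom.toLinearMap_apply,
        dualTensorHom_coact, comul_idEval, ididEval_mul, evOrbit₃_tmul, map_mul Q.comul]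
      simp only [map_mul Q.comulId, mul_assoc]
  rw [h1, h3, coevOrbit₃'_coevElt_phi, ← phi_inv_mul_idComul_evElt]
  congr 1
  rw [← mul_assoc (Q.comulId (Q.comul c)), ← phi_inv_mul_idComul]
  simp only [mul_assoc]

theorem dual_isQuasiHopfBimodule : Q.IsQuasiHopfBimodule Q.dual where
  lact_one ψ := by ext c; simp [S_symm_one]
  lact_mul a b ψ := by ext c; simp [S_symm_mul, mul_assoc]
  ract_one ψ := by ext c; simp [Q.S_one]
  ract_mul a b ψ := by ext c; simp [Q.S_mul, mul_assoc]
  lact_ract a b ψ := by ext c; simp [mul_assoc]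
  coact_lact := Q.dual_coact_lact
  coact_ract := Q.dual_coact_ract
  counit := Q.dual_counit
  coassoc := Q.dual_coassoc

end

/-! ### The structure theorem for quasi-Hopf bimodules -/

section

variable {M : Type*} [AddCommGroup M] [Module k M] {A : BimoduleData k H M}

variable (A) in
/-- `m ⊗ h ↦ m · β S(h)` -/
def ractBetaS : M ⊗[k] H →ₗ[k] M :=
  TensorProduct.lift (A.ract ∘ₗ LinearMap.mulLeft k Q.beta ∘ₗ Q.S.toLinearMap).flip

@[simp] theorem ractBetaS_tmul (m : M) (h : H) :
    Q.ractBetaS A (m ⊗ₜ h) = A.ract (Q.beta * Q.S h) m := by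
  simp [ractBetaS]

theorem E_eq (m : M) : Q.E A m = Q.ractBetaS A (A.lactT H Q.qR (A.coact m)) := by
  have h : ∀ (s : H ⊗[k] H) (w : M ⊗[k] H), TensorProduct.lift A.ract.flip
      (TensorProduct.map (TensorProduct.lift A.lact)
        (LinearMap.mulLeft k Q.beta ∘ₗ Q.S.toLinearMap ∘ₗ LinearMap.mul' k H)
        (TensorProduct.tensorTensorTensorComm k H H M H (s ⊗ₜ w))) =
      Q.ractBetaS A (A.lactT H s w) := by
    intro s w
    induction s with
    | zero => simp
    | add x y hx hy => simp only [map_add, TensorProduct.add_tmul, LinearMap.add_apply, hx, hy]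
    | tmul x y =>
      induction w with
      | zero => simp
      | add x y hx hy => simp only [map_add, TensorProduct.tmul_add, hx, hy]
      | tmul m h => simp
  exact h _ _

namespace IsQuasiHopfBimodule

variable {Q} (hA : Q.IsQuasiHopfBimodule A)

include hA

theorem lactT_mul {B : Type*} [Ring B] [Algebra k B] (s t : H ⊗[k] B) (w : M ⊗[k] B) :
    A.lactT B (s * t) w = A.lactT B s (A.lactT B t w) := by
  induction w with
  | zero => simp
  | add x y hx hy => simp only [map_add, hx, hy]
  | tmul m h =>
    induction s with
    | zero => simp
    | add x y hx hy => simp only [map_add, add_mul, LinearMap.add_apply, hx, hy]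
    | tmul x y =>
      induction t with
      | zero => simp
      | add x y hx hy => simp only [map_add, mul_add, LinearMap.add_apply, hx, hy]
      | tmul a b => simp [hA.lact_mul, mul_assoc]

theorem lactT_one {B : Type*} [Ring B] [Algebra k B] (w : M ⊗[k] B) : A.lactT B 1 w = w := by
  induction w with
  | zero => simp
  | add x y hx hy => simp only [map_add, hx, hy]
  | tmul m h => simp [Algebra.TensorProduct.one_def, hA.lact_one]

theorem lactT_ractT {B : Type*} [Ring B] [Algebra k B] (s t : H ⊗[k] B) (w : M ⊗[k] B) :
    A.lactT B s (A.ractT B t w) = A.ractT B t (A.lactT B s w) := by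
  induction w with
  | zero => simp
  | add x y hx hy => simp only [map_add, hx, hy]
  | tmul m h =>
    induction s with
    | zero => simp
    | add x y hx hy => simp only [map_add, LinearMap.add_apply, hx, hy]
    | tmul x y =>
      induction t with
      | zero => simp
      | add x y hx hy => simp only [map_add, LinearMap.add_apply, hx, hy]
      | tmul a b => simp [hA.lact_ract, mul_assoc]

theorem ractBetaS_ractT (d : H ⊗[k] H) (m : M) (h : H) :
    Q.ractBetaS A (A.ractT H d (m ⊗ₜ h)) = A.ract (Q.betaS d * Q.S h) m := by
  induction d with
  | zero => simp
  | add x y hx hy => simp only [map_add, add_mul, LinearMap.add_apply, hx, hy]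
  | tmul x y => simp [← hA.ract_mul, Q.S_mul, mul_assoc]

/-- `E(m · a) = ε(a) E(m)` -/
theorem E_ract (a : H) (m : M) : Q.E A (A.ract a m) = Q.counit a • Q.E A m := by
  have h : ∀ w : M ⊗[k] H, Q.ractBetaS A (A.ractT H (Q.comul a) w) =
      Q.counit a • Q.ractBetaS A w := by
    intro w
    induction w with
    | zero => simp
    | add x y hx hy => simp only [map_add, smul_add, hx, hy]
    | tmul m h =>
      have : Q.betaS (Q.comul a) = Q.counit a • Q.beta := Q.antipode_beta a
      rw [hA.ractBetaS_ractT, this]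
      simp
  rw [E_eq, hA.coact_ract, hA.lactT_ractT, h, ← E_eq]

variable (A Q) in
omit hA in
/-- For `m ∈ M`, the map `x ⊗ y ↦ E(x · m) · y`. -/
def actE (m : M) : H ⊗[k] H →ₗ[k] M :=
  TensorProduct.lift (A.ract.flip ∘ₗ Q.E A ∘ₗ A.lact.flip m)

omit hA in
@[simp] theorem actE_tmul (m : M) (x y : H) :
    actE Q A m (x ⊗ₜ y) = A.ract y (Q.E A (A.lact x m)) := by
  simp [actE]

/-- `a · E(m) = E(a₍₁₎ · m) · a₍₂₎` -/
theorem lact_E (a : H) (m : M) : A.lact a (Q.E A m) = actE Q A m (Q.comul a) := by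
  have h1 : ∀ w : M ⊗[k] H, A.lact a (Q.ractBetaS A w) =
      Q.ractBetaS A (A.lactT H (a ⊗ₜ 1) w) := by
    intro w
    induction w with
    | zero => simp
    | add x y hx hy => simp only [map_add, hx, hy]
    | tmul m h => simp [hA.lact_ract]
  have h2 : ∀ (y : H) (w : M ⊗[k] H), Q.ractBetaS A (A.lactT H (1 ⊗ₜ Q.S.symm y) w) =
      A.ract y (Q.ractBetaS A w) := by
    intro y w
    induction w with
    | zero => simp
    | add x y hx hy => simp only [map_add, hx, hy]
    | tmul m h => simp [hA.lact_one, ← hA.ract_mul, Q.S_mul, mul_assoc]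
  have h3 : ∀ d, Q.ractBetaS A (A.lactT H (Q.qROrbit d) (A.coact m)) = actE Q A m d := by
    intro d
    induction d with
    | zero => simp
    | add x y hx hy => simp only [map_add, LinearMap.add_apply, hx, hy]
    | tmul x y =>
      rw [qROrbit_tmul, actE_tmul, hA.lactT_mul, hA.lactT_mul, h2, E_eq, hA.coact_lact]
  rw [E_eq, h1, ← hA.lactT_mul, tmul_one_mul_qR, h3]

theorem map_E_ractT {B : Type*} [Ring B] [Algebra k B] (d : H ⊗[k] B) (w : M ⊗[k] B) :
    TensorProduct.map (Q.E A) LinearMap.id (A.ractT B d w) =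
      TensorProduct.map (Q.E A) (LinearMap.mulRight k (Algebra.TensorProduct.lid k B
        (Algebra.TensorProduct.map Q.counit (AlgHom.id k B) d))) w := by
  induction w with
  | zero => simp
  | add x y hx hy => simp only [map_add, hx, hy]
  | tmul m h =>
    induction d with
    | zero => simp
    | add x y hx hy =>
      simp only [map_add, LinearMap.add_apply, hx, hy]
      simp [mul_add, TensorProduct.tmul_add]
    | tmul x y => simp [hA.E_ract, TensorProduct.smul_tmul']

/-- `(E ⊗ id)(ρ(m · b)) = (E ⊗ id)(ρ(m)) (1 ⊗ b)` -/
theorem map_E_coact_ract (b : H) (m : M) :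
    TensorProduct.map (Q.E A) LinearMap.id (A.coact (A.ract b m)) =
      TensorProduct.map (Q.E A) (LinearMap.mulRight k b) (A.coact m) := by
  rw [hA.coact_ract, hA.map_E_ractT, Q.counit_comul]

/-- Coassociativity, solved for `(ρ ⊗ id)(ρ(m))`. -/
theorem assoc_map_coact (m : M) :
    TensorProduct.assoc k M H H (TensorProduct.map A.coact LinearMap.id (A.coact m)) =
    A.lactT (H ⊗[k] H) Q.phi.inv (A.ractT (H ⊗[k] H) Q.phi.val
      (TensorProduct.map LinearMap.id Q.comul.toLinearMap (A.coact m))) := by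
  rw [← hA.coassoc, ← hA.lactT_mul, Q.phi.inv_val, hA.lactT_one]

/-- A linear map on `M ⊗ H ⊗ H` that factors through `E` on the first leg absorbs the right action
of `φ`, as `(ε ⊗ id ⊗ id)(φ) = 1`. -/
theorem map_E_ractT_phi (w : M ⊗[k] (H ⊗[k] H)) :
    TensorProduct.map (Q.E A) LinearMap.id (A.ractT (H ⊗[k] H) Q.phi.val w) =
      TensorProduct.map (Q.E A) LinearMap.id w := by
  have : Algebra.TensorProduct.lid k (H ⊗[k] H)
      (Algebra.TensorProduct.map Q.counit (AlgHom.id k (H ⊗[k] H)) Q.phi.val) = 1 := Q.eps₁_phi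
  rw [hA.map_E_ractT, this]
  congr 2
  ext
  simp

theorem map_E_coact_ractBetaS (t : H ⊗[k] H) (w : M ⊗[k] H) :
    TensorProduct.map (Q.E A) LinearMap.id (A.coact (Q.ractBetaS A (A.lactT H t w))) =
    TensorProduct.map (Q.E A) Q.betaS (A.lactT (H ⊗[k] H) (Q.comulId t)
      (TensorProduct.assoc k M H H (TensorProduct.map A.coact LinearMap.id w))) := by
  have h : ∀ (d : H ⊗[k] H) (v : M ⊗[k] H) (y h : H),
      TensorProduct.map (Q.E A) (LinearMap.mulRight k (Q.beta * Q.S (y * h))) (A.lactT H d v) =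
      TensorProduct.map (Q.E A) Q.betaS (A.lactT (H ⊗[k] H)
        (Algebra.TensorProduct.assoc k k k H H H (d ⊗ₜ y))
        (TensorProduct.assoc k M H H (v ⊗ₜ h))) := by
    intro d v y h
    induction d with
    | zero => simp
    | add x y hx hy => simp only [map_add, TensorProduct.add_tmul, LinearMap.add_apply, hx, hy]
    | tmul a b =>
      induction v with
      | zero => simp
      | add x y hx hy => simp only [map_add, TensorProduct.add_tmul, hx, hy]
      | tmul m c => simp [mul_assoc]
  induction w with
  | zero => simp
  | add x y hx hy => simp only [map_add, hx, hy]
  | tmul m c =>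
    induction t with
    | zero => simp
    | add x y hx hy => simp only [map_add, LinearMap.add_apply, hx, hy]
    | tmul x y =>
      rw [BimoduleData.lactT_tmul, ractBetaS_tmul, hA.map_E_coact_ract, hA.coact_lact, h,
        comulId_tmul, TensorProduct.map_tmul, LinearMap.id_apply]

/-- Elements `n` of the image of `E` satisfy `(E ⊗ id)(ρ(n)) = n ⊗ 1`; this amounts to
`Δ(q_R¹) p_R (1 ⊗ S(q_R²)) = 1 ⊗ 1`. -/
theorem map_E_coact_E (m : M) :
    TensorProduct.map (Q.E A) LinearMap.id (A.coact (Q.E A m)) = Q.E A m ⊗ₜ 1 := by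
  have h1 : ∀ (s : H ⊗[k] (H ⊗[k] H)) (w : M ⊗[k] H),
      TensorProduct.map (Q.E A) Q.betaS (A.lactT (H ⊗[k] H) s
        (TensorProduct.map LinearMap.id Q.comul.toLinearMap w)) =
      TensorProduct.map (Q.E A ∘ₗ A.lact.flip (TensorProduct.rid k M
        (TensorProduct.map LinearMap.id Q.counit.toLinearMap w))) LinearMap.id (Q.idBetaS s) := by
    intro s w
    induction w with
    | zero => simp
    | add x y hx hy =>
      simp only [map_add, hx, hy, LinearMap.comp_add, TensorProduct.map_add_left,
        LinearMap.add_apply]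
    | tmul m h =>
      induction s with
      | zero => simp
      | add x y hx hy => simp only [map_add, LinearMap.add_apply, hx, hy]
      | tmul x t => simp [betaS_mul_comul, TensorProduct.smul_tmul']
  have h2 : ∀ s, Q.idBetaS (Q.comulId (Q.idSinvAlpha s) * Q.phi.inv) = Q.pRSandwich s := by
    intro s
    induction s with
    | zero => simp
    | add x y hx hy => simp only [map_add, add_mul, hx, hy]
    | tmul x t =>
      rw [idSinvAlpha_tmul, comulId_tmul, idBetaS_assoc_mul, pRSandwich_tmul, pR_eq,
        LinearEquiv.apply_symm_apply]
  have h3 : ∀ w, TensorProduct.map (Q.E A) Q.betaS (A.ractT (H ⊗[k] H) Q.phi.val w) =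
      TensorProduct.map (Q.E A) Q.betaS w := by
    intro w
    have h : ∀ v : M ⊗[k] (H ⊗[k] H), TensorProduct.map (Q.E A) Q.betaS v =
        TensorProduct.map LinearMap.id Q.betaS (TensorProduct.map (Q.E A) LinearMap.id v) := by
      intro v
      rw [← LinearMap.comp_apply, ← TensorProduct.map_comp, LinearMap.id_comp, LinearMap.comp_id]
    rw [h, hA.map_E_ractT_phi, ← h]
  have h4 := hA.map_E_coact_ractBetaS Q.qR (A.coact m)
  rw [← E_eq, hA.assoc_map_coact, ← hA.lactT_mul, hA.lactT_ractT, h3, h1, hA.counit, qR_eq, h2,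
    pRSandwich_phi, Algebra.TensorProduct.one_def] at h4
  simpa [hA.lact_one] using h4

/-- `E` is a projection. -/
theorem E_E (m : M) : Q.E A (Q.E A m) = Q.E A m := by
  have h : ∀ w : M ⊗[k] H, TensorProduct.rid k M (TensorProduct.map LinearMap.id
      Q.counit.toLinearMap (TensorProduct.map (Q.E A) LinearMap.id w)) =
      Q.E A (TensorProduct.rid k M (TensorProduct.map LinearMap.id Q.counit.toLinearMap w)) := by
    intro w
    induction w with
    | zero => simp
    | add x y hx hy => simp only [map_add, hx, hy]
    | tmul m h => simp
  have := h (A.coact (Q.E A m))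
  rw [hA.map_E_coact_E, hA.counit] at this
  simpa using this.symm

/-- `E(a · E(m)) = E(a · m)` -/
theorem E_lact_E (a : H) (m : M) : Q.E A (A.lact a (Q.E A m)) = Q.E A (A.lact a m) := by
  have h : ∀ d : H ⊗[k] H, Q.E A (actE Q A m d) = Q.E A (A.lact (TensorProduct.rid k H
      (TensorProduct.map LinearMap.id Q.counit.toLinearMap d)) m) := by
    intro d
    induction d with
    | zero => simp
    | add x y hx hy => simp only [map_add, LinearMap.add_apply, hx, hy]
    | tmul x y => simp [hA.E_ract, hA.E_E]
  rw [hA.lact_E, h]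
  congr 3
  exact Q.comul_counit a

/-- `E(m₍₀₎) · m₍₁₎ = m` -/
theorem ract_E_coact (m : M) :
    TensorProduct.lift A.ract.flip (TensorProduct.map (Q.E A) LinearMap.id (A.coact m)) = m := by
  let D : M ⊗[k] (H ⊗[k] H) →ₗ[k] M :=
    TensorProduct.lift (A.ract ∘ₗ LinearMap.mulLeft k Q.beta ∘ₗ Q.sAlpha).flip
  have hD : ∀ (n : M) (t : H ⊗[k] H), D (n ⊗ₜ t) = A.ract (Q.beta * Q.sAlpha t) n := by
    intro n t
    simp [D]
  have h1 : ∀ (s : H ⊗[k] (H ⊗[k] H)) (v : M ⊗[k] H) (h : H),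
      A.ract h (Q.ractBetaS A (A.lactT H (Q.idSinvAlpha s) v)) =
      D (A.lactT (H ⊗[k] H) s (TensorProduct.assoc k M H H (v ⊗ₜ h))) := by
    intro s v h
    induction v with
    | zero => simp
    | add x y hx hy => simp only [map_add, TensorProduct.add_tmul, hx, hy]
    | tmul n c =>
      induction s with
      | zero => simp
      | add x y hx hy => simp only [map_add, LinearMap.add_apply, hx, hy]
      | tmul x t =>
        rw [idSinvAlpha_tmul, BimoduleData.lactT_tmul, ractBetaS_tmul, TensorProduct.assoc_tmul,
          BimoduleData.lactT_tmul, hD, sAlpha_mul_tmul, ← hA.ract_mul, Q.S_mul,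
          LinearEquiv.apply_symm_apply]
        simp only [mul_assoc]
  have h2 : ∀ w : M ⊗[k] H,
      TensorProduct.lift A.ract.flip (TensorProduct.map (Q.E A) LinearMap.id w) =
      D (A.lactT (H ⊗[k] H) Q.phi.val
        (TensorProduct.assoc k M H H (TensorProduct.map A.coact LinearMap.id w))) := by
    intro w
    induction w with
    | zero => simp
    | add x y hx hy => simp only [map_add, hx, hy]
    | tmul n c =>
      rw [TensorProduct.map_tmul, TensorProduct.map_tmul, LinearMap.id_apply, ← h1, ← qR_eq,
        ← E_eq]
      simp
  have h3 : ∀ (s : H ⊗[k] (H ⊗[k] H)) (w : M ⊗[k] H),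
      D (A.ractT (H ⊗[k] H) s (TensorProduct.map LinearMap.id Q.comul.toLinearMap w)) =
      A.ract (Q.betaSAlpha s) (TensorProduct.rid k M
        (TensorProduct.map LinearMap.id Q.counit.toLinearMap w)) := by
    intro s w
    induction w with
    | zero => simp
    | add x y hx hy => simp only [map_add, hx, hy]
    | tmul n c =>
      induction s with
      | zero => simp
      | add x y hx hy => simp only [map_add, LinearMap.add_apply, hx, hy]
      | tmul x t =>
        rw [TensorProduct.map_tmul, LinearMap.id_apply, AlgHom.toLinearMap_apply,
          BimoduleData.ractT_tmul, hD, sAlpha_comul_mul, betaSAlpha_tmul, ← hA.ract_mul]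
        simp [mul_assoc]
  rw [h2, hA.coassoc, h3, betaSAlpha_phi, hA.counit, hA.ract_one]

/-- For coinvariant `n`, the coaction is `ρ(n) = E(X̄ · n) · Ȳ ⊗ Z̄`. -/
theorem coact_of_E_eq {n : M} (hn : Q.E A n = n) :
    A.coact n = TensorProduct.map (actE Q A n) LinearMap.id
      ((TensorProduct.assoc k H H H).symm Q.phi.inv) := by
  let J : M ⊗[k] (H ⊗[k] H) →ₗ[k] M ⊗[k] H :=
    TensorProduct.map (TensorProduct.lift A.ract.flip) LinearMap.id ∘ₗ
      (TensorProduct.assoc k M H H).symm.toLinearMap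
  have h1 : ∀ w : M ⊗[k] H, J (TensorProduct.map (Q.E A) LinearMap.id
      (TensorProduct.assoc k M H H (TensorProduct.map A.coact LinearMap.id w))) = w := by
    have h : ∀ (v : M ⊗[k] H) (h : H), J (TensorProduct.map (Q.E A) LinearMap.id
        (TensorProduct.assoc k M H H (v ⊗ₜ h))) =
        TensorProduct.lift A.ract.flip (TensorProduct.map (Q.E A) LinearMap.id v) ⊗ₜ h := by
      intro v h
      induction v with
      | zero => simp
      | add x y hx hy => simp only [map_add, TensorProduct.add_tmul, hx, hy]
      | tmul n c => simp [J]
    intro w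
    induction w with
    | zero => simp
    | add x y hx hy => simp only [map_add, hx, hy]
    | tmul n c => rw [TensorProduct.map_tmul, h, hA.ract_E_coact, LinearMap.id_apply]
  have h2 : ∀ (s : H ⊗[k] (H ⊗[k] H)) (w : M ⊗[k] H),
      TensorProduct.map (Q.E A) LinearMap.id (A.lactT (H ⊗[k] H) s
        (TensorProduct.map LinearMap.id Q.comul.toLinearMap w)) =
      TensorProduct.map (Q.E A) LinearMap.id (A.lactT (H ⊗[k] H) s
        (TensorProduct.map LinearMap.id Q.comul.toLinearMap
          (TensorProduct.map (Q.E A) LinearMap.id w))) := by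
    intro s w
    induction w with
    | zero => simp
    | add x y hx hy => simp only [map_add, hx, hy]
    | tmul n c =>
      induction s with
      | zero => simp
      | add x y hx hy => simp only [map_add, LinearMap.add_apply, hx, hy]
      | tmul x t => simp [hA.E_lact_E]
  have h3 : ∀ s : H ⊗[k] (H ⊗[k] H), J (TensorProduct.map (Q.E A) LinearMap.id
      (A.lactT (H ⊗[k] H) s (n ⊗ₜ 1))) =
      TensorProduct.map (actE Q A n) LinearMap.id ((TensorProduct.assoc k H H H).symm s) := by
    intro s
    induction s using tensor_induction₃ with
    | zero => simp
    | add x y hx hy => simp only [map_add, LinearMap.add_apply, hx, hy]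
    | pure x y z => simp [J]
  have h4 := hA.map_E_coact_E n
  rw [hn] at h4
  have h5 := h1 (A.coact n)
  rw [hA.assoc_map_coact, hA.lactT_ractT, hA.map_E_ractT_phi, h2, h4, TensorProduct.map_tmul,
    AlgHom.toLinearMap_apply, map_one, LinearMap.id_apply, h3] at h5
  exact h5.symm

variable (A Q) in
omit hA in
/-- The linear map `E(M) ⊗ H → M`, `n ⊗ h ↦ n · h`. -/
def ofCoinvariants : Q.coinvariants A ⊗[k] H →ₗ[k] M :=
  TensorProduct.lift (A.ract.flip ∘ₗ (Q.coinvariants A).subtype)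

theorem E_coe (n : Q.coinvariants A) : Q.E A n = n := by
  obtain ⟨_, m, rfl⟩ := n
  exact hA.E_E m

theorem map_E_coact_ofCoinvariants (w : Q.coinvariants A ⊗[k] H) :
    TensorProduct.map (Q.E A) LinearMap.id (A.coact (ofCoinvariants Q A w)) =
      TensorProduct.map (Q.coinvariants A).subtype LinearMap.id w := by
  induction w with
  | zero => simp
  | add x y hx hy => simp only [map_add, hx, hy]
  | tmul n h =>
    have h1 : ∀ v : M ⊗[k] H, TensorProduct.map (Q.E A) (LinearMap.mulRight k h) v =
        TensorProduct.map LinearMap.id (LinearMap.mulRight k h)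
          (TensorProduct.map (Q.E A) LinearMap.id v) := by
      intro v
      rw [← LinearMap.comp_apply, ← TensorProduct.map_comp, LinearMap.id_comp, LinearMap.comp_id]
    have h2 := hA.map_E_coact_E (n : M)
    rw [hA.E_coe] at h2
    have h3 : ofCoinvariants Q A (n ⊗ₜ h) = A.ract h n := by simp [ofCoinvariants]
    rw [h3, hA.map_E_coact_ract, h1, h2]
    simp

/-- The fundamental theorem of quasi-Hopf bimodules: `M ≅ E(M) ⊗ H`. -/
theorem ofCoinvariants_bijective : Function.Bijective (ofCoinvariants Q A) := by
  constructor
  · rw [injective_iff_map_eq_zero]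
    intro w hw
    have h := hA.map_E_coact_ofCoinvariants w
    rw [hw, map_zero, map_zero] at h
    have hinj : Function.Injective (TensorProduct.map (Q.coinvariants A).subtype
        (LinearMap.id : H →ₗ[k] H)) :=
      Module.Flat.rTensor_preserves_injective_linearMap _ (Submodule.subtype_injective _)
    exact hinj (h.symm.trans (map_zero _).symm)
  · intro m
    let E' : M →ₗ[k] Q.coinvariants A := (Q.E A).rangeRestrict
    have hE' : ∀ m, (E' m : M) = Q.E A m := fun m => rfl
    have h : ∀ w : M ⊗[k] H, ofCoinvariants Q A (TensorProduct.map E' LinearMap.id w) =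
        TensorProduct.lift A.ract.flip (TensorProduct.map (Q.E A) LinearMap.id w) := by
      intro w
      induction w with
      | zero => simp
      | add x y hx hy => simp only [map_add, hx, hy]
      | tmul n c => simp [ofCoinvariants, hE']
    exact ⟨TensorProduct.map E' LinearMap.id (A.coact m), by rw [h, hA.ract_E_coact]⟩

theorem finrank_coinvariants [FiniteDimensional k H] [Nontrivial H]
    (hd : Module.finrank k M = Module.finrank k H) : Module.finrank k (Q.coinvariants A) = 1 := by
  have h := (LinearEquiv.ofBijective _ hA.ofCoinvariants_bijective).finrank_eq
  rw [Module.finrank_tensorProduct, hd] at h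
  exact Nat.eq_of_mul_eq_mul_right Module.finrank_pos (h.trans (one_mul _).symm)

theorem exists_coinvariant_ne_zero [FiniteDimensional k H] [Nontrivial H]
    (hd : Module.finrank k M = Module.finrank k H) : ∃ n ∈ Q.coinvariants A, n ≠ 0 := by
  apply Submodule.exists_mem_ne_zero_of_ne_bot
  intro h
  have h1 := hA.finrank_coinvariants hd
  rw [h, finrank_bot] at h1
  exact zero_ne_one h1

theorem exists_smul_eq_of_mem_coinvariants [FiniteDimensional k H] [Nontrivial H]
    (hd : Module.finrank k M = Module.finrank k H) {n m : M} (hn : n ∈ Q.coinvariants A)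
    (h0 : n ≠ 0) (hm : m ∈ Q.coinvariants A) : ∃ c : k, c • n = m := by
  obtain ⟨c, hc⟩ := (finrank_eq_one_iff_of_nonzero' (⟨n, hn⟩ : Q.coinvariants A)
    (fun hc => h0 (congrArg Subtype.val hc))).mp (hA.finrank_coinvariants hd) ⟨m, hm⟩
  exact ⟨c, congrArg Subtype.val hc⟩

theorem eq_zero_of_ract_eq_zero {n : M} (hn : n ∈ Q.coinvariants A) (h0 : n ≠ 0) {b : H}
    (hb : A.ract b n = 0) : b = 0 := by
  have h1 := hA.map_E_coact_ofCoinvariants (⟨n, hn⟩ ⊗ₜ b)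
  have h2 : ofCoinvariants Q A (⟨n, hn⟩ ⊗ₜ b) = A.ract b n := by simp [ofCoinvariants]
  rw [h2, hb, map_zero, map_zero] at h1
  simp only [TensorProduct.map_tmul, Submodule.subtype_apply, LinearMap.id_apply] at h1
  obtain ⟨g, hg⟩ : ∃ g : Module.Dual k M, g n ≠ 0 := by
    by_contra! hc
    exact h0 ((Module.forall_dual_apply_eq_zero_iff k n).mp hc)
  have h3 := congrArg (TensorProduct.lid k H ∘ TensorProduct.map g LinearMap.id) h1.symm
  simpa [hg] using h3

end IsQuasiHopfBimodule

end

/-! ### The space of left cointegrals -/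

section

variable [FiniteDimensional k H]

/-- `F_λ(b) = λ · b` in `H*` -/
theorem fourier_apply (lam : Module.Dual k H) (b : H) :
    Q.fourier lam b = Q.dual.ract b lam := rfl

theorem fourier_bijective {lam : Module.Dual k H} (h : lam ∈ Q.leftCointegrals) (h0 : lam ≠ 0) :
    Function.Bijective (Q.fourier lam) := by
  have hinj : Function.Injective (Q.fourier lam) := by
    rw [injective_iff_map_eq_zero]
    intro b hb
    exact Q.dual_isQuasiHopfBimodule.eq_zero_of_ract_eq_zero h h0 hb
  have hd : Module.finrank k H = Module.finrank k (Module.Dual k H) :=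
    Subspace.dual_finrank_eq.symm
  exact ⟨hinj, (LinearMap.injective_iff_surjective_of_finrank_eq_finrank hd).mp hinj⟩

theorem E_of_mem_leftCointegrals {lam : Module.Dual k H} (h : lam ∈ Q.leftCointegrals) :
    Q.E Q.dual lam = lam :=
  Q.dual_isQuasiHopfBimodule.E_coe ⟨lam, h⟩

/-- As the left cointegrals form a one-dimensional space, `a ↦ E(a · λ)` acts on a left
cointegral `λ` by a character of `H`. -/
theorem exists_character {lam : Module.Dual k H} (h : lam ∈ Q.leftCointegrals) (h0 : lam ≠ 0) :
    ∃ ν : H →ₐ[k] k, ∀ a, Q.E Q.dual (Q.dual.lact a lam) = ν a • lam := by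
  have hA := Q.dual_isQuasiHopfBimodule
  obtain ⟨x, hx⟩ : ∃ x, lam x ≠ 0 := by
    by_contra! hc
    exact h0 (LinearMap.ext hc)
  have : Nontrivial H := ⟨x, 0, fun hc => hx (by rw [hc, map_zero])⟩
  have h1 : ∀ a, Q.E Q.dual (Q.dual.lact a lam) =
      (Q.E Q.dual (Q.dual.lact a lam) x / lam x) • lam := by
    intro a
    obtain ⟨c, hc⟩ := hA.exists_smul_eq_of_mem_coinvariants Subspace.dual_finrank_eq h h0
      ⟨Q.dual.lact a lam, rfl⟩
    rw [← hc, LinearMap.smul_apply, smul_eq_mul, mul_div_cancel_right₀ _ hx]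
  have hE := Q.E_of_mem_leftCointegrals h
  refine ⟨AlgHom.ofLinearMap ((lam x)⁻¹ • (LinearMap.applyₗ x ∘ₗ Q.E Q.dual ∘ₗ
    Q.dual.lact.flip lam)) ?_ ?_, fun a => ?_⟩
  · simp [hA.lact_one, hE, hx]
  · intro a b
    have h2 := hA.E_lact_E a (Q.dual.lact b lam)
    rw [h1 b, map_smul, map_smul, ← hA.lact_mul] at h2
    simp only [LinearMap.smul_apply, LinearMap.comp_apply, LinearMap.applyₗ_apply_apply,
      LinearMap.flip_apply, ← h2, smul_eq_mul]
    field_simp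
  · rw [h1 a]
    simp [div_eq_inv_mul]

section

variable {Q} {lam : Module.Dual k H} {ν : H →ₐ[k] k}

theorem actE_eq_of_character (hν : ∀ a, Q.E Q.dual (Q.dual.lact a lam) = ν a • lam)
    (t : H ⊗[k] H) : IsQuasiHopfBimodule.actE Q Q.dual lam t = Q.fourier lam
      (Algebra.TensorProduct.lid k H (Algebra.TensorProduct.map ν (AlgHom.id k H) t)) := by
  induction t with
  | zero => simp
  | add x y hx hy => simp only [map_add, hx, hy]
  | tmul x y => simp [hν, fourier_apply]

/-- `a · λ = λ · (a ↼ ν)` -/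
theorem lact_of_character (h : lam ∈ Q.leftCointegrals)
    (hν : ∀ a, Q.E Q.dual (Q.dual.lact a lam) = ν a • lam) (a : H) :
    Q.dual.lact a lam = Q.fourier lam (Q.hit ν a) := by
  have h1 := Q.dual_isQuasiHopfBimodule.lact_E a lam
  rw [Q.E_of_mem_leftCointegrals h, actE_eq_of_character hν] at h1
  exact h1

theorem coact_fourier_of_character (h : lam ∈ Q.leftCointegrals)
    (hν : ∀ a, Q.E Q.dual (Q.dual.lact a lam) = ν a • lam) (b : H) :
    Q.dual.coact (Q.fourier lam b) =
      TensorProduct.map (Q.fourier lam) LinearMap.id (Q.T ν * Q.comul b) := by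
  have hA := Q.dual_isQuasiHopfBimodule
  have h1 : Q.dual.coact lam = TensorProduct.map (Q.fourier lam) LinearMap.id (Q.T ν) := by
    rw [hA.coact_of_E_eq (Q.E_of_mem_leftCointegrals h), T]
    generalize Q.phi.inv = s
    induction s using tensor_induction₃ with
    | zero => simp
    | add x y hx hy => simp only [map_add, hx, hy]
    | pure x y z => simp [hν, TensorProduct.smul_tmul', fourier_apply]
  have h2 : ∀ s t : H ⊗[k] H, Q.dual.ractT H t
      (TensorProduct.map (Q.fourier lam) LinearMap.id s) =
      TensorProduct.map (Q.fourier lam) LinearMap.id (s * t) := by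
    intro s t
    induction s with
    | zero => simp
    | add x y hx hy => simp only [map_add, add_mul, hx, hy]
    | tmul x y =>
      induction t with
      | zero => simp
      | add x y hx hy => simp only [map_add, mul_add, LinearMap.add_apply, hx, hy]
      | tmul a b => simp [fourier_apply, hA.ract_mul]
  rw [fourier_apply, hA.coact_ract, h1, h2]

end

end

/-! ### The modulus -/

theorem counit_S (a : H) : Q.counit (Q.S a) = Q.counit a := by
  have h : ∀ t : H ⊗[k] H, rep2 (Q.invRep Q.counit) Q.counit t = Q.counit (Q.S
      (Algebra.TensorProduct.rid k k H
        (Algebra.TensorProduct.map (AlgHom.id k H) Q.counit t))) := by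
    intro t
    induction t with
    | zero => simp
    | add x y hx hy => simp only [map_add, hx, hy]
    | tmul x y => simp [rep2, invRep_apply, mul_comm]
  rw [← Q.invRep_conv Q.counit a, h, Q.comul_counit]

theorem counit_eq_hit (ν : H →ₐ[k] k) (a : H) : ν (Q.S (Q.hit ν (Q.S a))) = Q.counit a := by
  have h : ∀ t : H ⊗[k] H, rep2 ν (Q.invRep ν) t = ν (Q.S
      (Algebra.TensorProduct.lid k H (Algebra.TensorProduct.map ν (AlgHom.id k H) t))) := by
    intro t
    induction t with
    | zero => simp
    | add x y hx hy => simp only [map_add, hx, hy]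
    | tmul x y => simp [rep2, invRep_apply]
  rw [← Q.counit_S, ← Q.conv_invRep ν, h]
  rfl

/-- The automorphism `a ↦ S(S(a) ↼ ν)` of `H`. -/
def twistedSquare (ν : H →ₐ[k] k) : H ≃ₐ[k] H :=
  AlgEquiv.ofLinearEquiv (Q.S.trans ((Q.hitEquiv ν).toLinearEquiv.trans Q.S))
    (by simp [Q.S_one]) (by simp [Q.S_mul])

theorem twistedSquare_apply (ν : H →ₐ[k] k) (a : H) :
    Q.twistedSquare ν a = Q.S (Q.hit ν (Q.S a)) := rfl

variable {Q} in
/-- A left cointegral `λ` is nondegenerate, and `λ(a b) = λ(b θ(a))` with `θ(a) = S(S(a) ↼ ν)`; so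
the character `ν` of `λ` is the modulus. -/
theorem isModulus_of_character [FiniteDimensional k H] {lam : Module.Dual k H} {ν : H →ₐ[k] k}
    (h : lam ∈ Q.leftCointegrals) (h0 : lam ≠ 0)
    (hν : ∀ a, Q.E Q.dual (Q.dual.lact a lam) = ν a • lam) : Q.IsModulus ν := by
  refine ⟨lam, ?_, Q.twistedSquare ν, fun a b => ?_, fun a => ?_⟩
  · have h1 := (Q.fourier_bijective h h0).comp Q.S.symm.bijective
    convert h1 using 2 with a
    ext b
    change lam (b * a) = lam (b * Q.S (Q.S.symm a))
    rw [LinearEquiv.apply_symm_apply]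
  · have h1 := LinearMap.congr_fun (lact_of_character h hν (Q.S a)) b
    rw [fourier_apply, dual_lact_apply, dual_ract_apply, LinearEquiv.symm_apply_apply] at h1
    exact h1
  · rw [← Q.counit_eq_hit ν, ← twistedSquare_apply, AlgEquiv.apply_symm_apply]

/-- Two nondegenerate functionals differ by a unit `u`, and their modular automorphisms by the
inner automorphism of `u`, on which characters are trivial. -/
theorem IsModulus.unique {μ μ' : H →ₐ[k] k} (h : Q.IsModulus μ) (h' : Q.IsModulus μ') :
    μ = μ' := by
  obtain ⟨ω, hω, θ, hθ, hμ⟩ := h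
  obtain ⟨ω', hω', θ', hθ', hμ'⟩ := h'
  obtain ⟨u, hu⟩ := hω.2 ω'
  obtain ⟨v, hv⟩ := hω'.2 ω
  have hu' : ∀ b, ω' b = ω (b * u) := fun b => (LinearMap.congr_fun hu b).symm
  have hv' : ∀ b, ω b = ω' (b * v) := fun b => (LinearMap.congr_fun hv b).symm
  have hvu : v * u = 1 := by
    apply hω.1
    ext b
    change ω (b * (v * u)) = ω (b * 1)
    rw [mul_one, ← mul_assoc, ← hu', ← hv']
  have hconj : ∀ a, u * θ a = θ' a * u := by
    intro a
    apply hω.1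
    ext b
    change ω (b * (u * θ a)) = ω (b * (θ' a * u))
    rw [← mul_assoc, ← hθ, ← mul_assoc b, ← hu', ← hθ', hu', mul_assoc]
  have hu0 : μ' u ≠ 0 := by
    intro hc
    have := congrArg μ' hvu
    rw [map_mul, hc, mul_zero, map_one] at this
    exact zero_ne_one this
  ext a
  have h1 := congrArg μ' (hconj (θ.symm a))
  rw [map_mul, map_mul, mul_comm, AlgEquiv.apply_symm_apply] at h1
  rw [mul_right_cancel₀ hu0 h1, hμ, hμ', AlgEquiv.symm_apply_apply]

theorem IsModulus.modulus_eq {μ : H →ₐ[k] k} (h : Q.IsModulus μ) : Q.modulus = μ := by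
  have hex : ∃ μ : H →ₐ[k] k, Q.IsModulus μ := ⟨μ, h⟩
  rw [modulus, dif_pos hex]
  exact IsModulus.unique Q hex.choose_spec h

/-! ### Fourier transformations -/

theorem epsId_T (ν : H →ₐ[k] k) : Q.epsId (Q.T ν) = 1 := by
  have h : ∀ s, Q.epsId (Algebra.TensorProduct.lid k (H ⊗[k] H)
      (Algebra.TensorProduct.map ν (AlgHom.id k (H ⊗[k] H)) s)) =
      Algebra.TensorProduct.lid k H (Algebra.TensorProduct.map ν (AlgHom.id k H) (Q.eps₂ s)) := by
    intro s
    induction s using tensor_induction₃ with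
    | zero => simp
    | add x y hx hy => simp only [map_add, hx, hy]
    | pure x y z => simp [smul_comm (ν x)]
  rw [T, h, eps₂_phi_inv, map_one, map_one]

section

variable {Q} [FiniteDimensional k H] {lam : Module.Dual k H}

theorem lact_leftCointegral (h : lam ∈ Q.leftCointegrals) (h0 : lam ≠ 0) (a : H) :
    Q.dual.lact a lam = Q.fourier lam (Q.hit Q.modulus a) := by
  obtain ⟨ν, hν⟩ := Q.exists_character h h0
  rw [IsModulus.modulus_eq Q (isModulus_of_character h h0 hν)]
  exact lact_of_character h hν a

theorem coact_fourier (h : lam ∈ Q.leftCointegrals) (h0 : lam ≠ 0) (b : H) :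
    Q.dual.coact (Q.fourier lam b) =
      TensorProduct.map (Q.fourier lam) LinearMap.id (Q.T Q.modulus * Q.comul b) := by
  obtain ⟨ν, hν⟩ := Q.exists_character h h0
  rw [IsModulus.modulus_eq Q (isModulus_of_character h h0 hν)]
  exact coact_fourier_of_character h hν b

theorem isFourierTransformation_fourier (h : lam ∈ Q.leftCointegrals) (h0 : lam ≠ 0) :
    Q.IsFourierTransformation (Q.fourier lam) := by
  have hA := Q.dual_isQuasiHopfBimodule
  refine ⟨fun hc => h0 ?_, fun a x => ?_, fun a x => ?_, coact_fourier h h0⟩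
  · have := LinearMap.congr_fun hc 1
    rwa [fourier_apply, hA.ract_one] at this
  · change Q.dual.ract (Q.hit Q.modulus a * x) lam = Q.dual.lact a (Q.dual.ract x lam)
    rw [hA.ract_mul, hA.lact_ract, lact_leftCointegral h h0, fourier_apply]
  · exact hA.ract_mul x a lam

variable (Q) in
theorem fourier'_apply (lam : Module.Dual k H) (a : H) :
    Q.fourier' lam a = Q.dual.lact ((Q.hitEquiv Q.modulus).symm a) lam := rfl

theorem fourier'_fourier (h : lam ∈ Q.leftCointegrals) (h0 : lam ≠ 0) (a b : H) :
    Q.fourier' (Q.fourier lam b) a = Q.fourier lam (a * b) := by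
  have hA := Q.dual_isQuasiHopfBimodule
  have e : Q.hit Q.modulus ((Q.hitEquiv Q.modulus).symm a) = a :=
    (Q.hitEquiv Q.modulus).apply_symm_apply a
  rw [fourier'_apply, fourier_apply, hA.lact_ract, lact_leftCointegral h h0, e, fourier_apply,
    fourier_apply, hA.ract_mul]

theorem fourier_fourier (lam : Module.Dual k H) (a b : H) :
    Q.fourier (Q.fourier lam b) a = Q.fourier lam (b * a) :=
  (Q.dual_isQuasiHopfBimodule.ract_mul b a lam).symm

/-- If the coaction of `λ · b` is given by `(F_λ ⊗ id)(s)` with `(ε ⊗ id)(s) = ε(b) 1`, then `b` is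
a scalar. -/
theorem fourier_mem_of_coact_eq (h : lam ∈ Q.leftCointegrals) (h0 : lam ≠ 0) {b : H}
    {s : H ⊗[k] H} (hs : Q.epsId s = Q.counit b • 1)
    (hb : Q.dual.coact (Q.fourier lam b) = TensorProduct.map (Q.fourier lam) LinearMap.id s) :
    Q.fourier lam b ∈ Q.leftCointegrals := by
  have hinj : Function.Injective (TensorProduct.map (Q.fourier lam) (LinearMap.id : H →ₗ[k] H)) :=
    Module.Flat.rTensor_preserves_injective_linearMap _ (Q.fourier_bijective h h0).1
  rw [coact_fourier h h0] at hb
  have h1 := congrArg Q.epsId (hinj hb)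
  rw [map_mul, epsId_T, one_mul, epsId_comul, hs] at h1
  rw [h1, map_smul, fourier_apply, Q.dual_isQuasiHopfBimodule.ract_one]
  exact Submodule.smul_mem _ _ h

end

end QuasiHopfAlgebra

end

theorem proposition5 {k H : Type*} [Field k] [Ring H] [Algebra k H] [FiniteDimensional k H]
    (Q : QuasiHopfAlgebra k H) (lam : Module.Dual k H) (hlam : lam ≠ 0) :
    List.TFAE
      [lam ∈ Q.leftCointegrals,
       Q.IsFourierTransformation (Q.fourier lam),
       ∀ a : H, Q.dual.coact (Q.fourier lam a) =
         TensorProduct.map (Q.fourier lam) LinearMap.id (Q.T Q.modulus * Q.comul a),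
       ∀ a : H, Q.dual.coact (Q.fourier' lam a) =
         TensorProduct.map (Q.fourier' lam) LinearMap.id (Q.T Q.modulus * Q.comul a)] := by
  have : Nontrivial H := by
    by_contra hc
    rw [not_nontrivial_iff_subsingleton] at hc
    exact hlam (Subsingleton.elim _ _)
  obtain ⟨lam₀, h, h0⟩ :=
    Q.dual_isQuasiHopfBimodule.exists_coinvariant_ne_zero Subspace.dual_finrank_eq
  obtain ⟨b, rfl⟩ := (Q.fourier_bijective h h0).2 lam
  tfae_have 1 → 2 := fun hl => QuasiHopfAlgebra.isFourierTransformation_fourier hl hlam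
  tfae_have 2 → 3 := fun hF => hF.2.2.2
  tfae_have 3 → 1 := by
    intro hF
    have h1 := hF 1
    rw [QuasiHopfAlgebra.fourier_fourier, mul_one, map_one, mul_one] at h1
    refine QuasiHopfAlgebra.fourier_mem_of_coact_eq h h0
      (s := (b ⊗ₜ 1) * Q.T Q.modulus) ?_ ?_
    · rw [map_mul, Q.epsId_T, QuasiHopfAlgebra.epsId_tmul, mul_one]
    · rw [h1]
      generalize Q.T Q.modulus = t
      induction t with
      | zero => simp
      | add x y hx hy => simp only [map_add, mul_add, hx, hy]
      | tmul x y => simp [QuasiHopfAlgebra.fourier_fourier]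
  tfae_have 1 → 4 := by
    intro hl a
    have h1 : Q.fourier' (Q.fourier lam₀ b) = Q.fourier (Q.fourier lam₀ b) := by
      refine LinearMap.ext fun x => ?_
      have h2 : Q.fourier (Q.fourier lam₀ b) 1 = Q.fourier lam₀ b := by
        rw [QuasiHopfAlgebra.fourier_fourier, mul_one]
      have h3 := QuasiHopfAlgebra.fourier'_fourier hl hlam x 1
      rwa [h2, mul_one] at h3
    rw [h1]
    exact QuasiHopfAlgebra.coact_fourier hl hlam a
  tfae_have 4 → 1 := by
    intro hF
    have h1 := hF 1
    rw [QuasiHopfAlgebra.fourier'_fourier h h0, one_mul, map_one, mul_one] at h1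
    refine QuasiHopfAlgebra.fourier_mem_of_coact_eq h h0
      (s := Q.T Q.modulus * (b ⊗ₜ 1)) ?_ ?_
    · rw [map_mul, Q.epsId_T, QuasiHopfAlgebra.epsId_tmul, one_mul]
    · rw [h1]
      generalize Q.T Q.modulus = t
      induction t with
      | zero => simp
      | add x y hx hy => simp only [map_add, add_mul, hx, hy]
      | tmul x y => simp [QuasiHopfAlgebra.fourier'_fourier h h0]
  tfae_finish
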